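/- Write $\dot{\mathbb Z}^2=\mathbb Z^2\setminus\{(0,0)\}$, $\langle x\rangle=(1+x^2)^{1/2}$, and $\alpha\cdot\xi=\alpha_1\xi_1+\alpha_2\xi_2$. Let $\alpha\in\mathbb R^2$ satisfy, for some $\gamma>1$ and $C_0>0$, the Diophantine condition $|\alpha\cdot\xi|\ge C_0|\xi|^{-\gamma}$ for all $\xi\in\dot{\mathbb Z}^2$, and let $\max\{\tfrac78,\tfrac\gamma2\}<\theta<1$. For $f(x)=\sum_{\xi\in\dot{\mathbb Z}^2}\widehat f_\xi e^{i(\alpha\cdot\xi)x}$ put $$\|f\|_{G^\theta}=\Big\|\tfrac{\langle\xi_1\rangle^\theta\langle\xi_2\rangle^\theta}{|\alpha\cdot\xi|^{1/2}}\widehat f_\xi\Big\|_{\ell^2_\xi},\qquad \|q\|_{X^{\theta,1/2}}=\Big\|\tfrac{\langle\xi_1\rangle^\theta\langle\xi_2\rangle^\theta}{|\alpha\cdot\xi|^{1/2}}\,\big\|\langle\tau-(\alpha\cdot\xi)^3\rangle^{1/2}\,\mathcal F_t\widehat q_\xi(\tau)\big\|_{L^2_\tau}\Big\|_{\ell^2_\xi},$$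 where $\widehat q_\xi(t)$ are the Fourier coefficients of $q(t)=\sum_{\xi\in\dot{\mathbb Z}^2}\widehat q_\xi(t)e^{i(\alpha\cdot\xi)x}$ and $\mathcal F_t$ is the Fourier transform in time. Let $q_0(x)=\operatorname{sq}(\alpha_1x)+\operatorname{sq}(\alpha_2x)$ with $\operatorname{sq}(x)=\operatorname{sgn}(\sin x)$. Then there is a constant $C$, depending only on $\alpha,\gamma,C_0,\theta$, such that the following holds. Let $T>0$, let $\eta,\eta_T:\mathbb R\to\mathbb R$ be smooth compactly supported functions equal to $1$ on $[-T,T]$, and let $q\in C(\mathbb R;G^\theta)\cap X^{\theta,1/2}$ solve the truncated Duhamel formulation of the KdV equation $\partial_tq=-\partial_x^3q+3\partial_x(q^2)$ with initial data $q_0$, $$q(t)=\eta(t)e^{-t\partial_x^3}q_0+3\eta(t)\int_0^te^{-(t-s)\partial_x^3}\partial_x(\eta_Tq^2)(s)\,ds\qquad(t\in\mathbb R).$$ Then the difference between the KdV and Airy evolutions has $\ell^1$ Fourier coefficients, uniformly for $|t|\le T$, and $$\sup_{|t|\le T}\ \sum_{\xi\in\dot{\mathbb Z}^2}\big|\widehat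 q_\xi(t)-e^{it(\alpha\cdot\xi)^3}\widehat q_\xi(0)\big|\le C\Big[(1+\|q\|_{X^{\theta,1/2}})\|q\|_{X^{\theta,1/2}}^2+(1+T)(1+\|q\|_{L^\infty_tG^\theta})\|q\|_{L^\infty_tG^\theta}^2\Big]<\infty.$$ -/

import Mathlib

open MeasureTheory Filter Topology
open scoped ENNReal NNReal SchwartzMap

namespace QPKdV

noncomputable section

/-- The punctured lattice `ℤ² \ {(0,0)}` of frequency labels. -/
abbrev Freq : Type := {ξ : ℤ × ℤ // ξ ≠ 0}

/-- The actual frequency `α · ξ = α₁ ξ₁ + α₂ ξ₂`. -/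
def freq (α : ℝ × ℝ) (ξ : Freq) : ℝ := α.1 * (ξ.1.1 : ℝ) + α.2 * (ξ.1.2 : ℝ)

/-- The Japanese bracket `⟨x⟩ = (1 + x²)^{1/2}`. -/
def jb (x : ℝ) : ℝ := Real.sqrt (1 + x ^ 2)

/-- The diophantine condition `|α · ξ| ≥ C₀ |ξ|^{-γ}` for all `ξ ∈ ℤ² \ {0}`, where `|ξ|` is the
Euclidean length. -/
def Diophantine (α : ℝ × ℝ) (γ C₀ : ℝ) : Prop :=
  ∀ ξ : Freq, C₀ * Real.sqrt ((ξ.1.1 : ℝ) ^ 2 + (ξ.1.2 : ℝ) ^ 2) ^ (-γ) ≤ |freq α ξ|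

/-- The square wave `sgn (sin x)`, of period `2π`. -/
def squareWave (x : ℝ) : ℝ := Real.sign (Real.sin x)

/-- The quasiperiodic data `sq(α₁ x) + sq(α₂ x)`. -/
def squareData (α : ℝ × ℝ) (x : ℝ) : ℝ := squareWave (α.1 * x) + squareWave (α.2 * x)

/-- `f(x) = ∑_ξ c_ξ e^{i(α·ξ)x}`, the series being (unconditionally) convergent in the sense of
tempered distributions. -/
def IsSeriesOf (α : ℝ × ℝ) (c : Freq → ℂ) (f : ℝ → ℝ) : Prop :=
  ∀ φ : 𝓢(ℝ, ℂ),
    HasSum (fun ξ : Freq => c ξ * ∫ x : ℝ, Complex.exp (Complex.I * ((freq α ξ * x : ℝ) : ℂ)) * φ x)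
      (∫ x : ℝ, (f x : ℂ) * φ x)

/-- The weight `⟨ξ₁⟩^θ ⟨ξ₂⟩^θ / |α · ξ|^{1/2}`. -/
def weight (α : ℝ × ℝ) (θ : ℝ) (ξ : Freq) : ℝ :=
  jb (ξ.1.1 : ℝ) ^ θ * jb (ξ.1.2 : ℝ) ^ θ / |freq α ξ| ^ (1 / 2 : ℝ)

/-- The weighted `ℓ²` norm (with values in `[0,∞]`) of a family of nonnegative numbers. -/
def hatNorm (α : ℝ × ℝ) (θ : ℝ) (a : Freq → ℝ≥0∞) : ℝ≥0∞ :=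
  (∑' ξ : Freq, (ENNReal.ofReal (weight α θ ξ) * a ξ) ^ 2) ^ (1 / 2 : ℝ)

/-- The norm of `G^θ`. An element `∑_ξ f_ξ e^{i(α·ξ)x}` of `G^θ` is given by its family
`f : Freq → ℂ` of coefficients; it belongs to `G^θ` if and only if this norm is finite. -/
def gNorm (α : ℝ × ℝ) (θ : ℝ) (f : Freq → ℂ) : ℝ≥0∞ := hatNorm α θ (fun ξ => ‖f ξ‖ₑ)

/-- `q ∈ C(ℝ; G^θ)`; here `q t ξ` is the spatial Fourier coefficient of `q(t)` at `ξ`. -/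
def IsContinuousInG (α : ℝ × ℝ) (θ : ℝ) (q : ℝ → Freq → ℂ) : Prop :=
  (∀ t, gNorm α θ (q t) < ∞) ∧
    ∀ t₀, Tendsto (fun t => gNorm α θ (q t - q t₀)) (𝓝 t₀) (𝓝 0)

/-- The norm of `L^∞_t G^θ`. It is only applied to continuous functions of time with values in
`G^θ`, for which the essential supremum is the supremum. -/
def linftyGNorm (α : ℝ × ℝ) (θ : ℝ) (q : ℝ → Freq → ℂ) : ℝ≥0∞ := ⨆ t : ℝ, gNorm α θ (q t)

/-- The (unitary) Fourier transform in time. It is only applied to continuous functions of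
compact support. -/
def timeFourier (f : ℝ → ℂ) (τ : ℝ) : ℂ :=
  ((Real.sqrt (2 * Real.pi))⁻¹ : ℝ) * ∫ t : ℝ, Complex.exp (-(Complex.I * ((τ * t : ℝ) : ℂ))) * f t

/-- The norm `‖⟨τ - (α·ξ)³⟩^{1/2} ℱ_{t,x} q(τ, ξ)‖` of `X^{θ,1/2}`: first `L²` in `τ`, then the
weighted `ℓ²` norm in `ξ`. -/
def xNorm (α : ℝ × ℝ) (θ : ℝ) (q : ℝ → Freq → ℂ) : ℝ≥0∞ :=
  hatNorm α θ (fun ξ =>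
    eLpNorm (fun τ : ℝ =>
      ((jb (τ - freq α ξ ^ 3) ^ (1 / 2 : ℝ) : ℝ) : ℂ) * timeFourier (fun t => q t ξ) τ) 2 volume)

/-- The Fourier coefficient of `f²` at `ξ`: the sum of `f_{ξ⁽¹⁾} f_{ξ⁽²⁾}` over all decompositions
`ξ = ξ⁽¹⁾ + ξ⁽²⁾` with `ξ⁽¹⁾, ξ⁽²⁾ ≠ 0`. -/
def squareCoeff (f : Freq → ℂ) (ξ : Freq) : ℂ :=
  ∑' p : {p : Freq × Freq // p.1.1 + p.2.1 = ξ.1}, f p.1.1 * f p.1.2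

/-- The Fourier multiplier `e^{it(α·ξ)³}` of the Airy propagator `e^{-t∂ₓ³}`. -/
def airy (α : ℝ × ℝ) (t : ℝ) (ξ : Freq) : ℂ :=
  Complex.exp (Complex.I * ((t * freq α ξ ^ 3 : ℝ) : ℂ))

/-- A smooth, compactly supported cutoff function in time that is `1` on `[-T, T]`. -/
def IsTimeCutoff (T : ℝ) (η : ℝ → ℝ) : Prop :=
  ContDiff ℝ ((⊤ : ℕ∞) : WithTop ℕ∞) η ∧ HasCompactSupport η ∧ ∀ t, |t| ≤ T → η t = 1

/-- The truncated Duhamel formulation of KdV, `q_t = -q_xxx + 3 (q²)_x`,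
`q(t) = η(t) e^{-t∂ₓ³} q₀ + 3 η(t) ∫₀ᵗ e^{-(t-s)∂ₓ³} ∂ₓ (η_T q²)(s) ds`,
written for the spatial Fourier coefficients (`∂ₓ` removes the zeroth coefficient of `q²`). -/
def SolvesDuhamel (α : ℝ × ℝ) (η ηT : ℝ → ℝ) (q₀ : Freq → ℂ) (q : ℝ → Freq → ℂ) : Prop :=
  ∀ (t : ℝ) (ξ : Freq),
    q t ξ = (η t : ℂ) * (airy α t ξ * q₀ ξ) +
      3 * (η t : ℂ) * ∫ s in (0 : ℝ)..t,
        airy α (t - s) ξ * ((Complex.I * (freq α ξ : ℂ)) * ((ηT s : ℂ) * squareCoeff (q s) ξ))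

/-- The `ℓ¹` norm of the Fourier coefficients of the difference, at time `t`, between `q(t)` and
the Airy evolution of `q(0)`. -/
def smoothingNorm (α : ℝ × ℝ) (q : ℝ → Freq → ℂ) (t : ℝ) : ℝ≥0∞ :=
  ∑' ξ : Freq, ‖q t ξ - airy α t ξ * q 0 ξ‖ₑ

end

end QPKdV

namespace QPKdV

open FourierTransform Convolution ComplexConjugate

/-! Write ω(ξ) = α·ξ. By Duhamel the difference to be estimated is, up to a unimodular factor,
3iω(ξ) ∫₀ᵗ e^{-isω(ξ)³} (q²)^_ξ(s) ds. If ξ = a + b then ω(ξ)³ - ω(a)³ - ω(b)³ = 3ω(a)ω(b)ω(ξ), so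
integrating by parts in time (`LatticeSolution.integral_mode_eq`) trades the derivative ω(ξ) for
1/(ω(a)ω(b)). What remains is a pair of boundary terms and a cubic term in which one mode carries
1/ω and the other has been replaced by q² without its zero mode.

The boundary terms are in ℓ¹ because q̂/ω is. By Cauchy–Schwarz this reduces to the convergence of ∑
|ω|⁻¹ (⟨ξ₁⟩⟨ξ₂⟩)^{-2θ}. Small divisors occur only in the strip |ω| < 1, where ⟨ξ₁⟩ and ⟨ξ₂⟩ are
comparable: there |ω|⁻¹ ≲ (⟨ξ₁⟩⟨ξ₂⟩)^{γ/2} and the sum is essentially one-dimensional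
(`Diophantine.tsum_latFreq_rpow_ne_top`).

For modes x, y, z the cubic term oscillates with frequency Φ = 3(ω(x)+ω(y))(ω(x)+ω(z))(ω(y)+ω(z)).
The case x + y = 0 is absent since ω(0) = 0. On x + z = 0 and y + z = 0 the factor 1/ω(z) is odd, so
the resonant sums cancel except for the single interaction (ξ, ξ, -ξ)
(`LatticeSolution.tsum_cubicTerm_eq`), which is bounded without oscillation at the cost of a factor
T. Elsewhere Φ ≠ 0, and the time integral gains ⟨Φ⟩^{-1/4} against the H^{1/2} norms of the modes in
the frame of the Airy flow (`exists_enorm_integral_oscillating_le`); the weighted ℓ² norm of these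
is the X norm. Cauchy–Schwarz in (x, y, z) leaves a numerical kernel sum, finite for θ > 7/8 and γ <
2 (`Diophantine.tsum_cubicKernel_ne_top`). -/

/-! ### Fourier transform in time: Parseval and Plancherel. -/

theorem timeFourier_eq_fourier (f : ℝ → ℂ) (τ : ℝ) :
    timeFourier f τ = ((Real.sqrt (2 * Real.pi))⁻¹ : ℝ) * 𝓕 f (τ / (2 * Real.pi)) := by
  rw [timeFourier, Real.fourier_real_eq_integral_exp_smul]
  congr 2
  ext t
  rw [smul_eq_mul]
  congr 2
  have : (Real.pi : ℂ) ≠ 0 := by exact_mod_cast Real.pi_ne_zero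
  push_cast
  field_simp

theorem continuous_timeFourier {f : ℝ → ℂ} (hf : Continuous f) (hc : HasCompactSupport f) :
    Continuous (timeFourier f) := by
  have h : Continuous (𝓕 f) :=
    VectorFourier.fourierIntegral_continuous Real.continuous_fourierChar
      (by exact continuous_inner) (hf.integrable_of_hasCompactSupport hc)
  have : timeFourier f = fun τ =>
      ((Real.sqrt (2 * Real.pi))⁻¹ : ℝ) * 𝓕 f (τ / (2 * Real.pi)) :=
    funext (timeFourier_eq_fourier f)
  rw [this]
  exact continuous_const.mul (h.comp (continuous_id.div_const _))

/-- Parseval's identity, through Fourier inversion for a correlation at the origin. -/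
theorem integral_mul_conj_eq {f g : ℝ → ℂ} (hf : Continuous f) (hfc : HasCompactSupport f)
    (hg : Continuous g) (hgc : HasCompactSupport g)
    (hi : Integrable fun τ => timeFourier f τ * conj (timeFourier g τ)) :
    ∫ t, f t * conj (g t) = ∫ τ, timeFourier f τ * conj (timeFourier g τ) := by
  set k : ℝ → ℂ := fun t => conj (g (-t)) with hk
  have hkc : Continuous k := Complex.continuous_conj.comp (hg.comp continuous_neg)
  have hks : HasCompactSupport k :=
    (hgc.comp_homeomorph (Homeomorph.neg ℝ)).comp_left (g := fun z : ℂ => conj z) (map_zero _)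
  have hfi := hf.integrable_of_hasCompactSupport hfc (μ := volume)
  have hki := hkc.integrable_of_hasCompactSupport hks (μ := volume)
  set F : ℝ → ℂ := f ⋆[ContinuousLinearMap.mul ℂ ℂ, volume] k with hF
  have hFc : Continuous F :=
    hks.continuous_convolution_right _ hfi.locallyIntegrable hkc
  have hFs : HasCompactSupport F := HasCompactSupport.convolution _ hfc hks
  have hkF : ∀ w, 𝓕 k w = conj (𝓕 g w) := by
    intro w
    rw [Real.fourier_real_eq_integral_exp_smul, Real.fourier_real_eq_integral_exp_smul,
      ← integral_conj, ← integral_neg_eq_self]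
    congr 1
    ext t
    simp only [hk, neg_neg, smul_eq_mul, map_mul, ← Complex.exp_conj, Complex.conj_ofReal,
      Complex.conj_I]
    congr 2
    push_cast
    ring
  have hFF : 𝓕 F = fun w => 𝓕 f w * conj (𝓕 g w) := by
    ext w
    rw [hF, Real.fourier_mul_convolution_eq hfi hki, hkF]
  have h2pi : (0 : ℝ) < 2 * Real.pi := by positivity
  set P : ℝ → ℂ := fun τ => timeFourier f τ * conj (timeFourier g τ) with hP
  have hsc : ∀ w, 𝓕 f w * conj (𝓕 g w) = (2 * Real.pi : ℝ) • P ((2 * Real.pi) * w) := by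
    intro w
    rw [hP]
    have h1 : (2 * Real.pi * w) / (2 * Real.pi) = w := by field_simp
    simp only [timeFourier_eq_fourier, h1, map_mul, Complex.conj_ofReal, Complex.real_smul]
    have : (((Real.sqrt (2 * Real.pi))⁻¹ : ℝ) : ℂ) * (((Real.sqrt (2 * Real.pi))⁻¹ : ℝ) : ℂ)
        = (((2 * Real.pi)⁻¹ : ℝ) : ℂ) := by
      rw [← Complex.ofReal_mul, ← mul_inv, Real.mul_self_sqrt h2pi.le]
    have h3 : ((2 * Real.pi : ℝ) : ℂ) * (((2 * Real.pi)⁻¹ : ℝ) : ℂ) = 1 := by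
      rw [← Complex.ofReal_mul, mul_inv_cancel₀ h2pi.ne', Complex.ofReal_one]
    rw [mul_mul_mul_comm, this, ← mul_assoc, h3, one_mul]
  have hFi : Integrable (𝓕 F) := by
    rw [hFF, funext hsc]
    exact (hi.comp_mul_left' h2pi.ne').smul (2 * Real.pi : ℝ)
  have hinv := (hFc.integrable_of_hasCompactSupport hFs).fourierInv_fourier_eq hFi
    (v := 0) hFc.continuousAt
  have h0 : F 0 = ∫ t, f t * conj (g t) := by
    simp [hF, convolution, hk]
  rw [← h0, ← hinv, Real.fourierInv_eq', hFF]
  simp only [inner_zero_right, mul_zero, Complex.ofReal_zero, zero_mul, Complex.exp_zero, one_smul]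
  rw [funext hsc, integral_smul, Measure.integral_comp_mul_left P, smul_smul,
    abs_of_pos (inv_pos.2 h2pi), mul_inv_cancel₀ h2pi.ne', one_smul]

theorem enorm_sq_eq_ofReal (z : ℂ) : ‖z‖ₑ ^ 2 = ENNReal.ofReal (‖z‖ ^ 2) := by
  rw [ENNReal.ofReal_pow (norm_nonneg _), ofReal_norm]

/-- Plancherel's inequality for continuous functions of compact support. -/
theorem lintegral_enorm_sq_le {f : ℝ → ℂ} (hf : Continuous f) (hfc : HasCompactSupport f) :
    ∫⁻ t, ‖f t‖ₑ ^ 2 ≤ ∫⁻ τ, ‖timeFourier f τ‖ₑ ^ 2 := by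
  by_cases htop : ∫⁻ τ, ‖timeFourier f τ‖ₑ ^ 2 = ∞
  · rw [htop]; exact le_top
  have hm := continuous_timeFourier hf hfc
  have hsq : Integrable fun τ => ‖timeFourier f τ‖ ^ 2 := by
    refine ⟨(hm.norm.pow 2).aestronglyMeasurable, ?_⟩
    rw [hasFiniteIntegral_iff_ofReal (ae_of_all _ fun _ => by positivity)]
    simp only [← enorm_sq_eq_ofReal]
    exact lt_top_iff_ne_top.2 htop
  have hmc : ∀ z : ℂ, z * conj z = ((‖z‖ ^ 2 : ℝ) : ℂ) := fun z => by
    rw [Complex.mul_conj, Complex.normSq_eq_norm_sq]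
  have h := integral_mul_conj_eq hf hfc hf hfc (by simp only [hmc]; exact hsq.ofReal)
  simp only [hmc, integral_complex_ofReal] at h
  have h' : ∫ t, ‖f t‖ ^ 2 = ∫ τ, ‖timeFourier f τ‖ ^ 2 := by exact_mod_cast h
  have hfc2 : HasCompactSupport fun t => ‖f t‖ ^ 2 :=
    hfc.comp_left (g := fun z : ℂ => ‖z‖ ^ 2) (by simp)
  have hfi : Integrable fun t => ‖f t‖ ^ 2 :=
    (hf.norm.pow 2).integrable_of_hasCompactSupport hfc2
  simp only [enorm_sq_eq_ofReal]
  rw [← ofReal_integral_eq_lintegral_ofReal hfi (ae_of_all _ fun _ => by positivity),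
    ← ofReal_integral_eq_lintegral_ofReal hsq (ae_of_all _ fun _ => by positivity), h']

/-! ### The space H^{1/2} in time: modulus of continuity and embedding into L⁴. -/

theorem jb_pos (x : ℝ) : 0 < jb x := Real.sqrt_pos.2 (by positivity)

theorem one_le_jb (x : ℝ) : 1 ≤ jb x := Real.one_le_sqrt.2 (by nlinarith [sq_nonneg x])

theorem abs_le_jb (x : ℝ) : |x| ≤ jb x := Real.abs_le_sqrt (by linarith)

theorem jb_sq (x : ℝ) : jb x ^ 2 = 1 + x ^ 2 := Real.sq_sqrt (by positivity)

theorem continuous_jb : Continuous jb := by unfold jb; fun_prop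

/-- The norm `‖⟨τ⟩^{1/2} ℱ f‖_{L²}` of `H^{1/2}`. -/
noncomputable def halfNorm (f : ℝ → ℂ) : ℝ≥0∞ :=
  eLpNorm (fun τ : ℝ => ((jb τ ^ (1 / 2 : ℝ) : ℝ) : ℂ) * timeFourier f τ) 2 volume

theorem halfNorm_sq (f : ℝ → ℂ) :
    halfNorm f ^ 2 = ∫⁻ τ, ENNReal.ofReal (jb τ) * ‖timeFourier f τ‖ₑ ^ 2 := by
  rw [halfNorm, eLpNorm_eq_lintegral_rpow_enorm_toReal two_ne_zero ENNReal.ofNat_ne_top,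
    ← ENNReal.rpow_natCast, ← ENNReal.rpow_mul]
  norm_num
  congr 1
  ext τ
  rw [mul_pow]
  congr 1
  rw [enorm_sq_eq_ofReal, Complex.norm_real, Real.norm_of_nonneg (by have := jb_pos τ; positivity),
    ← Real.rpow_natCast, ← Real.rpow_mul (jb_pos τ).le]
  norm_num

theorem lintegral_enorm_sq_le_halfNorm {f : ℝ → ℂ} (hf : Continuous f)
    (hfc : HasCompactSupport f) : ∫⁻ t, ‖f t‖ₑ ^ 2 ≤ halfNorm f ^ 2 := by
  refine (lintegral_enorm_sq_le hf hfc).trans ?_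
  rw [halfNorm_sq]
  refine lintegral_mono fun τ => ?_
  calc ‖timeFourier f τ‖ₑ ^ 2 = 1 * ‖timeFourier f τ‖ₑ ^ 2 := (one_mul _).symm
    _ ≤ _ := by
      gcongr
      rw [← ENNReal.ofReal_one]
      exact ENNReal.ofReal_le_ofReal (one_le_jb τ)

/-- Serves twice: to compute the transform of |f|², and to move the weight ⟨τ - ω³⟩ of the X norm to
⟨τ⟩. -/
theorem timeFourier_modulate (f : ℝ → ℂ) (a τ : ℝ) :
    timeFourier (fun t => Complex.exp (-(Complex.I * ((a * t : ℝ) : ℂ))) * f t) τ =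
      timeFourier f (τ + a) := by
  simp only [timeFourier]
  congr 2
  ext t
  rw [← mul_assoc, ← Complex.exp_add]
  congr 2
  push_cast
  ring

theorem timeFourier_translate (f : ℝ → ℂ) (h τ : ℝ) :
    timeFourier (fun t => f (t + h)) τ =
      Complex.exp (Complex.I * ((τ * h : ℝ) : ℂ)) * timeFourier f τ := by
  simp only [timeFourier]
  rw [mul_left_comm]
  congr 1
  rw [← integral_const_mul, ← integral_add_right_eq_self (fun t : ℝ => Complex.exp (Complex.I * ((τ * h : ℝ) : ℂ)) *
    (Complex.exp (-(Complex.I * ((τ * t : ℝ) : ℂ))) * f t)) h]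
  congr 1
  ext t
  rw [← mul_assoc, ← Complex.exp_add]
  congr 2
  push_cast
  ring

theorem HasCompactSupport.comp_add_right {f : ℝ → ℂ} (hfc : HasCompactSupport f) (h : ℝ) :
    HasCompactSupport fun t => f (t + h) :=
  hfc.comp_homeomorph (Homeomorph.addRight h)

theorem integrable_timeFourier_integrand {f : ℝ → ℂ} (hf : Continuous f)
    (hfc : HasCompactSupport f) (τ : ℝ) :
    Integrable fun t : ℝ => Complex.exp (-(Complex.I * ((τ * t : ℝ) : ℂ))) * f t :=
  Continuous.integrable_of_hasCompactSupport (by fun_prop) hfc.mul_left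

theorem timeFourier_sub {f g : ℝ → ℂ} (hf : Continuous f) (hfc : HasCompactSupport f)
    (hg : Continuous g) (hgc : HasCompactSupport g) (τ : ℝ) :
    timeFourier (fun t => f t - g t) τ = timeFourier f τ - timeFourier g τ := by
  simp only [timeFourier, mul_sub]
  rw [integral_sub (integrable_timeFourier_integrand hf hfc τ)
    (integrable_timeFourier_integrand hg hgc τ), mul_sub]

/-- Product of the bounds |x| and 2; being linear in |x|, it is absorbed by the weight ⟨τ⟩ of
H^{1/2}. -/
theorem norm_exp_I_sub_one_sq_le (x : ℝ) :
    ‖Complex.exp (Complex.I * ((x : ℝ) : ℂ)) - 1‖ ^ 2 ≤ 2 * |x| := by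
  have h1 : ‖Complex.exp (Complex.I * ((x : ℝ) : ℂ)) - 1‖ ≤ |x| := by
    simpa using Real.norm_exp_I_mul_ofReal_sub_one_le (x := x)
  have h2 : ‖Complex.exp (Complex.I * ((x : ℝ) : ℂ)) - 1‖ ≤ 2 := by
    refine (norm_sub_le _ _).trans ?_
    rw [mul_comm, Complex.norm_exp_ofReal_mul_I]
    norm_num
  rw [sq]
  exact mul_le_mul h2 h1 (norm_nonneg _) (by norm_num)

/-- The modulus of continuity in `L²` of a function of `H^{1/2}`. -/
theorem lintegral_enorm_sub_translate_sq_le {f : ℝ → ℂ} (hf : Continuous f)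
    (hfc : HasCompactSupport f) (h : ℝ) :
    ∫⁻ t, ‖f (t + h) - f t‖ₑ ^ 2 ≤ ENNReal.ofReal (2 * |h|) * halfNorm f ^ 2 := by
  have hf' : Continuous fun t => f (t + h) := by fun_prop
  have hfc' := HasCompactSupport.comp_add_right hfc h
  refine (lintegral_enorm_sq_le (hf'.sub hf) (hfc'.sub hfc)).trans ?_
  rw [halfNorm_sq, ← lintegral_const_mul' _ _ ENNReal.ofReal_ne_top]
  refine lintegral_mono fun τ => ?_
  have h1 : timeFourier (fun t => f (t + h) - f t) τ =
      (Complex.exp (Complex.I * ((τ * h : ℝ) : ℂ)) - 1) * timeFourier f τ := by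
    rw [timeFourier_sub hf' hfc' hf hfc, timeFourier_translate]
    ring
  have h2 : ‖Complex.exp (Complex.I * ((τ * h : ℝ) : ℂ)) - 1‖ₑ ^ 2 ≤
      ENNReal.ofReal (2 * |h|) * ENNReal.ofReal (jb τ) := by
    rw [enorm_sq_eq_ofReal, ← ENNReal.ofReal_mul (by positivity)]
    refine ENNReal.ofReal_le_ofReal ((norm_exp_I_sub_one_sq_le _).trans ?_)
    rw [abs_mul]
    nlinarith [abs_le_jb τ, abs_nonneg h]
  change ‖timeFourier (fun t => f (t + h) - f t) τ‖ₑ ^ 2 ≤ _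
  rw [h1, enorm_mul, mul_pow, ← mul_assoc]
  gcongr

/-- The Cauchy–Schwarz inequality for the lower integral, in squared form. -/
theorem lintegral_mul_sq_le {X : Type*} [MeasurableSpace X] (μ : Measure X) {f g : X → ℝ≥0∞}
    (hf : AEMeasurable f μ) (hg : AEMeasurable g μ) :
    (∫⁻ x, f x * g x ∂μ) ^ 2 ≤ (∫⁻ x, f x ^ 2 ∂μ) * ∫⁻ x, g x ^ 2 ∂μ := by
  have h := ENNReal.lintegral_mul_le_Lp_mul_Lq μ Real.HolderConjugate.two_two hf hg
  calc (∫⁻ x, f x * g x ∂μ) ^ 2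
      ≤ ((∫⁻ x, f x ^ (2 : ℝ) ∂μ) ^ (1 / 2 : ℝ) * (∫⁻ x, g x ^ (2 : ℝ) ∂μ) ^ (1 / 2 : ℝ)) ^ 2 := by
        gcongr; exact h
    _ = _ := by
        rw [mul_pow, ← ENNReal.rpow_natCast, ← ENNReal.rpow_natCast, ← ENNReal.rpow_mul,
          ← ENNReal.rpow_mul]
        norm_num

/-- AM–GM and translation invariance. Uniformity in the shift is what the L⁴ embedding needs. -/
theorem lintegral_inv_jb_mul_inv_jb_le (a : ℝ) :
    ∫⁻ τ, ENNReal.ofReal ((jb τ)⁻¹ * (jb (τ + a))⁻¹) ≤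
      ∫⁻ τ, ENNReal.ofReal ((1 + τ ^ 2)⁻¹) := by
  have hm : Measurable fun τ : ℝ => ENNReal.ofReal ((1 + τ ^ 2)⁻¹) := by fun_prop
  have h1 : ∀ τ, ENNReal.ofReal ((jb τ)⁻¹ * (jb (τ + a))⁻¹) ≤
      2⁻¹ * (ENNReal.ofReal ((1 + τ ^ 2)⁻¹) + ENNReal.ofReal ((1 + (τ + a) ^ 2)⁻¹)) := by
    intro τ
    have h2 : (2⁻¹ : ℝ≥0∞) = ENNReal.ofReal 2⁻¹ := by
      rw [ENNReal.ofReal_inv_of_pos two_pos]; norm_num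
    rw [← ENNReal.ofReal_add (by positivity) (by positivity), h2,
      ← ENNReal.ofReal_mul (by positivity), ← jb_sq, ← jb_sq]
    refine ENNReal.ofReal_le_ofReal ?_
    have := sq_nonneg ((jb τ)⁻¹ - (jb (τ + a))⁻¹)
    rw [← inv_pow, ← inv_pow]
    nlinarith
  refine (lintegral_mono h1).trans ?_
  rw [lintegral_const_mul' _ _ (by simp), lintegral_add_left hm,
    lintegral_add_right_eq_self (fun τ : ℝ => ENNReal.ofReal ((1 + τ ^ 2)⁻¹)) a, ← two_mul,
    ← mul_assoc, ENNReal.inv_mul_cancel two_ne_zero ENNReal.ofNat_ne_top, one_mul]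

/-- Parseval for f and its modulation by e^{-iτt}: the transform of |f|² is an autocorrelation of
the transform of f. Finiteness of `halfNorm f` makes the product integrable. -/
theorem timeFourier_normSq {f : ℝ → ℂ} (hf : Continuous f) (hfc : HasCompactSupport f)
    (hA : halfNorm f ≠ ∞) (τ : ℝ) :
    ‖timeFourier (fun t => f t * conj (f t)) τ‖ₑ ≤
      ∫⁻ σ, ‖timeFourier f (σ + τ)‖ₑ * ‖timeFourier f σ‖ₑ := by
  set g : ℝ → ℂ := fun t => Complex.exp (-(Complex.I * ((τ * t : ℝ) : ℂ))) * f t with hg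
  have hgf : Continuous g := by fun_prop
  have hgc : HasCompactSupport g := hfc.mul_left
  have hgt : ∀ σ, timeFourier g σ = timeFourier f (σ + τ) := timeFourier_modulate f τ
  have hc := continuous_timeFourier hf hfc
  have hA2 : ∫⁻ σ, ‖timeFourier f σ‖ₑ ^ 2 ≠ ∞ := by
    refine ne_top_of_le_ne_top (ENNReal.pow_ne_top hA (n := 2)) ?_
    rw [halfNorm_sq]
    refine lintegral_mono fun σ => le_mul_of_one_le_left (by positivity) ?_
    rw [← ENNReal.ofReal_one]
    exact ENNReal.ofReal_le_ofReal (one_le_jb σ)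
  have hfin : ∫⁻ σ, ‖timeFourier f (σ + τ)‖ₑ * ‖timeFourier f σ‖ₑ ≠ ∞ := by
    intro h
    have h1 := lintegral_mul_sq_le volume (f := fun σ => ‖timeFourier f (σ + τ)‖ₑ)
      (g := fun σ => ‖timeFourier f σ‖ₑ) (by fun_prop) (by fun_prop)
    rw [h, lintegral_add_right_eq_self (fun σ => ‖timeFourier f σ‖ₑ ^ 2) τ] at h1
    exact ENNReal.mul_ne_top hA2 hA2 (top_le_iff.1 (by simpa using h1))
  have hi : Integrable fun σ => timeFourier g σ * conj (timeFourier f σ) := by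
    simp only [hgt]
    refine ⟨Continuous.aestronglyMeasurable (by fun_prop), ?_⟩
    rw [HasFiniteIntegral]
    refine lt_of_le_of_lt (le_of_eq ?_) (lt_top_iff_ne_top.2 hfin)
    congr 1 with σ
    rw [enorm_mul, RCLike.enorm_conj]
  have hP := integral_mul_conj_eq hgf hgc hf hfc hi
  have h1 : timeFourier (fun t => f t * conj (f t)) τ =
      ((Real.sqrt (2 * Real.pi))⁻¹ : ℝ) *
        ∫ σ, timeFourier f (σ + τ) * conj (timeFourier f σ) := by
    rw [timeFourier]
    simp only [hgt] at hP
    rw [← hP]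
    simp only [hg, mul_assoc]
  have h2 : ‖(((Real.sqrt (2 * Real.pi))⁻¹ : ℝ) : ℂ)‖ₑ ≤ 1 := by
    rw [← ofReal_norm, ← ENNReal.ofReal_one]
    refine ENNReal.ofReal_le_ofReal ?_
    rw [Complex.norm_real, Real.norm_of_nonneg (by positivity)]
    exact inv_le_one_of_one_le₀ (Real.one_le_sqrt.2 (by linarith [Real.pi_gt_three]))
  rw [h1, enorm_mul]
  refine (mul_le_mul' h2 (enorm_integral_le_lintegral_enorm _)).trans (le_of_eq ?_)
  rw [one_mul]
  congr 1 with σ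
  rw [enorm_mul, RCLike.enorm_conj]

/-- Cauchy–Schwarz after inserting the weight ⟨σ⟩^{1/2}⟨σ+τ⟩^{1/2} and its inverse. -/
theorem timeFourier_normSq_sq {f : ℝ → ℂ} (hf : Continuous f) (hfc : HasCompactSupport f)
    (hA : halfNorm f ≠ ∞) (τ : ℝ) :
    ‖timeFourier (fun t => f t * conj (f t)) τ‖ₑ ^ 2 ≤
      (∫⁻ σ, ENNReal.ofReal ((1 + σ ^ 2)⁻¹)) *
        ∫⁻ σ, (ENNReal.ofReal (jb (σ + τ)) * ‖timeFourier f (σ + τ)‖ₑ ^ 2) *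
          (ENNReal.ofReal (jb σ) * ‖timeFourier f σ‖ₑ ^ 2) := by
  have hc := continuous_timeFourier hf hfc
  have hj := continuous_jb
  have key : ∀ σ, ‖timeFourier f (σ + τ)‖ₑ * ‖timeFourier f σ‖ₑ =
      ENNReal.ofReal (Real.sqrt ((jb σ)⁻¹ * (jb (σ + τ))⁻¹)) *
        (ENNReal.ofReal (Real.sqrt (jb (σ + τ) * jb σ)) *
          (‖timeFourier f (σ + τ)‖ₑ * ‖timeFourier f σ‖ₑ)) := by
    intro σ
    have h1 := jb_pos σ
    have h2 := jb_pos (σ + τ)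
    rw [← mul_assoc, ← ENNReal.ofReal_mul (by positivity), ← Real.sqrt_mul (by positivity)]
    have : (jb σ)⁻¹ * (jb (σ + τ))⁻¹ * (jb (σ + τ) * jb σ) = 1 := by field_simp
    rw [this]
    simp
  calc _ ≤ (∫⁻ σ, ‖timeFourier f (σ + τ)‖ₑ * ‖timeFourier f σ‖ₑ) ^ 2 := by
        gcongr; exact timeFourier_normSq hf hfc hA τ
    _ = (∫⁻ σ, ENNReal.ofReal (Real.sqrt ((jb σ)⁻¹ * (jb (σ + τ))⁻¹)) *
        (ENNReal.ofReal (Real.sqrt (jb (σ + τ) * jb σ)) *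
          (‖timeFourier f (σ + τ)‖ₑ * ‖timeFourier f σ‖ₑ))) ^ 2 := by
        congr 1; exact lintegral_congr key
    _ ≤ _ := lintegral_mul_sq_le volume
        (Measurable.aemeasurable (by have := hj.measurable; fun_prop))
        (Measurable.aemeasurable (by have := hj.measurable; have := hc.measurable; fun_prop))
    _ ≤ _ := by
        gcongr ?_ * ?_
        · refine le_trans (le_of_eq (lintegral_congr fun σ => ?_))
            (lintegral_inv_jb_mul_inv_jb_le τ)
          have h1 := jb_pos σ
          have h2 := jb_pos (σ + τ)
          rw [← ENNReal.ofReal_pow (by positivity), Real.sq_sqrt (by positivity)]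
        · refine le_of_eq (lintegral_congr fun σ => ?_)
          have h1 := jb_pos σ
          have h2 := jb_pos (σ + τ)
          rw [mul_pow, ← ENNReal.ofReal_pow (by positivity), Real.sq_sqrt (by positivity),
            ENNReal.ofReal_mul h2.le, mul_pow]
          ring

theorem lintegral_inv_one_add_sq_ne_top :
    ∫⁻ σ : ℝ, ENNReal.ofReal ((1 + σ ^ 2)⁻¹) ≠ ∞ := by
  have h := (hasFiniteIntegral_iff_ofReal
    (ae_of_all _ fun σ : ℝ => by positivity)).1 integrable_inv_one_add_sq.2
  exact h.ne

/-- The embedding of `H^{1/2}` into `L⁴`. -/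
theorem exists_lintegral_enorm_pow_four_le : ∃ K : ℝ≥0, ∀ f : ℝ → ℂ, Continuous f →
    HasCompactSupport f → ∫⁻ t, ‖f t‖ₑ ^ 4 ≤ K * halfNorm f ^ 4 := by
  -- The summand 1 makes the constant visibly nonzero, so that the right side is ∞ when `halfNorm f`
  -- is.
  refine ⟨(∫⁻ σ : ℝ, ENNReal.ofReal ((1 + σ ^ 2)⁻¹)).toNNReal + 1, fun f hf hfc => ?_⟩
  rw [ENNReal.coe_add, ENNReal.coe_toNNReal lintegral_inv_one_add_sq_ne_top]
  set K := ∫⁻ σ : ℝ, ENNReal.ofReal ((1 + σ ^ 2)⁻¹)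
  by_cases hA : halfNorm f = ∞
  · rw [hA, ENNReal.top_pow (by norm_num), ENNReal.mul_top (by simp)]
    exact le_top
  have hc := continuous_timeFourier hf hfc
  have hj := continuous_jb
  have hgf : Continuous fun t => f t * conj (f t) := by fun_prop
  have hgc : HasCompactSupport fun t => f t * conj (f t) := hfc.mul_right
  set k : ℝ → ℝ≥0∞ := fun σ => ENNReal.ofReal (jb σ) * ‖timeFourier f σ‖ₑ ^ 2 with hk
  have hkm : Measurable k := by
    have := hj.measurable; have := hc.measurable; fun_prop
  have hkA : ∫⁻ σ, k σ = halfNorm f ^ 2 := (halfNorm_sq f).symm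
  -- The fourth power of the L⁴ norm is the squared L² norm of |f|². After Plancherel, Tonelli
  -- decouples the double integral into the square of ∫ k.
  calc ∫⁻ t, ‖f t‖ₑ ^ 4 = ∫⁻ t, ‖f t * conj (f t)‖ₑ ^ 2 := by
        refine lintegral_congr fun t => ?_
        rw [enorm_mul, RCLike.enorm_conj]
        ring
    _ ≤ _ := lintegral_enorm_sq_le hgf hgc
    _ ≤ ∫⁻ τ, K * ∫⁻ σ, k (σ + τ) * k σ :=
        lintegral_mono fun τ => timeFourier_normSq_sq hf hfc hA τ
    _ = K * ∫⁻ τ, ∫⁻ σ, k (σ + τ) * k σ :=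
        lintegral_const_mul' _ _ lintegral_inv_one_add_sq_ne_top
    _ = K * ∫⁻ σ, ∫⁻ τ, k (σ + τ) * k σ := by
        rw [lintegral_lintegral_swap (Measurable.aemeasurable (by fun_prop))]
    _ = K * halfNorm f ^ 4 := by
        congr 1
        calc _ = ∫⁻ σ, (∫⁻ τ, k τ) * k σ := by
              refine lintegral_congr fun σ => ?_
              rw [lintegral_mul_const _ (by fun_prop), lintegral_add_left_eq_self k σ]
          _ = _ := by
              rw [lintegral_const_mul _ hkm, hkA]
              ring
    _ ≤ _ := by gcongr; exact le_self_add

/-! ### Oscillatory integrals of products of three functions of H^{1/2}. -/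

/-- Hölder with exponents 2, 4, 4; the L² slot will hold the factor that is differenced in time. -/
theorem lintegral_mul_three_le {X : Type*} [MeasurableSpace X] (μ : Measure X)
    {f g k : X → ℝ≥0∞} (hf : AEMeasurable f μ) (hg : AEMeasurable g μ) (hk : AEMeasurable k μ) :
    ∫⁻ x, f x * g x * k x ∂μ ≤
      (∫⁻ x, f x ^ 2 ∂μ) ^ (1 / 2 : ℝ) * (∫⁻ x, g x ^ 4 ∂μ) ^ (1 / 4 : ℝ) *
        (∫⁻ x, k x ^ 4 ∂μ) ^ (1 / 4 : ℝ) := by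
  have h := ENNReal.lintegral_prod_norm_pow_le (μ := μ) (Finset.univ : Finset (Fin 3))
    (f := ![fun x => f x ^ 2, fun x => g x ^ 4, fun x => k x ^ 4])
    (by intro i _; fin_cases i <;> simp <;> fun_prop)
    (p := ![1 / 2, 1 / 4, 1 / 4]) (by simp [Fin.sum_univ_three]; norm_num)
    (by intro i _; fin_cases i <;> simp)
  simp only [Fin.prod_univ_three, Matrix.cons_val_zero, Matrix.cons_val_one,
    Matrix.cons_val_two, Matrix.tail_cons, Matrix.head_cons] at h
  refine le_trans (le_of_eq (lintegral_congr fun x => ?_)) h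
  simp only [← ENNReal.rpow_natCast, ← ENNReal.rpow_mul]
  norm_num

/-- Hölder with four exponents 4, the fourth function being 1: short intervals give a small factor.
-/
theorem lintegral_mul_three_le_measure {X : Type*} [MeasurableSpace X] (μ : Measure X)
    {f g k : X → ℝ≥0∞} (hf : AEMeasurable f μ) (hg : AEMeasurable g μ) (hk : AEMeasurable k μ) :
    ∫⁻ x, f x * g x * k x ∂μ ≤
      μ Set.univ ^ (1 / 4 : ℝ) * ((∫⁻ x, f x ^ 4 ∂μ) ^ (1 / 4 : ℝ) *
        (∫⁻ x, g x ^ 4 ∂μ) ^ (1 / 4 : ℝ) * (∫⁻ x, k x ^ 4 ∂μ) ^ (1 / 4 : ℝ)) := by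
  have h := ENNReal.lintegral_prod_norm_pow_le (μ := μ) (Finset.univ : Finset (Fin 4))
    (f := ![fun x => f x ^ 4, fun x => g x ^ 4, fun x => k x ^ 4, fun _ => 1])
    (by intro i _; fin_cases i <;> simp <;> fun_prop)
    (p := ![1 / 4, 1 / 4, 1 / 4, 1 / 4]) (by simp [Fin.sum_univ_four]; norm_num)
    (by intro i _; fin_cases i <;> simp)
  simp only [Fin.prod_univ_four, Matrix.cons_val_zero, Matrix.cons_val_one,
    Matrix.cons_val_two, Matrix.cons_val, Matrix.tail_cons, Matrix.head_cons,
    ENNReal.one_rpow, mul_one, lintegral_const, one_mul] at h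
  rw [mul_comm]
  refine le_trans (le_of_eq (lintegral_congr fun x => ?_)) h
  simp only [← ENNReal.rpow_natCast, ← ENNReal.rpow_mul]
  norm_num

theorem exists_rpow_lintegral_enorm_pow_four_le : ∃ K : ℝ≥0, ∀ f : ℝ → ℂ, Continuous f →
    HasCompactSupport f → (∫⁻ t, ‖f t‖ₑ ^ 4) ^ (1 / 4 : ℝ) ≤ K * halfNorm f := by
  obtain ⟨K, hK⟩ := exists_lintegral_enorm_pow_four_le
  refine ⟨K ^ (1 / 4 : ℝ), fun f hf hfc => ?_⟩
  refine (ENNReal.rpow_le_rpow (hK f hf hfc) (by norm_num)).trans (le_of_eq ?_)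
  rw [ENNReal.mul_rpow_of_nonneg _ _ (by norm_num), ENNReal.coe_rpow_of_nonneg _ (by norm_num),
    ← ENNReal.rpow_natCast, ← ENNReal.rpow_mul]
  norm_num

theorem rpow_lintegral_enorm_sub_translate_le {f : ℝ → ℂ} (hf : Continuous f)
    (hfc : HasCompactSupport f) (h : ℝ) :
    (∫⁻ t, ‖f (t + h) - f t‖ₑ ^ 2) ^ (1 / 2 : ℝ) ≤
      ENNReal.ofReal (2 * |h|) ^ (1 / 2 : ℝ) * halfNorm f := by
  refine (ENNReal.rpow_le_rpow (lintegral_enorm_sub_translate_sq_le hf hfc h)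
    (by norm_num)).trans (le_of_eq ?_)
  rw [ENNReal.mul_rpow_of_nonneg _ _ (by norm_num), ← ENNReal.rpow_natCast, ← ENNReal.rpow_mul]
  norm_num

theorem rpow_lintegral_enorm_sq_le {f : ℝ → ℂ} (hf : Continuous f)
    (hfc : HasCompactSupport f) : (∫⁻ t, ‖f t‖ₑ ^ 2) ^ (1 / 2 : ℝ) ≤ halfNorm f := by
  refine (ENNReal.rpow_le_rpow (lintegral_enorm_sq_le_halfNorm hf hfc)
    (by norm_num)).trans (le_of_eq ?_)
  rw [← ENNReal.rpow_natCast, ← ENNReal.rpow_mul]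
  norm_num

section Trilinear

variable {u v w : ℝ → ℂ} {K : ℝ≥0}

theorem lintegral_enorm_mul_three_le
    (hK : ∀ f : ℝ → ℂ, Continuous f → HasCompactSupport f →
      (∫⁻ t, ‖f t‖ₑ ^ 4) ^ (1 / 4 : ℝ) ≤ K * halfNorm f)
    (hu : Continuous u) (huc : HasCompactSupport u) (hv : Continuous v) (hvc : HasCompactSupport v)
    (hw : Continuous w) (hwc : HasCompactSupport w) :
    ∫⁻ s, ‖u s * v s * w s‖ₑ ≤ K ^ 2 * (halfNorm u * halfNorm v * halfNorm w) := by
  simp only [enorm_mul]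
  refine (lintegral_mul_three_le volume (by fun_prop) (by fun_prop) (by fun_prop)).trans ?_
  calc _ ≤ halfNorm u * (K * halfNorm v) * (K * halfNorm w) :=
        mul_le_mul' (mul_le_mul' (rpow_lintegral_enorm_sq_le hu huc) (hK v hv hvc)) (hK w hw hwc)
    _ = _ := by ring

theorem setLIntegral_enorm_mul_three_le
    (hK : ∀ f : ℝ → ℂ, Continuous f → HasCompactSupport f →
      (∫⁻ t, ‖f t‖ₑ ^ 4) ^ (1 / 4 : ℝ) ≤ K * halfNorm f)
    (hu : Continuous u) (huc : HasCompactSupport u) (hv : Continuous v) (hvc : HasCompactSupport v)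
    (hw : Continuous w) (hwc : HasCompactSupport w) (S : Set ℝ) :
    ∫⁻ s in S, ‖u s * v s * w s‖ₑ ≤
      volume S ^ (1 / 4 : ℝ) * (K ^ 3 * (halfNorm u * halfNorm v * halfNorm w)) := by
  simp only [enorm_mul]
  refine (lintegral_mul_three_le_measure _ (by fun_prop) (by fun_prop) (by fun_prop)).trans ?_
  rw [Measure.restrict_apply_univ]
  have h : ∀ f : ℝ → ℂ, Continuous f → HasCompactSupport f →
      (∫⁻ t in S, ‖f t‖ₑ ^ 4) ^ (1 / 4 : ℝ) ≤ K * halfNorm f := fun f hf hfc =>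
    (ENNReal.rpow_le_rpow (setLIntegral_le_lintegral _ _) (by norm_num)).trans (hK f hf hfc)
  calc _ ≤ volume S ^ (1 / 4 : ℝ) *
        ((K * halfNorm u) * (K * halfNorm v) * (K * halfNorm w)) :=
        mul_le_mul' le_rfl
          (mul_le_mul' (mul_le_mul' (h u hu huc) (h v hv hvc)) (h w hw hwc))
    _ = _ := by ring

/-- Telescoping: one factor at a time is differenced, in L² with gain |h|^{1/2}, while the other two
stay in L⁴. -/
theorem lintegral_enorm_sub_translate_mul_three_le
    (hK : ∀ f : ℝ → ℂ, Continuous f → HasCompactSupport f →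
      (∫⁻ t, ‖f t‖ₑ ^ 4) ^ (1 / 4 : ℝ) ≤ K * halfNorm f)
    (hu : Continuous u) (huc : HasCompactSupport u) (hv : Continuous v) (hvc : HasCompactSupport v)
    (hw : Continuous w) (hwc : HasCompactSupport w) (h : ℝ) :
    ∫⁻ s, ‖u (s + h) * v (s + h) * w (s + h) - u s * v s * w s‖ₑ ≤
      ENNReal.ofReal (2 * |h|) ^ (1 / 2 : ℝ) *
        (3 * K ^ 2 * (halfNorm u * halfNorm v * halfNorm w)) := by
  have hsplit : ∀ s, ‖u (s + h) * v (s + h) * w (s + h) - u s * v s * w s‖ₑ ≤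
      ‖u (s + h) - u s‖ₑ * ‖v s‖ₑ * ‖w s‖ₑ + ‖v (s + h) - v s‖ₑ * ‖u (s + h)‖ₑ * ‖w s‖ₑ +
        ‖w (s + h) - w s‖ₑ * ‖u (s + h)‖ₑ * ‖v (s + h)‖ₑ := by
    intro s
    have : u (s + h) * v (s + h) * w (s + h) - u s * v s * w s =
        (u (s + h) - u s) * v s * w s + (v (s + h) - v s) * u (s + h) * w s +
          (w (s + h) - w s) * u (s + h) * v (s + h) := by ring
    rw [this]
    simp only [← enorm_mul]
    exact (enorm_add_le _ _).trans (add_le_add (enorm_add_le _ _) le_rfl)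
  have hT : ∀ f : ℝ → ℂ, Continuous f → HasCompactSupport f →
      (∫⁻ t, ‖f (t + h)‖ₑ ^ 4) ^ (1 / 4 : ℝ) ≤ K * halfNorm f := fun f hf hfc => by
    rw [lintegral_add_right_eq_self (fun t => ‖f t‖ₑ ^ 4) h]
    exact hK f hf hfc
  have hD := fun (f : ℝ → ℂ) (hf : Continuous f) (hfc : HasCompactSupport f) =>
    rpow_lintegral_enorm_sub_translate_le hf hfc h
  refine (lintegral_mono hsplit).trans ?_
  rw [lintegral_add_left (by fun_prop), lintegral_add_left (by fun_prop)]
  have h1 := (lintegral_mul_three_le volume (f := fun s => ‖u (s + h) - u s‖ₑ)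
    (g := fun s => ‖v s‖ₑ) (k := fun s => ‖w s‖ₑ) (by fun_prop) (by fun_prop) (by fun_prop)).trans
    (mul_le_mul' (mul_le_mul' (hD u hu huc) (hK v hv hvc)) (hK w hw hwc))
  have h2 := (lintegral_mul_three_le volume (f := fun s => ‖v (s + h) - v s‖ₑ)
    (g := fun s => ‖u (s + h)‖ₑ) (k := fun s => ‖w s‖ₑ) (by fun_prop) (by fun_prop)
    (by fun_prop)).trans (mul_le_mul' (mul_le_mul' (hD v hv hvc) (hT u hu huc)) (hK w hw hwc))
  have h3 := (lintegral_mul_three_le volume (f := fun s => ‖w (s + h) - w s‖ₑ)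
    (g := fun s => ‖u (s + h)‖ₑ) (k := fun s => ‖v (s + h)‖ₑ) (by fun_prop) (by fun_prop)
    (by fun_prop)).trans (mul_le_mul' (mul_le_mul' (hD w hw hwc) (hT u hu huc)) (hT v hv hvc))
  refine (add_le_add (add_le_add h1 h2) h3).trans (le_of_eq ?_)
  ring

theorem enorm_intervalIntegral_le_setLIntegral (F : ℝ → ℂ) (a b : ℝ) :
    ‖∫ s in a..b, F s‖ₑ ≤ ∫⁻ s in Set.uIoc a b, ‖F s‖ₑ := by
  have h : ‖∫ s in a..b, F s‖ₑ = ‖∫ s in Set.uIoc a b, F s‖ₑ := by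
    rw [← ofReal_norm, intervalIntegral.norm_intervalIntegral_eq, ofReal_norm]
  rw [h]
  exact enorm_integral_le_lintegral_enorm _

theorem enorm_exp_neg_I_mul (x : ℝ) : ‖Complex.exp (-(Complex.I * (x : ℂ)))‖ₑ = 1 := by
  rw [← ofReal_norm, ← mul_neg, mul_comm, ← Complex.ofReal_neg, Complex.norm_exp_ofReal_mul_I,
    ENNReal.ofReal_one]

/-- Half a period shift turns an oscillating integral into one of a difference. -/
theorem two_mul_integral_oscillating {G : ℝ → ℂ} (hG : Continuous G) {Φ : ℝ} (hΦ : Φ ≠ 0) (t : ℝ) :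
    2 * ∫ s in (0 : ℝ)..t, Complex.exp (-(Complex.I * ((Φ * s : ℝ) : ℂ))) * G s =
      -(∫ s in (0 : ℝ)..t, Complex.exp (-(Complex.I * ((Φ * s : ℝ) : ℂ))) *
          (G (s + Real.pi / Φ) - G s)) -
        (∫ s in (-(Real.pi / Φ))..0,
          Complex.exp (-(Complex.I * ((Φ * s : ℝ) : ℂ))) * G (s + Real.pi / Φ)) -
        ∫ s in t..(t - Real.pi / Φ),
          Complex.exp (-(Complex.I * ((Φ * s : ℝ) : ℂ))) * G (s + Real.pi / Φ) := by
  set h := Real.pi / Φ with hh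
  set E : ℝ → ℂ := fun s => Complex.exp (-(Complex.I * ((Φ * s : ℝ) : ℂ))) with hE
  have hEc : Continuous E := by fun_prop
  have hEh : ∀ s, E (s + h) = -E s := by
    intro s
    have : -(Complex.I * ((Φ * (s + h) : ℝ) : ℂ)) =
        -(Complex.I * ((Φ * s : ℝ) : ℂ)) - Real.pi * Complex.I := by
      rw [hh, mul_add, mul_div_cancel₀ _ hΦ]
      push_cast
      ring
    simp only [hE]
    rw [this, Complex.exp_sub, Complex.exp_pi_mul_I, div_neg, div_one]
  have hi : ∀ F : ℝ → ℂ, Continuous F → ∀ a b, IntervalIntegrable F volume a b :=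
    fun F hF a b => hF.intervalIntegrable a b
  have h1 : ∫ s in (0 : ℝ)..t, E s * G s = -∫ s in (-h)..(t - h), E s * G (s + h) := by
    rw [← intervalIntegral.integral_neg]
    have := intervalIntegral.integral_comp_add_right (a := -h) (b := t - h)
      (fun s => E s * G s) h
    rw [neg_add_cancel, sub_add_cancel] at this
    rw [← this]
    congr 1
    ext s
    rw [hEh]
    ring
  have h2 : ∫ s in (-h)..(t - h), E s * G (s + h) = (∫ s in (-h)..0, E s * G (s + h)) +
      (∫ s in (0 : ℝ)..t, E s * G (s + h)) + ∫ s in t..(t - h), E s * G (s + h) := by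
    rw [intervalIntegral.integral_add_adjacent_intervals (hi _ (by fun_prop) _ _)
      (hi _ (by fun_prop) _ _), intervalIntegral.integral_add_adjacent_intervals
      (hi _ (by fun_prop) _ _) (hi _ (by fun_prop) _ _)]
  have h3 : ∫ s in (0 : ℝ)..t, E s * (G (s + h) - G s) =
      (∫ s in (0 : ℝ)..t, E s * G (s + h)) - ∫ s in (0 : ℝ)..t, E s * G s := by
    rw [← intervalIntegral.integral_sub (hi _ (by fun_prop) _ _) (hi _ (by fun_prop) _ _)]
    simp only [mul_sub]
  rw [h3]
  rw [h2] at h1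
  linear_combination h1

end Trilinear

/-- An oscillatory integral of a product of three functions of `H^{1/2}`, uniformly in the interval
of integration. -/
theorem exists_enorm_integral_oscillating_le : ∃ K : ℝ≥0, ∀ u v w : ℝ → ℂ,
    Continuous u → HasCompactSupport u → Continuous v → HasCompactSupport v →
    Continuous w → HasCompactSupport w → ∀ Φ t : ℝ,
    ‖∫ s in (0 : ℝ)..t, Complex.exp (-(Complex.I * ((Φ * s : ℝ) : ℂ))) * (u s * v s * w s)‖ₑ ≤
      K * ENNReal.ofReal (jb Φ ^ (-(1 / 4) : ℝ)) * (halfNorm u * halfNorm v * halfNorm w) := by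
  obtain ⟨K, hK⟩ := exists_rpow_lintegral_enorm_pow_four_le
  -- The summands pay, in turn, for |Φ| ≤ 1, for the integral of the difference, and for the two end
  -- intervals of length |h|.
  refine ⟨2 * K ^ 2 + 12 * K ^ 2 + 4 * K ^ 3,
    fun u v w hu huc hv hvc hw hwc Φ t => ?_⟩
  have hbase : ‖∫ s in (0 : ℝ)..t,
      Complex.exp (-(Complex.I * ((Φ * s : ℝ) : ℂ))) * (u s * v s * w s)‖ₑ ≤
      K ^ 2 * (halfNorm u * halfNorm v * halfNorm w) := by
    refine (enorm_intervalIntegral_le_setLIntegral _ _ _).trans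
      ((setLIntegral_le_lintegral _ _).trans ?_)
    simp only [enorm_mul, enorm_exp_neg_I_mul, one_mul]
    simpa only [enorm_mul] using lintegral_enorm_mul_three_le hK hu huc hv hvc hw hwc
  set A := halfNorm u * halfNorm v * halfNorm w
  rcases le_or_gt |Φ| 1 with hΦ | hΦ
  · have hj : 1 ≤ 2 * ENNReal.ofReal (jb Φ ^ (-(1 / 4) : ℝ)) := by
      rw [← ENNReal.ofReal_one, show (2 : ℝ≥0∞) = ENNReal.ofReal 2 by norm_num,
        ← ENNReal.ofReal_mul (by norm_num)]
      refine ENNReal.ofReal_le_ofReal ?_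
      have h2 : jb Φ ≤ 2 := by
        refine Real.sqrt_le_iff.2 ⟨by norm_num, ?_⟩
        have := (sq_le_one_iff_abs_le_one Φ).2 hΦ
        linarith
      have h3 : (2 : ℝ) ^ (-(1 / 4) : ℝ) ≤ jb Φ ^ (-(1 / 4) : ℝ) :=
        Real.rpow_le_rpow_of_nonpos (jb_pos Φ) h2 (by norm_num)
      have h4 : (2 : ℝ) ^ (-1 : ℝ) ≤ (2 : ℝ) ^ (-(1 / 4) : ℝ) :=
        Real.rpow_le_rpow_of_exponent_le (by norm_num) (by norm_num)
      rw [Real.rpow_neg_one] at h4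
      linarith
    calc _ ≤ K ^ 2 * A := hbase
      _ ≤ (2 * ENNReal.ofReal (jb Φ ^ (-(1 / 4) : ℝ))) * (K ^ 2 * A) :=
        le_mul_of_one_le_left (by positivity) hj
      _ = ((2 * K ^ 2 : ℝ≥0) : ℝ≥0∞) * ENNReal.ofReal (jb Φ ^ (-(1 / 4) : ℝ)) * A := by
        push_cast; ring
      _ ≤ _ := by
        gcongr
        rw [add_assoc]
        exact le_self_add
  have hΦ0 : Φ ≠ 0 := by rintro rfl; norm_num at hΦ
  have hG : Continuous fun s => u s * v s * w s := by fun_prop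
  set h := Real.pi / Φ with hh
  have habs : |h| = Real.pi / |Φ| := by rw [hh, abs_div, abs_of_pos Real.pi_pos]
  have h2 := two_mul_integral_oscillating hG hΦ0 t
  set J := ∫ s in (0 : ℝ)..t, Complex.exp (-(Complex.I * ((Φ * s : ℝ) : ℂ))) * (u s * v s * w s)
  have hbd : ∀ a b, |b - a| = |h| → ‖∫ s in a..b, Complex.exp (-(Complex.I * ((Φ * s : ℝ) : ℂ))) *
      (u (s + h) * v (s + h) * w (s + h))‖ₑ ≤
        ENNReal.ofReal |h| ^ (1 / 4 : ℝ) * (K ^ 3 * A) := by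
    intro a b hab
    refine (enorm_intervalIntegral_le_setLIntegral _ _ _).trans ?_
    simp only [enorm_mul (Complex.exp _), enorm_exp_neg_I_mul, one_mul]
    have h5 := setLIntegral_enorm_mul_three_le hK hu huc hv hvc hw hwc (Set.uIoc (a + h) (b + h))
    rw [Set.uIoc, Real.volume_Ioc, max_sub_min_eq_abs, add_sub_add_right_eq_sub, hab] at h5
    refine le_trans (le_of_eq ?_) h5
    have hmp := (measurePreserving_add_right (volume : Measure ℝ) h).setLIntegral_comp_preimage_emb
      (MeasurableEquiv.addRight h).measurableEmbedding
      (fun s => ‖u s * v s * w s‖ₑ) (Set.uIoc (a + h) (b + h))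
    rw [Set.uIoc] at hmp
    rw [← hmp, Set.uIoc]
    congr 2
    ext s
    rw [Set.mem_preimage, min_add_add_right, max_add_add_right]
    simp
  have hdiff : ‖∫ s in (0 : ℝ)..t, Complex.exp (-(Complex.I * ((Φ * s : ℝ) : ℂ))) *
      (u (s + h) * v (s + h) * w (s + h) - u s * v s * w s)‖ₑ ≤
        ENNReal.ofReal (2 * |h|) ^ (1 / 2 : ℝ) * (3 * K ^ 2 * A) := by
    refine (enorm_intervalIntegral_le_setLIntegral _ _ _).trans
      ((setLIntegral_le_lintegral _ _).trans ?_)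
    simp only [enorm_mul (Complex.exp _), enorm_exp_neg_I_mul, one_mul]
    exact lintegral_enorm_sub_translate_mul_three_le hK hu huc hv hvc hw hwc h
  have h6 : ‖J‖ₑ ≤ ‖2 * J‖ₑ := by
    rw [enorm_mul]
    refine le_mul_of_one_le_left (by positivity) ?_
    rw [← ofReal_norm, ← ENNReal.ofReal_one]
    exact ENNReal.ofReal_le_ofReal (by norm_num)
  have hpi := Real.pi_pos
  have hpi4 := Real.pi_le_four
  have hjle : jb Φ ≤ 2 * |Φ| := by
    refine Real.sqrt_le_iff.2 ⟨by positivity, ?_⟩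
    rw [mul_pow, sq_abs]
    have := (one_lt_sq_iff_one_lt_abs Φ).2 hΦ
    linarith
  -- Since ⟨Φ⟩ ≤ 2|Φ| and π ≤ 4, |h| = π/|Φ| ≤ 16/⟨Φ⟩; the value 16 has fourth root 2.
  have hkey : ENNReal.ofReal |h| ^ (1 / 4 : ℝ) ≤
      2 * ENNReal.ofReal (jb Φ ^ (-(1 / 4) : ℝ)) := by
    rw [ENNReal.ofReal_rpow_of_nonneg (abs_nonneg _) (by norm_num),
      show (2 : ℝ≥0∞) = ENNReal.ofReal 2 by norm_num, ← ENNReal.ofReal_mul (by norm_num)]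
    refine ENNReal.ofReal_le_ofReal ?_
    have hjp := jb_pos Φ
    calc |h| ^ (1 / 4 : ℝ) ≤ (16 * (jb Φ)⁻¹) ^ (1 / 4 : ℝ) := by
          refine Real.rpow_le_rpow (abs_nonneg _) ?_ (by norm_num)
          rw [habs, ← div_eq_mul_inv, div_le_div_iff₀ (by positivity) hjp]
          nlinarith
      _ = _ := by
          rw [Real.mul_rpow (by norm_num) (by positivity), Real.inv_rpow hjp.le,
            ← Real.rpow_neg hjp.le, show (16 : ℝ) = 2 ^ (4 : ℝ) by norm_num,
            ← Real.rpow_mul (by norm_num)]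
          norm_num
  -- The better power 1/2 is lowered to 1/4: as |h| ≤ 4, (2|h|)² ≤ 16|h|.
  have hkey2 : ENNReal.ofReal (2 * |h|) ^ (1 / 2 : ℝ) ≤
      2 * (2 * ENNReal.ofReal (jb Φ ^ (-(1 / 4) : ℝ))) := by
    refine le_trans ?_ (mul_le_mul' le_rfl hkey)
    rw [ENNReal.ofReal_rpow_of_nonneg (by positivity) (by norm_num),
      ENNReal.ofReal_rpow_of_nonneg (by positivity) (by norm_num),
      show (2 : ℝ≥0∞) = ENNReal.ofReal 2 by norm_num, ← ENNReal.ofReal_mul (by norm_num)]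
    refine ENNReal.ofReal_le_ofReal ?_
    have hle : |h| ≤ 4 := by
      rw [habs, div_le_iff₀ (by positivity)]; nlinarith
    have e1 : (2 * |h|) ^ (1 / 2 : ℝ) = ((2 * |h|) ^ 2) ^ (1 / 4 : ℝ) := by
      rw [← Real.rpow_natCast, ← Real.rpow_mul (by positivity)]; norm_num
    have e2 : (2 : ℝ) * |h| ^ (1 / 4 : ℝ) = (16 * |h|) ^ (1 / 4 : ℝ) := by
      rw [Real.mul_rpow (by norm_num) (by positivity), show (16 : ℝ) = 2 ^ (4 : ℝ) by norm_num,
            ← Real.rpow_mul (by norm_num)]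
      norm_num
    rw [e1, e2]
    refine Real.rpow_le_rpow (by positivity) ?_ (by norm_num)
    nlinarith [abs_nonneg h]
  set j := ENNReal.ofReal (jb Φ ^ (-(1 / 4) : ℝ))
  calc ‖J‖ₑ ≤ ‖2 * J‖ₑ := h6
    _ ≤ ENNReal.ofReal (2 * |h|) ^ (1 / 2 : ℝ) * (3 * K ^ 2 * A) +
        ENNReal.ofReal |h| ^ (1 / 4 : ℝ) * (K ^ 3 * A) +
        ENNReal.ofReal |h| ^ (1 / 4 : ℝ) * (K ^ 3 * A) := by
      rw [h2]
      refine (enorm_sub_le).trans (add_le_add ((enorm_sub_le).trans (add_le_add ?_ ?_)) ?_)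
      · rw [enorm_neg]; exact hdiff
      · exact hbd _ _ (by rw [zero_sub, neg_neg])
      · exact hbd _ _ (by rw [sub_sub_cancel_left, abs_neg])
    _ ≤ (2 * (2 * j)) * (3 * K ^ 2 * A) + (2 * j) * (K ^ 3 * A) + (2 * j) * (K ^ 3 * A) := by
      gcongr
    _ = ((12 * K ^ 2 + 4 * K ^ 3 : ℝ≥0) : ℝ≥0∞) * j * A := by push_cast; ring
    _ ≤ _ := by
      gcongr
      exact le_add_self

/-! ### The frequency lattice: small divisors and convergent sums. -/

/-- The linear form `ξ ↦ α · ξ` on the whole lattice. -/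
noncomputable def latFreq (α : ℝ × ℝ) (ξ : ℤ × ℤ) : ℝ := α.1 * (ξ.1 : ℝ) + α.2 * (ξ.2 : ℝ)

/-- The product `⟨ξ₁⟩⟨ξ₂⟩`. -/
noncomputable def br (ξ : ℤ × ℤ) : ℝ := jb (ξ.1 : ℝ) * jb (ξ.2 : ℝ)

theorem one_le_br (ξ : ℤ × ℤ) : 1 ≤ br ξ := one_le_mul_of_one_le_of_one_le (one_le_jb _) (one_le_jb _)

theorem br_pos (ξ : ℤ × ℤ) : 0 < br ξ := one_pos.trans_le (one_le_br ξ)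

theorem latFreq_add (α : ℝ × ℝ) (x y : ℤ × ℤ) :
    latFreq α (x + y) = latFreq α x + latFreq α y := by
  simp only [latFreq, Prod.fst_add, Prod.snd_add, Int.cast_add]; ring

theorem latFreq_neg (α : ℝ × ℝ) (x : ℤ × ℤ) : latFreq α (-x) = -latFreq α x := by
  simp only [latFreq, Prod.fst_neg, Prod.snd_neg, Int.cast_neg]; ring

theorem latFreq_sub (α : ℝ × ℝ) (x y : ℤ × ℤ) :
    latFreq α (x - y) = latFreq α x - latFreq α y := by
  rw [sub_eq_add_neg, latFreq_add, latFreq_neg, sub_eq_add_neg]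

theorem latFreq_zero (α : ℝ × ℝ) : latFreq α 0 = 0 := by simp [latFreq]

theorem jb_add_le (a b : ℝ) : jb (a + b) ≤ jb a + jb b := by
  refine Real.sqrt_le_iff.2 ⟨add_nonneg (jb_pos a).le (jb_pos b).le, ?_⟩
  have h : |a| * |b| ≤ jb a * jb b :=
    mul_le_mul (abs_le_jb a) (abs_le_jb b) (abs_nonneg b) (jb_pos a).le
  have h2 : a * b ≤ |a| * |b| := by rw [← abs_mul]; exact le_abs_self _
  nlinarith [jb_sq a, jb_sq b]

theorem jb_add_le_mul (a b : ℝ) : jb (a + b) ≤ 2 * (jb a * jb b) := by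
  nlinarith [jb_add_le a b, one_le_jb a, one_le_jb b]

theorem br_add_le (x y : ℤ × ℤ) : br (x + y) ≤ 4 * (br x * br y) := by
  have h1 := jb_add_le_mul (x.1 : ℝ) (y.1 : ℝ)
  have h2 := jb_add_le_mul (x.2 : ℝ) (y.2 : ℝ)
  simp only [br, Prod.fst_add, Prod.snd_add, Int.cast_add]
  calc _ ≤ (2 * (jb (x.1 : ℝ) * jb (y.1 : ℝ))) * (2 * (jb (x.2 : ℝ) * jb (y.2 : ℝ))) :=
        mul_le_mul h1 h2 (jb_pos _).le (by have := jb_pos (x.1 : ℝ); have := jb_pos (y.1 : ℝ); positivity)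
    _ = _ := by ring

theorem abs_latFreq_le (α : ℝ × ℝ) (ξ : ℤ × ℤ) : |latFreq α ξ| ≤ (|α.1| + |α.2|) * br ξ := by
  have h1 : |(ξ.1 : ℝ)| ≤ br ξ := by
    have := abs_le_jb (ξ.1 : ℝ); have := one_le_jb (ξ.2 : ℝ); have := jb_pos (ξ.1 : ℝ)
    unfold br; nlinarith
  have h2 : |(ξ.2 : ℝ)| ≤ br ξ := by
    have := abs_le_jb (ξ.2 : ℝ); have := one_le_jb (ξ.1 : ℝ); have := jb_pos (ξ.2 : ℝ)
    unfold br; nlinarith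
  calc |latFreq α ξ| ≤ |α.1 * (ξ.1 : ℝ)| + |α.2 * (ξ.2 : ℝ)| := abs_add_le _ _
    _ = |α.1| * |(ξ.1 : ℝ)| + |α.2| * |(ξ.2 : ℝ)| := by rw [abs_mul, abs_mul]
    _ ≤ |α.1| * br ξ + |α.2| * br ξ := by gcongr
    _ = _ := by ring

section Diophantine

variable {α : ℝ × ℝ} {γ C₀ : ℝ}

theorem Diophantine.le_abs_latFreq (hα : Diophantine α γ C₀) {ξ : ℤ × ℤ} (hξ : ξ ≠ 0) :
    C₀ * Real.sqrt ((ξ.1 : ℝ) ^ 2 + (ξ.2 : ℝ) ^ 2) ^ (-γ) ≤ |latFreq α ξ| := hα ⟨ξ, hξ⟩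

theorem Diophantine.latFreq_ne_zero (hα : Diophantine α γ C₀) (hC₀ : 0 < C₀) {ξ : ℤ × ℤ}
    (hξ : ξ ≠ 0) : latFreq α ξ ≠ 0 := by
  have h : 0 < (ξ.1 : ℝ) ^ 2 + (ξ.2 : ℝ) ^ 2 := by
    by_contra hn
    have h1 : (ξ.1 : ℝ) = 0 := by nlinarith [sq_nonneg (ξ.1 : ℝ), sq_nonneg (ξ.2 : ℝ)]
    have h2 : (ξ.2 : ℝ) = 0 := by nlinarith [sq_nonneg (ξ.1 : ℝ), sq_nonneg (ξ.2 : ℝ)]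
    exact hξ (Prod.ext (by exact_mod_cast h1) (by exact_mod_cast h2))
  have := hα.le_abs_latFreq hξ
  have h3 : 0 < C₀ * Real.sqrt ((ξ.1 : ℝ) ^ 2 + (ξ.2 : ℝ) ^ 2) ^ (-γ) := by positivity
  exact abs_pos.1 (h3.trans_le this)

theorem Diophantine.fst_ne_zero (hα : Diophantine α γ C₀) (hC₀ : 0 < C₀) : α.1 ≠ 0 := by
  simpa [latFreq] using hα.latFreq_ne_zero hC₀ (ξ := (1, 0)) (by simp)

theorem Diophantine.snd_ne_zero (hα : Diophantine α γ C₀) (hC₀ : 0 < C₀) : α.2 ≠ 0 := by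
  simpa [latFreq] using hα.latFreq_ne_zero hC₀ (ξ := (0, 1)) (by simp)

theorem jb_le_of_abs_lt_one {a b x y : ℝ} (ha : a ≠ 0) (h : |a * x + b * y| < 1) :
    jb x ≤ (1 + (1 + |b|) / |a|) * jb y := by
  have ha' : 0 < |a| := abs_pos.2 ha
  have h1 : |a| * |x| ≤ 1 + |b| * |y| := by
    rw [← abs_mul, ← abs_mul]
    have : |a * x| ≤ |a * x + b * y| + |b * y| := by
      simpa using abs_sub (a * x + b * y) (b * y)
    linarith
  have h2 : |x| ≤ (1 + |b|) / |a| * jb y := by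
    rw [div_mul_eq_mul_div, le_div_iff₀ ha']
    have := one_le_jb y; have := abs_le_jb y; have := abs_nonneg b
    nlinarith
  have h3 : jb x ≤ 1 + |x| := by
    refine Real.sqrt_le_iff.2 ⟨by positivity, ?_⟩
    nlinarith [sq_abs x, abs_nonneg x]
  have := one_le_jb y
  linarith

/-- In the strip `|α · ξ| < 1` the two coordinates are comparable. -/
theorem Diophantine.exists_strip (hα : Diophantine α γ C₀) (hC₀ : 0 < C₀) :
    ∃ D : ℝ, 1 ≤ D ∧ ∀ ξ : ℤ × ℤ, |latFreq α ξ| < 1 →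
      jb (ξ.1 : ℝ) ≤ D * jb (ξ.2 : ℝ) ∧ jb (ξ.2 : ℝ) ≤ D * jb (ξ.1 : ℝ) := by
  refine ⟨(1 + (1 + |α.2|) / |α.1|) + (1 + (1 + |α.1|) / |α.2|), ?_, fun ξ hξ => ⟨?_, ?_⟩⟩
  · have : 0 ≤ (1 + |α.2|) / |α.1| := by positivity
    have : 0 ≤ (1 + |α.1|) / |α.2| := by positivity
    linarith
  · refine (jb_le_of_abs_lt_one (hα.fst_ne_zero hC₀) hξ).trans ?_
    exact mul_le_mul_of_nonneg_right (le_add_of_nonneg_right (by positivity)) (jb_pos _).le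
  · refine (jb_le_of_abs_lt_one (a := α.2) (b := α.1) (hα.snd_ne_zero hC₀)
      (by rw [add_comm]; exact hξ)).trans ?_
    exact mul_le_mul_of_nonneg_right (le_add_of_nonneg_left (by positivity)) (jb_pos _).le

/-- Only the strip |ω| < 1 matters. There ⟨ξ₁⟩ and ⟨ξ₂⟩ are comparable, so |ξ|² ≲ ⟨ξ₁⟩⟨ξ₂⟩, and the
exponent γ of the diophantine condition is halved. -/
theorem Diophantine.exists_inv_abs_latFreq_le (hα : Diophantine α γ C₀) (hC₀ : 0 < C₀)
    (hγ : 0 < γ) : ∃ D : ℝ, 1 ≤ D ∧ ∀ ξ : ℤ × ℤ, ξ ≠ 0 →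
      |latFreq α ξ|⁻¹ ≤ D * br ξ ^ (γ / 2) := by
  obtain ⟨D, hD1, hD⟩ := hα.exists_strip hC₀
  have hD0 : 0 < D := by linarith
  refine ⟨1 + C₀⁻¹ * (4 * D) ^ (γ / 2), le_add_of_nonneg_right (by positivity), fun ξ hξ => ?_⟩
  have hb := one_le_br ξ
  have hb' : 1 ≤ br ξ ^ (γ / 2) := Real.one_le_rpow hb (by positivity)
  have hpos := abs_pos.2 (hα.latFreq_ne_zero hC₀ hξ)
  have hC : 0 ≤ C₀⁻¹ * (4 * D) ^ (γ / 2) := by positivity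
  rcases le_or_gt 1 |latFreq α ξ| with h | h
  · have := inv_le_one_of_one_le₀ h
    nlinarith
  · obtain ⟨h1, h2⟩ := hD ξ h
    have hj1 := jb_pos (ξ.1 : ℝ)
    have hj2 := jb_pos (ξ.2 : ℝ)
    set E := Real.sqrt ((ξ.1 : ℝ) ^ 2 + (ξ.2 : ℝ) ^ 2) with hE
    have hE2 : E ^ 2 ≤ 4 * D * br ξ := by
      rw [hE, Real.sq_sqrt (by positivity), br]
      nlinarith [jb_sq (ξ.1 : ℝ), jb_sq (ξ.2 : ℝ), mul_pos hj1 hj2]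
    have hmain := hα.le_abs_latFreq hξ
    rw [← hE, Real.rpow_neg (Real.sqrt_nonneg _)] at hmain
    have hEp : 0 < E := by
      rcases (Real.sqrt_nonneg ((ξ.1 : ℝ) ^ 2 + (ξ.2 : ℝ) ^ 2)).lt_or_eq with h | h
      · exact h
      · exfalso
        have h0 : (ξ.1 : ℝ) ^ 2 + (ξ.2 : ℝ) ^ 2 = 0 :=
          (Real.sqrt_eq_zero (by positivity)).1 h.symm
        have h1 : (ξ.1 : ℝ) = 0 := by nlinarith [sq_nonneg (ξ.1 : ℝ), sq_nonneg (ξ.2 : ℝ)]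
        have h2 : (ξ.2 : ℝ) = 0 := by nlinarith [sq_nonneg (ξ.1 : ℝ), sq_nonneg (ξ.2 : ℝ)]
        exact hξ (Prod.ext (by exact_mod_cast h1) (by exact_mod_cast h2))
    have hEg : E ^ γ ≤ (4 * D) ^ (γ / 2) * br ξ ^ (γ / 2) := by
      have e1 : E ^ γ = (E ^ 2) ^ (γ / 2) := by
        rw [← Real.rpow_natCast, ← Real.rpow_mul hEp.le]; congr 1; push_cast; ring
      rw [e1, ← Real.mul_rpow (by positivity) (br_pos ξ).le]
      exact Real.rpow_le_rpow (by positivity) hE2 (by positivity)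
    have hEγ : 0 < E ^ γ := Real.rpow_pos_of_pos hEp _
    calc |latFreq α ξ|⁻¹ ≤ (C₀ * (E ^ γ)⁻¹)⁻¹ := inv_anti₀ (by positivity) hmain
      _ = C₀⁻¹ * E ^ γ := by rw [mul_inv, inv_inv]
      _ ≤ C₀⁻¹ * ((4 * D) ^ (γ / 2) * br ξ ^ (γ / 2)) := by gcongr
      _ ≤ _ := by rw [add_mul, one_mul, mul_assoc]; linarith

end Diophantine

theorem tsum_jb_rpow_ne_top {β : ℝ} (hβ : 1 < β) :
    ∑' n : ℤ, ENNReal.ofReal (jb (n : ℝ) ^ (-β)) ≠ ∞ := by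
  refine Summable.tsum_ofReal_ne_top (Summable.of_nonneg_of_le
    (fun n => (Real.rpow_pos_of_pos (jb_pos _) _).le) (fun n => ?_)
    ((Real.summable_abs_int_rpow hβ).add
      ((hasSum_ite_eq (0 : ℤ) (1 : ℝ)).summable)))
  -- At n = 0 the real power |n|^(-β) is 0 while `jb 0 = 1`; the added indicator covers this term.
  by_cases hn : n = 0
  · simp [hn, jb, Real.zero_rpow (by linarith : -β ≠ 0)]
  · have : 0 < |(n : ℝ)| := abs_pos.2 (by exact_mod_cast hn)
    simp only [hn, if_false, add_zero]
    exact Real.rpow_le_rpow_of_nonpos this (abs_le_jb _) (by linarith)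

theorem tsum_prod_mul (f g : ℤ → ℝ≥0∞) :
    ∑' ξ : ℤ × ℤ, f ξ.1 * g ξ.2 = (∑' n, f n) * ∑' n, g n := by
  rw [ENNReal.tsum_prod']
  simp only [ENNReal.tsum_mul_left, ENNReal.tsum_mul_right]

theorem ofReal_br_rpow (β : ℝ) (ξ : ℤ × ℤ) : ENNReal.ofReal (br ξ ^ β) =
    ENNReal.ofReal (jb (ξ.1 : ℝ) ^ β) * ENNReal.ofReal (jb (ξ.2 : ℝ) ^ β) := by
  have h1 := jb_pos (ξ.1 : ℝ)
  have h2 := jb_pos (ξ.2 : ℝ)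
  rw [br, Real.mul_rpow h1.le h2.le, ENNReal.ofReal_mul (by positivity)]

theorem tsum_br_rpow_ne_top {β : ℝ} (hβ : 1 < β) :
    ∑' ξ : ℤ × ℤ, ENNReal.ofReal (br ξ ^ (-β)) ≠ ∞ := by
  simp only [ofReal_br_rpow]
  rw [tsum_prod_mul (fun n => ENNReal.ofReal (jb (n : ℝ) ^ (-β)))
    (fun n => ENNReal.ofReal (jb (n : ℝ) ^ (-β)))]
  exact ENNReal.mul_ne_top (tsum_jb_rpow_ne_top hβ) (tsum_jb_rpow_ne_top hβ)

/-- The number of integers `n` with `|a n + x| < 1` is bounded independently of `x`. -/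
theorem exists_tsum_strip_le {a : ℝ} (ha : a ≠ 0) : ∃ N : ℝ≥0, ∀ x : ℝ,
    ∑' n : ℤ, (if |a * (n : ℝ) + x| < 1 then (1 : ℝ≥0∞) else 0) ≤ N := by
  have ha' : 0 < |a| := abs_pos.2 ha
  set m : ℤ := ⌈2 / |a|⌉ with hm
  refine ⟨((Finset.Icc (-m) m).card : ℝ≥0), fun x => ?_⟩
  by_cases hne : ∃ n₀ : ℤ, |a * (n₀ : ℝ) + x| < 1
  · obtain ⟨n₀, hn₀⟩ := hne
    have hsupp : ∀ n ∉ (Finset.Icc (n₀ - m) (n₀ + m)),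
        (if |a * (n : ℝ) + x| < 1 then (1 : ℝ≥0∞) else 0) = 0 := by
      intro n hn
      rw [if_neg]
      intro h
      apply hn
      have h1 : |a| * |(n : ℝ) - n₀| < 2 := by
        rw [← abs_mul]
        have : a * ((n : ℝ) - n₀) = (a * n + x) - (a * n₀ + x) := by ring
        rw [this]
        exact (abs_sub _ _).trans_lt (by linarith)
      have h2 : |(n : ℝ) - n₀| ≤ m := by
        refine le_trans ?_ (Int.le_ceil _)
        rw [le_div_iff₀ ha']
        linarith
      have h3 : |n - n₀| ≤ m := by exact_mod_cast h2
      rw [abs_le] at h3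
      rw [Finset.mem_Icc]
      constructor <;> linarith [h3.1, h3.2]
    rw [tsum_eq_sum hsupp]
    calc _ ≤ ∑ _n ∈ Finset.Icc (n₀ - m) (n₀ + m), (1 : ℝ≥0∞) :=
          Finset.sum_le_sum fun n _ => by split_ifs <;> simp
      _ = ((Finset.Icc (n₀ - m) (n₀ + m)).card : ℝ≥0∞) := by simp
      _ ≤ _ := by
          rw [ENNReal.coe_natCast]
          refine le_of_eq ?_
          congr 1
          simp only [Int.card_Icc]
          congr 1
          ring
  · push Not at hne
    have : ∀ n : ℤ, (if |a * (n : ℝ) + x| < 1 then (1 : ℝ≥0∞) else 0) = 0 := fun n =>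
      if_neg (not_lt.2 (hne n))
    simp [this]

/-- Off the strip |ω| < 1 the divisor is harmless and β > 1 suffices. In the strip the summand is at
most a constant times ⟨ξ₂⟩^{κγ-2β}, and each ξ₂ admits boundedly many ξ₁. -/
theorem Diophantine.tsum_latFreq_rpow_ne_top {α : ℝ × ℝ} {γ C₀ : ℝ} (hα : Diophantine α γ C₀)
    (hC₀ : 0 < C₀) (hγ : 0 < γ) {κ β : ℝ} (hκ : 0 < κ) (hβ : 1 < β) (hβκ : κ * γ + 1 < 2 * β) :
    ∑' ξ : ℤ × ℤ, ENNReal.ofReal (|latFreq α ξ| ^ (-κ) * br ξ ^ (-β)) ≠ ∞ := by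
  obtain ⟨D, hD1, hD⟩ := hα.exists_strip hC₀
  obtain ⟨D', hD1', hD'⟩ := hα.exists_inv_abs_latFreq_le hC₀ hγ
  obtain ⟨N, hN⟩ := exists_tsum_strip_le (hα.fst_ne_zero hC₀)
  have hD0 : 0 < D := by linarith
  have hD0' : 0 < D' := by linarith
  by_cases he : κ * γ / 2 - β < 0
  swap
  · exfalso; linarith
  set e := κ * γ / 2 - β with hedef
  have hpt : ∀ ξ : ℤ × ℤ, ENNReal.ofReal (|latFreq α ξ| ^ (-κ) * br ξ ^ (-β)) ≤
      ENNReal.ofReal (br ξ ^ (-β)) + ENNReal.ofReal (D' ^ κ * D ^ (-e)) *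
        ((if |α.1 * (ξ.1 : ℝ) + α.2 * (ξ.2 : ℝ)| < 1 then (1 : ℝ≥0∞) else 0) *
          ENNReal.ofReal (jb (ξ.2 : ℝ) ^ (-(-(2 * e))))) := by
    intro ξ
    have hbr := Real.rpow_pos_of_pos (br_pos ξ) (-β)
    -- The origin contributes nothing, because 0^(-κ) = 0 for the real power with κ ≠ 0.
    by_cases hξ : ξ = 0
    · rw [hξ, latFreq_zero, abs_zero, Real.zero_rpow (by linarith), zero_mul, ENNReal.ofReal_zero]
      exact zero_le
    have hpos := abs_pos.2 (hα.latFreq_ne_zero hC₀ hξ)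
    rcases le_or_gt 1 |latFreq α ξ| with h | h
    · refine le_add_right (ENNReal.ofReal_le_ofReal ?_)
      have : |latFreq α ξ| ^ (-κ) ≤ 1 := Real.rpow_le_one_of_one_le_of_nonpos h (by linarith)
      nlinarith
    · refine le_add_left ?_
      have h' : |α.1 * (ξ.1 : ℝ) + α.2 * (ξ.2 : ℝ)| < 1 := h
      rw [if_pos h', one_mul, ← ENNReal.ofReal_mul (by positivity)]
      refine ENNReal.ofReal_le_ofReal ?_
      have hj1 := jb_pos (ξ.1 : ℝ)
      have hj2 := jb_pos (ξ.2 : ℝ)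
      have h1 : |latFreq α ξ| ^ (-κ) ≤ D' ^ κ * br ξ ^ (κ * γ / 2) := by
        calc |latFreq α ξ| ^ (-κ) = (|latFreq α ξ|⁻¹) ^ κ := by
              rw [Real.rpow_neg hpos.le, Real.inv_rpow hpos.le]
          _ ≤ (D' * br ξ ^ (γ / 2)) ^ κ :=
              Real.rpow_le_rpow (by positivity) (hD' ξ hξ) hκ.le
          _ = _ := by
              have := br_pos ξ
              rw [Real.mul_rpow hD0'.le (by positivity), ← Real.rpow_mul this.le]
              congr 2
              ring
      calc |latFreq α ξ| ^ (-κ) * br ξ ^ (-β)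
          ≤ (D' ^ κ * br ξ ^ (κ * γ / 2)) * br ξ ^ (-β) := by gcongr
        _ = D' ^ κ * br ξ ^ e := by
            rw [mul_assoc, ← Real.rpow_add (br_pos ξ), hedef, sub_eq_add_neg]
        _ = D' ^ κ * (jb (ξ.1 : ℝ) ^ e * jb (ξ.2 : ℝ) ^ e) := by
            rw [br, Real.mul_rpow hj1.le hj2.le]
        _ ≤ D' ^ κ * ((D ^ (-e) * jb (ξ.2 : ℝ) ^ e) * jb (ξ.2 : ℝ) ^ e) := by
            have h2 : jb (ξ.1 : ℝ) ^ e ≤ D ^ (-e) * jb (ξ.2 : ℝ) ^ e := by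
              rw [Real.rpow_neg hD0.le, ← Real.inv_rpow hD0.le,
                ← Real.mul_rpow (by positivity) hj2.le]
              refine Real.rpow_le_rpow_of_nonpos (by positivity) ?_ he.le
              rw [inv_mul_le_iff₀ hD0]
              exact (hD ξ h).2
            gcongr
        _ = _ := by
            rw [neg_neg, two_mul, Real.rpow_add hj2]
            ring
  refine ne_top_of_le_ne_top ?_ (ENNReal.tsum_le_tsum hpt)
  rw [ENNReal.tsum_add, ENNReal.tsum_mul_left]
  refine ENNReal.add_ne_top.2 ⟨tsum_br_rpow_ne_top hβ,
    ENNReal.mul_ne_top ENNReal.ofReal_ne_top ?_⟩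
  -- Summing over ξ₁ first costs the factor N; then ∑ ⟨ξ₂⟩^{2e} converges since -2e = 2β - κγ > 1.
  rw [ENNReal.tsum_prod', ENNReal.tsum_comm]
  simp only [ENNReal.tsum_mul_right]
  refine ne_top_of_le_ne_top (ENNReal.mul_ne_top ENNReal.coe_ne_top
    (tsum_jb_rpow_ne_top (β := -(2 * e)) (by rw [hedef]; linarith)))
    ((ENNReal.tsum_le_tsum fun n => mul_le_mul' (hN _) le_rfl).trans_eq ENNReal.tsum_mul_left)

/-- The larger of ⟨n⟩ and ⟨d-n⟩ is at least ⟨d⟩/2. -/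
theorem jb_rpow_mul_jb_sub_rpow_le {β : ℝ} (hβ : 0 ≤ β) (d n : ℝ) :
    jb n ^ (-β) * jb (d - n) ^ (-β) ≤
      2 ^ β * jb d ^ (-β) * (jb n ^ (-β) + jb (d - n) ^ (-β)) := by
  have hn := jb_pos n
  have hd := jb_pos d
  have hdn := jb_pos (d - n)
  have hsum : jb d ≤ jb n + jb (d - n) := by simpa using jb_add_le n (d - n)
  have key : ∀ y : ℝ, 0 < y → jb d ≤ 2 * y → y ^ (-β) ≤ 2 ^ β * jb d ^ (-β) := by
    intro y hy hdy
    calc y ^ (-β) ≤ (2⁻¹ * jb d) ^ (-β) :=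
          Real.rpow_le_rpow_of_nonpos (by positivity) (by linarith) (by linarith)
      _ = _ := by
          rw [Real.mul_rpow (by norm_num) hd.le, Real.inv_rpow (by norm_num),
            Real.rpow_neg (by norm_num), inv_inv]
  have p1 := Real.rpow_pos_of_pos hn (-β)
  have p2 := Real.rpow_pos_of_pos hdn (-β)
  have p3 : 0 < 2 ^ β * jb d ^ (-β) := by positivity
  rcases le_total (jb n) (jb (d - n)) with h | h
  · nlinarith [key _ hdn (by linarith)]
  · nlinarith [key _ hn (by linarith)]

theorem tsum_jb_convolution_le {β : ℝ} (hβ : 0 ≤ β) (d : ℤ) :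
    ∑' n : ℤ, ENNReal.ofReal (jb (n : ℝ) ^ (-β)) * ENNReal.ofReal (jb ((d - n : ℤ) : ℝ) ^ (-β)) ≤
      ENNReal.ofReal (2 ^ β) * (2 * ∑' n : ℤ, ENNReal.ofReal (jb (n : ℝ) ^ (-β))) *
        ENNReal.ofReal (jb (d : ℝ) ^ (-β)) := by
  have hpt : ∀ n : ℤ, ENNReal.ofReal (jb (n : ℝ) ^ (-β)) *
      ENNReal.ofReal (jb ((d - n : ℤ) : ℝ) ^ (-β)) ≤
      ENNReal.ofReal (2 ^ β * jb (d : ℝ) ^ (-β)) * (ENNReal.ofReal (jb (n : ℝ) ^ (-β)) +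
        ENNReal.ofReal (jb ((d - n : ℤ) : ℝ) ^ (-β))) := by
    intro n
    have hn := jb_pos (n : ℝ)
    have hd := jb_pos (d : ℝ)
    have hdn := jb_pos ((d - n : ℤ) : ℝ)
    rw [← ENNReal.ofReal_mul (by positivity), ← ENNReal.ofReal_add (by positivity) (by positivity),
      ← ENNReal.ofReal_mul (by positivity)]
    refine ENNReal.ofReal_le_ofReal ?_
    push_cast
    exact jb_rpow_mul_jb_sub_rpow_le hβ _ _
  have hs : ∑' n : ℤ, ENNReal.ofReal (jb ((d - n : ℤ) : ℝ) ^ (-β)) =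
      ∑' n : ℤ, ENNReal.ofReal (jb (n : ℝ) ^ (-β)) :=
    (Equiv.subLeft d).tsum_eq (fun n : ℤ => ENNReal.ofReal (jb (n : ℝ) ^ (-β)))
  refine (ENNReal.tsum_le_tsum hpt).trans (le_of_eq ?_)
  rw [ENNReal.tsum_mul_left, ENNReal.tsum_add, hs,
    ENNReal.ofReal_mul (by positivity)]
  ring

theorem exists_tsum_br_convolution_le {β : ℝ} (hβ : 1 < β) : ∃ K : ℝ≥0, ∀ d : ℤ × ℤ,
    ∑' x : ℤ × ℤ, ENNReal.ofReal (br x ^ (-β)) * ENNReal.ofReal (br (d - x) ^ (-β)) ≤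
      K * ENNReal.ofReal (br d ^ (-β)) := by
  set A : ℝ≥0∞ := ENNReal.ofReal (2 ^ β) * (2 * ∑' n : ℤ, ENNReal.ofReal (jb (n : ℝ) ^ (-β)))
    with hA
  have hAt : A ≠ ∞ := ENNReal.mul_ne_top ENNReal.ofReal_ne_top
    (ENNReal.mul_ne_top ENNReal.ofNat_ne_top (tsum_jb_rpow_ne_top hβ))
  refine ⟨(A * A).toNNReal, fun d => ?_⟩
  rw [ENNReal.coe_toNNReal (ENNReal.mul_ne_top hAt hAt)]
  have hβ0 : 0 ≤ β := by linarith
  calc _ = ∑' x : ℤ × ℤ, (ENNReal.ofReal (jb (x.1 : ℝ) ^ (-β)) *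
            ENNReal.ofReal (jb ((d.1 - x.1 : ℤ) : ℝ) ^ (-β))) *
          (ENNReal.ofReal (jb (x.2 : ℝ) ^ (-β)) *
            ENNReal.ofReal (jb ((d.2 - x.2 : ℤ) : ℝ) ^ (-β))) := by
        refine tsum_congr fun x => ?_
        rw [ofReal_br_rpow, ofReal_br_rpow, Prod.fst_sub, Prod.snd_sub]
        ring
    _ = _ := tsum_prod_mul (fun n => ENNReal.ofReal (jb (n : ℝ) ^ (-β)) *
          ENNReal.ofReal (jb ((d.1 - n : ℤ) : ℝ) ^ (-β))) (fun n => ENNReal.ofReal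
            (jb (n : ℝ) ^ (-β)) * ENNReal.ofReal (jb ((d.2 - n : ℤ) : ℝ) ^ (-β)))
    _ ≤ (A * ENNReal.ofReal (jb (d.1 : ℝ) ^ (-β))) * (A * ENNReal.ofReal (jb (d.2 : ℝ) ^ (-β))) :=
        mul_le_mul' (tsum_jb_convolution_le hβ0 _) (tsum_jb_convolution_le hβ0 _)
    _ = _ := by rw [ofReal_br_rpow]; ring

/-! ### The cubic multiplier and the summability of its kernel. -/

theorem jb_rpow_neg_half_le_sqrt {Φ M : ℝ} (hM : 0 < M) (h : M ≤ |Φ|) :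
    jb Φ ^ (-(1 / 2) : ℝ) ≤ (Real.sqrt M)⁻¹ := by
  rw [Real.sqrt_eq_rpow, ← Real.rpow_neg hM.le]
  exact Real.rpow_le_rpow_of_nonpos hM (h.trans (abs_le_jb Φ)) (by norm_num)

/-- The exponent 1/2 is weakened to 1/4 on purpose: in the dominant case M = |b|²|a+c|/2, so
|b|^{-1/2} is still gained while only the fourth root of the small divisor |a+c| is paid. -/
theorem jb_rpow_neg_half_le_rpow {Φ M : ℝ} (hM : 0 < M) (h : M ≤ |Φ|) :
    jb Φ ^ (-(1 / 2) : ℝ) ≤ M ^ (-(1 / 4) : ℝ) :=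
  (Real.rpow_le_rpow_of_exponent_le (one_le_jb Φ) (by norm_num)).trans
    (Real.rpow_le_rpow_of_nonpos hM (h.trans (abs_le_jb Φ)) (by norm_num))

/-- The multiplier bound when one of the two frequencies dominates. -/
theorem multiplier_le_of_dominant {A D a b c X Y Z : ℝ} (hA : 1 ≤ A) (hD : 1 ≤ D)
    (hX : 1 ≤ X) (hY : 1 ≤ Y) (hZ : 1 ≤ Z) (hbY : |b| ≤ A * Y) (hc : c ≠ 0) (hr : a + c ≠ 0)
    (hr' : |a + c|⁻¹ ≤ D * (X * Z)) (hb8 : 8 * (1 + |c|) < |b|) (ha4 : |a| ≤ 4 * (1 + |c|)) :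
    |a| * |b| * |c|⁻¹ * jb (3 * (a + b) * (a + c) * (b + c)) ^ (-(1 / 2) : ℝ) ≤
      8 * A * D * (X ^ (1 / 2 : ℝ) * Y ^ (1 / 2 : ℝ) * Z ^ (1 / 4 : ℝ)) * (1 + |c|⁻¹) := by
  have hc0 : 0 < |c| := abs_pos.2 hc
  have hr0 : 0 < |a + c| := abs_pos.2 hr
  have hb0 : 0 < |b| := by linarith
  have h1 : |b| / 2 ≤ |a + b| := by
    have := abs_sub (a + b) a
    rw [add_sub_cancel_left] at this
    linarith
  have h2 : |b| / 2 ≤ |b + c| := by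
    have := abs_sub (b + c) c
    rw [add_sub_cancel_right] at this
    linarith
  have hM : |b| ^ 2 * |a + c| / 2 ≤ |3 * (a + b) * (a + c) * (b + c)| := by
    rw [abs_mul, abs_mul, abs_mul, abs_of_pos (by norm_num : (0 : ℝ) < 3)]
    have : (|b| / 2) * (|b| / 2) ≤ |a + b| * |b + c| := by gcongr
    nlinarith
  have hM0 : 0 < |b| ^ 2 * |a + c| / 2 := by positivity
  have hΦ := jb_rpow_neg_half_le_rpow hM0 hM
  have e1 : (|b| ^ 2 * |a + c| / 2) ^ (-(1 / 4) : ℝ) ≤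
      2 * |b| ^ (-(1 / 2) : ℝ) * (D * (X * Z) ^ (1 / 4 : ℝ)) := by
    have e2 : (|a + c|⁻¹) ^ (1 / 4 : ℝ) ≤ D * (X * Z) ^ (1 / 4 : ℝ) := by
      refine (Real.rpow_le_rpow (by positivity) hr' (by norm_num)).trans ?_
      rw [Real.mul_rpow (by positivity) (by positivity)]
      gcongr
      exact Real.rpow_le_self_of_one_le hD (by norm_num)
    have e3 : (2 : ℝ) ^ (1 / 4 : ℝ) ≤ 2 := Real.rpow_le_self_of_one_le (by norm_num) (by norm_num)
    have e4 : (|b| ^ 2 * |a + c| / 2) ^ (-(1 / 4) : ℝ) =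
        2 ^ (1 / 4 : ℝ) * |b| ^ (-(1 / 2) : ℝ) * (|a + c|⁻¹) ^ (1 / 4 : ℝ) := by
      rw [Real.div_rpow (by positivity) (by norm_num), Real.mul_rpow (by positivity) hr0.le,
        ← Real.rpow_natCast, ← Real.rpow_mul hb0.le, Real.inv_rpow hr0.le,
        ← Real.rpow_neg hr0.le, div_eq_mul_inv, ← Real.rpow_neg (by norm_num : (0 : ℝ) ≤ 2)]
      norm_num
      ring
    rw [e4]
    gcongr
  have e5 : |b| * |b| ^ (-(1 / 2) : ℝ) ≤ A * Y ^ (1 / 2 : ℝ) := by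
    calc |b| * |b| ^ (-(1 / 2) : ℝ) = |b| ^ (1 / 2 : ℝ) := by
          nth_rewrite 1 [← Real.rpow_one |b|]
          rw [← Real.rpow_add hb0]; norm_num
      _ ≤ (A * Y) ^ (1 / 2 : ℝ) := Real.rpow_le_rpow hb0.le hbY (by norm_num)
      _ ≤ _ := by
          rw [Real.mul_rpow (by positivity) (by positivity)]
          gcongr
          exact Real.rpow_le_self_of_one_le hA (by norm_num)
  have e6 : (X * Z) ^ (1 / 4 : ℝ) ≤ X ^ (1 / 2 : ℝ) * Z ^ (1 / 4 : ℝ) := by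
    rw [Real.mul_rpow (by positivity) (by positivity)]
    gcongr
    norm_num
  have e7 : |a| * |c|⁻¹ ≤ 4 * (1 + |c|⁻¹) := by
    rw [← div_eq_mul_inv, div_le_iff₀ hc0]
    have : |c|⁻¹ * |c| = 1 := inv_mul_cancel₀ hc0.ne'
    nlinarith
  calc _ ≤ |a| * |b| * |c|⁻¹ * (2 * |b| ^ (-(1 / 2) : ℝ) * (D * (X * Z) ^ (1 / 4 : ℝ))) := by
        gcongr
        exact hΦ.trans e1
    _ = 2 * D * (|a| * |c|⁻¹) * (|b| * |b| ^ (-(1 / 2) : ℝ)) * (X * Z) ^ (1 / 4 : ℝ) := by ring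
    _ ≤ 2 * D * (4 * (1 + |c|⁻¹)) * (A * Y ^ (1 / 2 : ℝ)) *
        (X ^ (1 / 2 : ℝ) * Z ^ (1 / 4 : ℝ)) := by gcongr
    _ = _ := by ring

/-- Three regimes. If |a| and |b| both exceed 4(1+|c|), then |Φ| ≥ |a||b||a+b| and half the powers
of a and b are gained. If one exceeds 8(1+|c|) and the other is at most 4(1+|c|), the former
dominates by a factor 2. If neither exceeds 8(1+|c|), no oscillation is needed. The thresholds 4 and
8 overlap so that these regimes are exhaustive. -/
theorem multiplier_le {A D a b c X Y Z : ℝ} (hA : 1 ≤ A) (hD : 1 ≤ D)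
    (hX : 1 ≤ X) (hY : 1 ≤ Y) (hZ : 1 ≤ Z) (haX : |a| ≤ A * X) (hbY : |b| ≤ A * Y)
    (hc : c ≠ 0) (hp : a + b ≠ 0) (hr : a + c ≠ 0) (hv : b + c ≠ 0)
    (hr' : |a + c|⁻¹ ≤ D * (X * Z)) (hv' : |b + c|⁻¹ ≤ D * (Y * Z)) :
    |a| * |b| * |c|⁻¹ * jb (3 * (a + b) * (a + c) * (b + c)) ^ (-(1 / 2) : ℝ) ≤
      8 * A * D * (X ^ (1 / 2 : ℝ) * Y ^ (1 / 2 : ℝ) * Z ^ (1 / 4 : ℝ)) * (1 + |c|⁻¹) *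
        (1 + |a + b| ^ (-(1 / 2) : ℝ)) := by
  have hc0 : 0 < |c| := abs_pos.2 hc
  have hp0 : 0 < |a + b| := abs_pos.2 hp
  have hP : 0 ≤ |a + b| ^ (-(1 / 2) : ℝ) := by positivity
  have hZ4 : 1 ≤ Z ^ (1 / 4 : ℝ) := Real.one_le_rpow hZ (by norm_num)
  have hsq : ∀ {x W : ℝ}, 0 ≤ W → |x| ≤ A * W → Real.sqrt |x| ≤ Real.sqrt A * W ^ (1 / 2 : ℝ) := by
    intro x W hW h
    rw [← Real.sqrt_eq_rpow, ← Real.sqrt_mul (by positivity)]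
    exact Real.sqrt_le_sqrt h
  have hAA : Real.sqrt A * Real.sqrt A = A := Real.mul_self_sqrt (by positivity)
  have hab : Real.sqrt |a| * Real.sqrt |b| ≤ A * (X ^ (1 / 2 : ℝ) * Y ^ (1 / 2 : ℝ)) := by
    calc _ ≤ (Real.sqrt A * X ^ (1 / 2 : ℝ)) * (Real.sqrt A * Y ^ (1 / 2 : ℝ)) := by
          gcongr
          · exact hsq (by positivity) haX
          · exact hsq (by positivity) hbY
      _ = (Real.sqrt A * Real.sqrt A) * (X ^ (1 / 2 : ℝ) * Y ^ (1 / 2 : ℝ)) := by ring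
      _ = _ := by rw [hAA]
  have hsa := Real.mul_self_sqrt (abs_nonneg a)
  have hsb := Real.mul_self_sqrt (abs_nonneg b)
  have hcc : |c|⁻¹ * |c| = 1 := inv_mul_cancel₀ hc0.ne'
  have hexp : ∀ {T : ℝ}, T ≤ 8 * A * D *
      (X ^ (1 / 2 : ℝ) * Y ^ (1 / 2 : ℝ) * Z ^ (1 / 4 : ℝ)) * (1 + |c|⁻¹) →
      T ≤ 8 * A * D * (X ^ (1 / 2 : ℝ) * Y ^ (1 / 2 : ℝ) * Z ^ (1 / 4 : ℝ)) * (1 + |c|⁻¹) *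
        (1 + |a + b| ^ (-(1 / 2) : ℝ)) := fun h =>
    h.trans (le_mul_of_one_le_right (by positivity) (by linarith))
  have hlarge : 4 * (1 + |c|) < |a| → 4 * (1 + |c|) < |b| →
      |a| * |b| * |c|⁻¹ * jb (3 * (a + b) * (a + c) * (b + c)) ^ (-(1 / 2) : ℝ) ≤
      8 * A * D * (X ^ (1 / 2 : ℝ) * Y ^ (1 / 2 : ℝ) * Z ^ (1 / 4 : ℝ)) * (1 + |c|⁻¹) *
        (1 + |a + b| ^ (-(1 / 2) : ℝ)) := by
    intro ha hb
    have ha0 : 0 < |a| := by linarith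
    have hb0 : 0 < |b| := by linarith
    have h1 : (3 / 4) * |a| ≤ |a + c| := by
      have := abs_sub (a + c) c
      rw [add_sub_cancel_right] at this
      linarith
    have h2 : (3 / 4) * |b| ≤ |b + c| := by
      have := abs_sub (b + c) c
      rw [add_sub_cancel_right] at this
      linarith
    have hM : |a| * |b| * |a + b| ≤ |3 * (a + b) * (a + c) * (b + c)| := by
      rw [abs_mul, abs_mul, abs_mul, abs_of_pos (by norm_num : (0 : ℝ) < 3)]
      have : ((3 / 4) * |a|) * ((3 / 4) * |b|) ≤ |a + c| * |b + c| := by gcongr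
      have h3 : 0 ≤ |a| * |b| := by positivity
      nlinarith
    have hΦ := jb_rpow_neg_half_le_sqrt (by positivity) hM
    rw [Real.sqrt_mul (by positivity), Real.sqrt_mul (by positivity)] at hΦ
    have hpr : (Real.sqrt |a + b|)⁻¹ = |a + b| ^ (-(1 / 2) : ℝ) := by
      rw [Real.sqrt_eq_rpow, Real.rpow_neg hp0.le]
    have hsa0 := Real.sqrt_pos.2 ha0
    have hsb0 := Real.sqrt_pos.2 hb0
    calc _ ≤ |a| * |b| * |c|⁻¹ * (Real.sqrt |a| * Real.sqrt |b| * Real.sqrt |a + b|)⁻¹ := by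
          gcongr
      _ = Real.sqrt |a| * Real.sqrt |b| * |c|⁻¹ * |a + b| ^ (-(1 / 2) : ℝ) := by
          rw [← hpr]
          nth_rewrite 1 [← hsa, ← hsb]
          field_simp
      _ ≤ (A * (X ^ (1 / 2 : ℝ) * Y ^ (1 / 2 : ℝ))) * (1 + |c|⁻¹) *
          (1 + |a + b| ^ (-(1 / 2) : ℝ)) := by
          gcongr <;> linarith
      _ ≤ (A * (X ^ (1 / 2 : ℝ) * Y ^ (1 / 2 : ℝ))) * (1 + |c|⁻¹) *
          (1 + |a + b| ^ (-(1 / 2) : ℝ)) * (8 * D * Z ^ (1 / 4 : ℝ)) := by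
          refine le_mul_of_one_le_right (by positivity) ?_
          nlinarith
      _ = _ := by ring
  by_cases hb8 : 8 * (1 + |c|) < |b|
  · by_cases ha4 : |a| ≤ 4 * (1 + |c|)
    · exact hexp (multiplier_le_of_dominant hA hD hX hY hZ hbY hc hr hr' hb8 ha4)
    · exact hlarge (not_le.1 ha4) (by linarith)
  by_cases ha8 : 8 * (1 + |c|) < |a|
  · by_cases hb4 : |b| ≤ 4 * (1 + |c|)
    · refine hexp ?_
      have h := multiplier_le_of_dominant (X := Y) (Y := X) hA hD hY hX hZ haX hc hv hv' ha8 hb4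
      convert h using 1
      · rw [add_comm b a]; ring_nf
      · ring
    · exact hlarge (by linarith) (not_le.1 hb4)
  · refine hexp ?_
    push Not at ha8 hb8
    have hj : jb (3 * (a + b) * (a + c) * (b + c)) ^ (-(1 / 2) : ℝ) ≤ 1 :=
      Real.rpow_le_one_of_one_le_of_nonpos (one_le_jb _) (by norm_num)
    -- Half of |a||b| is bounded by 1 + |c|, which |c|⁻¹ turns into 1 + |c|⁻¹; the other half
    -- becomes X^{1/2}Y^{1/2}.
    have h1 : Real.sqrt |a| * Real.sqrt |b| ≤ 8 * (1 + |c|) := by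
      rw [← Real.sqrt_mul (abs_nonneg _)]
      refine Real.sqrt_le_iff.2 ⟨by positivity, ?_⟩
      rw [sq]
      gcongr
    calc _ ≤ |a| * |b| * |c|⁻¹ * 1 := by
          gcongr
      _ = (Real.sqrt |a| * Real.sqrt |b|) * (Real.sqrt |a| * Real.sqrt |b|) * |c|⁻¹ := by
          nth_rewrite 1 [← hsa, ← hsb]; ring
      _ ≤ (A * (X ^ (1 / 2 : ℝ) * Y ^ (1 / 2 : ℝ))) * (8 * (1 + |c|)) * |c|⁻¹ := by gcongr
      _ = 8 * A * (X ^ (1 / 2 : ℝ) * Y ^ (1 / 2 : ℝ)) * (1 + |c|⁻¹) := by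
          linear_combination (8 * A * (X ^ (1 / 2 : ℝ) * Y ^ (1 / 2 : ℝ))) * hcc
      _ ≤ 8 * A * (X ^ (1 / 2 : ℝ) * Y ^ (1 / 2 : ℝ)) * (1 + |c|⁻¹) * (D * Z ^ (1 / 4 : ℝ)) := by
          refine le_mul_of_one_le_right (by positivity) ?_
          nlinarith
      _ = _ := by ring

/-- The resonance function of the cubic interaction. -/
noncomputable def resonance (α : ℝ × ℝ) (x y z : ℤ × ℤ) : ℝ :=
  3 * (latFreq α x + latFreq α y) * (latFreq α x + latFreq α z) * (latFreq α y + latFreq α z)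

/-- The squared multiplier of the nonresonant cubic interaction divided by the squared weights. -/
noncomputable def cubicKernel (α : ℝ × ℝ) (θ : ℝ) (x y z : ℤ × ℤ) : ℝ :=
  |latFreq α x| * |latFreq α y| * |latFreq α z|⁻¹ * jb (resonance α x y z) ^ (-(1 / 2) : ℝ) *
    (br x ^ (-(2 * θ)) * br y ^ (-(2 * θ)) * br z ^ (-(2 * θ)))

/-- `multiplier_le` separates z from (x, y). The sum over (x, y) is a convolution in d = x + y,
which reproduces its weight and meets only the divisor |ω(d)|^{-1/2}; the sum over z meets |ω(z)|⁻¹.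
-/
theorem Diophantine.tsum_cubicKernel_ne_top {α : ℝ × ℝ} {γ C₀ θ : ℝ} (hα : Diophantine α γ C₀)
    (hC₀ : 0 < C₀) (hγ : 0 < γ) (hγ2 : γ < 2) (hθ : 7 / 8 < θ) :
    ∑' x : ℤ × ℤ, ∑' y : ℤ × ℤ, ∑' z : ℤ × ℤ,
      (if x + y ≠ 0 ∧ x + z ≠ 0 ∧ y + z ≠ 0 ∧ z ≠ 0 then
        ENNReal.ofReal (cubicKernel α θ x y z) else 0) ≠ ∞ := by
  obtain ⟨D₀, hD₀1, hD₀⟩ := hα.exists_inv_abs_latFreq_le hC₀ hγ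
  set D := 4 * D₀ with hDdef
  have hD1 : 1 ≤ D := by linarith
  set A := 1 + (|α.1| + |α.2|) with hAdef
  have hA1 : 1 ≤ A := by rw [hAdef]; linarith [abs_nonneg α.1, abs_nonneg α.2]
  have hA : ∀ ξ, |latFreq α ξ| ≤ A * br ξ := fun ξ => (abs_latFreq_le α ξ).trans (by
    have := br_pos ξ; rw [hAdef]; nlinarith)
  have hD : ∀ x y : ℤ × ℤ, x + y ≠ 0 → |latFreq α x + latFreq α y|⁻¹ ≤ D * (br x * br y) := by
    intro x y hxy
    rw [← latFreq_add]
    refine (hD₀ _ hxy).trans ?_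
    have h1 : br (x + y) ^ (γ / 2) ≤ br (x + y) :=
      Real.rpow_le_self_of_one_le (one_le_br _) (by linarith)
    have h2 := br_add_le x y
    rw [hDdef]
    nlinarith
  set f : ℤ × ℤ → ℝ≥0∞ := fun x => ENNReal.ofReal (br x ^ (-(2 * θ - 1 / 2))) with hf
  set g : ℤ × ℤ → ℝ≥0∞ := fun z =>
    ENNReal.ofReal ((1 + |latFreq α z|⁻¹) * br z ^ (-(2 * θ - 1 / 4))) with hg
  set P : ℤ × ℤ → ℝ≥0∞ := fun p => 1 + ENNReal.ofReal (|latFreq α p| ^ (-(1 / 2) : ℝ)) with hP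
  set C : ℝ≥0∞ := ENNReal.ofReal (8 * A * D) with hC
  have hpt : ∀ x y z : ℤ × ℤ, (if x + y ≠ 0 ∧ x + z ≠ 0 ∧ y + z ≠ 0 ∧ z ≠ 0 then
        ENNReal.ofReal (cubicKernel α θ x y z) else 0) ≤ C * (f x * f y * P (x + y)) * g z := by
    intro x y z
    split_ifs with h
    swap
    · exact zero_le
    obtain ⟨hxy, hxz, hyz, hz⟩ := h
    have hbx := br_pos x
    have hby := br_pos y
    have hbz := br_pos z
    have hne : ∀ u v : ℤ × ℤ, u + v ≠ 0 → latFreq α u + latFreq α v ≠ 0 := fun u v huv => by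
      rw [← latFreq_add]; exact hα.latFreq_ne_zero hC₀ huv
    have hm := multiplier_le hA1 hD1 (one_le_br x) (one_le_br y) (one_le_br z) (hA x) (hA y)
      (hα.latFreq_ne_zero hC₀ hz) (hne _ _ hxy) (hne _ _ hxz) (hne _ _ hyz) (hD _ _ hxz)
      (hD _ _ hyz)
    simp only [hC, hf, hg, hP]
    rw [latFreq_add, ← ENNReal.ofReal_one, ← ENNReal.ofReal_add (by norm_num) (by positivity),
      ← ENNReal.ofReal_mul (by positivity), ← ENNReal.ofReal_mul (by positivity),
      ← ENNReal.ofReal_mul (by positivity), ← ENNReal.ofReal_mul (by positivity)]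
    refine ENNReal.ofReal_le_ofReal ?_
    have hsplit : ∀ (u : ℤ × ℤ) (s : ℝ), br u ^ (-(2 * θ - s)) = br u ^ s * br u ^ (-(2 * θ)) := by
      intro u s
      rw [← Real.rpow_add (br_pos u)]
      congr 1
      ring
    rw [hsplit x, hsplit y, hsplit z, cubicKernel, resonance]
    refine (mul_le_mul_of_nonneg_right hm (by positivity)).trans (le_of_eq ?_)
    ring
  have hPf : ∑' x : ℤ × ℤ, ∑' y : ℤ × ℤ, f x * f y * P (x + y) ≠ ∞ := by
    obtain ⟨K, hK⟩ := exists_tsum_br_convolution_le (β := 2 * θ - 1 / 2) (by linarith)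
    have hre : ∀ x : ℤ × ℤ, ∑' y : ℤ × ℤ, f x * f y * P (x + y) =
        ∑' d : ℤ × ℤ, f x * f (d - x) * P d := by
      intro x
      rw [← (Equiv.addLeft x).tsum_eq (fun d => f x * f (d - x) * P d)]
      simp
    simp only [hre]
    rw [ENNReal.tsum_comm]
    simp only [ENNReal.tsum_mul_right]
    refine ne_top_of_le_ne_top (b := ∑' d : ℤ × ℤ, (K * f d) * P d) ?_
      (ENNReal.tsum_le_tsum fun d => mul_le_mul' (hK d) le_rfl)
    simp only [mul_assoc]
    rw [ENNReal.tsum_mul_left]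
    refine ENNReal.mul_ne_top ENNReal.coe_ne_top ?_
    simp only [hP, mul_add, mul_one]
    rw [ENNReal.tsum_add]
    refine ENNReal.add_ne_top.2 ⟨tsum_br_rpow_ne_top (by linarith), ?_⟩
    have := hα.tsum_latFreq_rpow_ne_top hC₀ hγ (κ := 1 / 2) (β := 2 * θ - 1 / 2) (by norm_num)
      (by linarith) (by linarith)
    convert this using 3 with d
    have hbd := br_pos d
    rw [← ENNReal.ofReal_mul (by positivity), mul_comm]
  have hgs : ∑' z, g z ≠ ∞ := by
    simp only [hg]
    -- The tightest condition: γ + 1 < 2(2θ - 1/4), which follows from γ < 2 and θ > 7/8.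
    have h1 := hα.tsum_latFreq_rpow_ne_top hC₀ hγ (κ := 1) (β := 2 * θ - 1 / 4) (by norm_num)
      (by linarith) (by linarith)
    have h2 := tsum_br_rpow_ne_top (β := 2 * θ - 1 / 4) (by linarith)
    have h3 := ENNReal.add_ne_top.2 ⟨h2, h1⟩
    rw [← ENNReal.tsum_add] at h3
    convert h3 using 3 with z
    have hbz := br_pos z
    rw [← ENNReal.ofReal_add (by positivity) (by positivity), Real.rpow_neg_one]
    congr 1
    ring
  refine ne_top_of_le_ne_top ?_ (ENNReal.tsum_le_tsum fun x => ENNReal.tsum_le_tsum fun y =>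
    ENNReal.tsum_le_tsum fun z => hpt x y z)
  simp only [ENNReal.tsum_mul_left, ENNReal.tsum_mul_right]
  exact ENNReal.mul_ne_top (ENNReal.mul_ne_top ENNReal.ofReal_ne_top hPf) hgs

/-! ### Weighted ℓ² sequences on the lattice. -/

theorem tsum_mul_sq_le {ι : Type*} (f g : ι → ℝ≥0∞) :
    (∑' i, f i * g i) ^ 2 ≤ (∑' i, f i ^ 2) * ∑' i, g i ^ 2 := by
  let _ : MeasurableSpace ι := ⊤
  have h := lintegral_mul_sq_le (Measure.count : Measure ι) (f := f) (g := g)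
    (Measurable.of_discrete).aemeasurable (Measurable.of_discrete).aemeasurable
  simpa only [lintegral_count] using h

/-- The weight `⟨ξ₁⟩^θ ⟨ξ₂⟩^θ / |α · ξ|^{1/2}` on the whole lattice. -/
noncomputable def latWeight (α : ℝ × ℝ) (θ : ℝ) (ξ : ℤ × ℤ) : ℝ :=
  br ξ ^ θ / |latFreq α ξ| ^ (1 / 2 : ℝ)

/-- The reciprocal of the weight. -/
noncomputable def invWeight (α : ℝ × ℝ) (θ : ℝ) (ξ : ℤ × ℤ) : ℝ :=
  |latFreq α ξ| ^ (1 / 2 : ℝ) * br ξ ^ (-θ)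

/-- The square of the weighted `ℓ²` norm on the whole lattice. -/
noncomputable def latNormSq (α : ℝ × ℝ) (θ : ℝ) (a : ℤ × ℤ → ℝ≥0∞) : ℝ≥0∞ :=
  ∑' ξ, (ENNReal.ofReal (latWeight α θ ξ) * a ξ) ^ 2

/-- Extension by zero from `Freq` to the whole lattice. -/
noncomputable def extendZero {M : Type*} [Zero M] (f : Freq → M) (ξ : ℤ × ℤ) : M :=
  open scoped Classical in if h : ξ ≠ 0 then f ⟨ξ, h⟩ else 0

section extendZero

variable {M : Type*} [Zero M]

@[simp] theorem extendZero_zero (f : Freq → M) : extendZero f 0 = 0 := by simp [extendZero]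

@[simp] theorem extendZero_coe (f : Freq → M) (ξ : Freq) : extendZero f ξ.1 = f ξ := by
  simp [extendZero, ξ.2]

theorem extendZero_of_ne (f : Freq → M) {ξ : ℤ × ℤ} (h : ξ ≠ 0) :
    extendZero f ξ = f ⟨ξ, h⟩ := by simp [extendZero, h]

end extendZero

theorem extendZero_sub (f g : Freq → ℂ) (ξ : ℤ × ℤ) :
    extendZero (f - g) ξ = extendZero f ξ - extendZero g ξ := by
  by_cases h : ξ = 0
  · simp [h]
  · simp [extendZero_of_ne _ h]

theorem enorm_extendZero (f : Freq → ℂ) (ξ : ℤ × ℤ) :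
    ‖extendZero f ξ‖ₑ = extendZero (fun ζ => ‖f ζ‖ₑ) ξ := by
  by_cases h : ξ = 0
  · simp [h]
  · simp [extendZero_of_ne _ h]

theorem tsum_freq_eq {G : ℤ × ℤ → ℝ≥0∞} (h0 : G 0 = 0) : ∑' ξ : Freq, G ξ.1 = ∑' ξ, G ξ :=
  tsum_subtype_eq_of_support_subset (s := {ξ : ℤ × ℤ | ξ ≠ 0}) (f := G) fun ξ hξ h => by
    rw [h] at hξ
    exact hξ h0

theorem hatNorm_sq (α : ℝ × ℝ) (θ : ℝ) (a : Freq → ℝ≥0∞) :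
    hatNorm α θ a ^ 2 = latNormSq α θ (extendZero a) := by
  rw [hatNorm, ← ENNReal.rpow_natCast, ← ENNReal.rpow_mul, latNormSq]
  norm_num
  rw [← tsum_freq_eq (G := fun ξ => (ENNReal.ofReal (latWeight α θ ξ) * extendZero a ξ) ^ 2)
    (by simp)]
  refine tsum_congr fun ξ => ?_
  rw [extendZero_coe, latWeight, weight, br, Real.mul_rpow (jb_pos _).le (jb_pos _).le]
  rfl

theorem gNorm_sq (α : ℝ × ℝ) (θ : ℝ) (f : Freq → ℂ) :
    gNorm α θ f ^ 2 = latNormSq α θ (fun ξ => ‖extendZero f ξ‖ₑ) := by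
  rw [gNorm, hatNorm_sq]
  congr 1
  ext ξ
  rw [enorm_extendZero]

section Weighted

variable {α : ℝ × ℝ} {γ C₀ θ : ℝ}

/-- The form in which every Cauchy–Schwarz below inserts the weight. Both weights vanish at the
origin (division by zero is zero), hence the condition `a 0 = 0`. -/
theorem Diophantine.eq_invWeight_mul (hα : Diophantine α γ C₀) (hC₀ : 0 < C₀)
    {a : ℤ × ℤ → ℝ≥0∞} (ha : a 0 = 0) (ξ : ℤ × ℤ) :
    a ξ = ENNReal.ofReal (invWeight α θ ξ) * (ENNReal.ofReal (latWeight α θ ξ) * a ξ) := by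
  by_cases h : ξ = 0
  · rw [h, ha, mul_zero, mul_zero]
  · have hb := br_pos ξ
    have hω := abs_pos.2 (hα.latFreq_ne_zero hC₀ h)
    rw [← mul_assoc, invWeight, latWeight, ← ENNReal.ofReal_mul (by positivity),
      Real.rpow_neg hb.le]
    have : |latFreq α ξ| ^ (1 / 2 : ℝ) * (br ξ ^ θ)⁻¹ * (br ξ ^ θ / |latFreq α ξ| ^ (1 / 2 : ℝ)) =
        1 := by
      have h1 := Real.rpow_pos_of_pos hω (1 / 2)
      have h2 := Real.rpow_pos_of_pos hb θ
      field_simp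
    rw [this, ENNReal.ofReal_one, one_mul]

theorem invWeight_sq (ξ : ℤ × ℤ) :
    invWeight α θ ξ ^ 2 = |latFreq α ξ| * br ξ ^ (-(2 * θ)) := by
  have hb := br_pos ξ
  rw [invWeight, mul_pow, ← Real.rpow_natCast, ← Real.rpow_mul (abs_nonneg _),
    ← Real.rpow_natCast, ← Real.rpow_mul hb.le]
  congr 1
  · norm_num
  · congr 1
    push_cast
    ring

theorem invWeight_nonneg (ξ : ℤ × ℤ) : 0 ≤ invWeight α θ ξ := by
  have hb := br_pos ξ
  unfold invWeight
  positivity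

theorem invWeight_sq_le (hθ : 1 / 2 ≤ θ) (ξ : ℤ × ℤ) :
    invWeight α θ ξ ^ 2 ≤ |α.1| + |α.2| := by
  have hb := br_pos ξ
  rw [invWeight_sq]
  have h1 : br ξ ^ (-(2 * θ)) ≤ (br ξ)⁻¹ := by
    rw [← Real.rpow_neg_one]
    exact Real.rpow_le_rpow_of_exponent_le (one_le_br ξ) (by linarith)
  calc _ ≤ ((|α.1| + |α.2|) * br ξ) * (br ξ)⁻¹ := by
        have := abs_latFreq_le α ξ
        gcongr
    _ = _ := by field_simp

theorem Diophantine.tsum_sq_le (hα : Diophantine α γ C₀) (hC₀ : 0 < C₀) (hθ : 1 / 2 ≤ θ)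
    {a : ℤ × ℤ → ℝ≥0∞} (ha : a 0 = 0) :
    ∑' ξ, a ξ ^ 2 ≤ ENNReal.ofReal (|α.1| + |α.2|) * latNormSq α θ a := by
  rw [latNormSq, ← ENNReal.tsum_mul_left]
  refine ENNReal.tsum_le_tsum fun ξ => ?_
  conv_lhs => rw [hα.eq_invWeight_mul hC₀ (θ := θ) ha ξ]
  rw [mul_pow]
  gcongr
  rw [← ENNReal.ofReal_pow (invWeight_nonneg ξ)]
  exact ENNReal.ofReal_le_ofReal (invWeight_sq_le hθ ξ)

/-- Convolutions of sequences in the weighted space are bounded. -/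
theorem Diophantine.tsum_convolution_sq_le (hα : Diophantine α γ C₀) (hC₀ : 0 < C₀)
    (hθ : 1 / 2 ≤ θ) {a b : ℤ × ℤ → ℝ≥0∞} (ha : a 0 = 0) (hb : b 0 = 0) (ξ : ℤ × ℤ) :
    (∑' x, a x * b (ξ - x)) ^ 2 ≤
      ENNReal.ofReal (|α.1| + |α.2|) ^ 2 * (latNormSq α θ a * latNormSq α θ b) := by
  refine (tsum_mul_sq_le _ _).trans ?_
  have h : ∑' x, b (ξ - x) ^ 2 = ∑' x, b x ^ 2 := (Equiv.subLeft ξ).tsum_eq (fun x => b x ^ 2)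
  rw [h]
  refine (mul_le_mul' (hα.tsum_sq_le hC₀ hθ ha) (hα.tsum_sq_le hC₀ hθ hb)).trans (le_of_eq ?_)
  ring

/-- Cauchy–Schwarz against the weight leaves ∑ |ω|⁻¹ (⟨ξ₁⟩⟨ξ₂⟩)^{-2θ}, convergent because γ + 1 <
4θ. This puts q̂/ω in ℓ¹ and supplies the bound `M₁` below. -/
theorem Diophantine.exists_tsum_div_sq_le (hα : Diophantine α γ C₀) (hC₀ : 0 < C₀) (hγ : 0 < γ)
    (hθ : 1 / 2 < θ) (hθγ : γ + 1 < 4 * θ) : ∃ K : ℝ≥0, ∀ a : ℤ × ℤ → ℝ≥0∞, a 0 = 0 →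
      (∑' ξ, ENNReal.ofReal |latFreq α ξ|⁻¹ * a ξ) ^ 2 ≤ K * latNormSq α θ a := by
  have hS := hα.tsum_latFreq_rpow_ne_top hC₀ hγ (κ := 1) (β := 2 * θ) one_pos
    (by linarith) (by linarith)
  refine ⟨(∑' ξ : ℤ × ℤ, ENNReal.ofReal (|latFreq α ξ| ^ (-1 : ℝ) * br ξ ^ (-(2 * θ)))).toNNReal,
    fun a ha => ?_⟩
  rw [ENNReal.coe_toNNReal hS, latNormSq]
  have h : ∀ ξ, ENNReal.ofReal |latFreq α ξ|⁻¹ * a ξ =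
      ENNReal.ofReal (|latFreq α ξ|⁻¹ * invWeight α θ ξ) *
        (ENNReal.ofReal (latWeight α θ ξ) * a ξ) := by
    intro ξ
    rw [ENNReal.ofReal_mul (by positivity), mul_assoc, ← hα.eq_invWeight_mul hC₀ ha]
  rw [tsum_congr h]
  refine (tsum_mul_sq_le _ _).trans (mul_le_mul' (ENNReal.tsum_le_tsum fun ξ => ?_) le_rfl)
  have hn := invWeight_nonneg (α := α) (θ := θ) ξ
  rw [← ENNReal.ofReal_pow (by positivity)]
  refine ENNReal.ofReal_le_ofReal ?_
  rw [mul_pow, invWeight_sq, Real.rpow_neg_one, sq, ← mul_assoc, mul_assoc |latFreq α ξ|⁻¹]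
  refine mul_le_mul_of_nonneg_right ?_ (by have := br_pos ξ; positivity)
  refine mul_le_of_le_one_right (by positivity) ?_
  exact inv_mul_le_one

theorem latNormSq_le_two_mul (a b c : ℤ × ℤ → ℝ≥0∞) (h : ∀ ξ, a ξ ≤ b ξ + c ξ) :
    latNormSq α θ a ≤ 2 * (latNormSq α θ b + latNormSq α θ c) := by
  simp only [latNormSq]
  rw [← ENNReal.tsum_add, ← ENNReal.tsum_mul_left]
  refine ENNReal.tsum_le_tsum fun ξ => ?_
  have h2 := ENNReal.rpow_add_le_mul_rpow_add_rpow (ENNReal.ofReal (latWeight α θ ξ) * b ξ)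
    (ENNReal.ofReal (latWeight α θ ξ) * c ξ) (p := 2) (by norm_num)
  norm_num at h2
  refine le_trans ?_ h2
  rw [← mul_add]
  gcongr
  exact h ξ

end Weighted

/-! ### Autoconvolution, exchange of sums and time integrals, and the phase. -/

/-- The autoconvolution on the lattice. -/
noncomputable def autoConv (f : ℤ × ℤ → ℂ) (ξ : ℤ × ℤ) : ℂ := ∑' x, f x * f (ξ - x)

/-- Decompositions with a zero summand may be included, since the extension vanishes at the origin.
-/
theorem squareCoeff_eq_autoConv (f : Freq → ℂ) (ξ : Freq) :
    squareCoeff f ξ = autoConv (extendZero f) ξ.1 := by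
  have hinj : Function.Injective
      (fun p : {p : Freq × Freq // p.1.1 + p.2.1 = ξ.1} => p.1.1.1) := by
    rintro ⟨⟨p, q⟩, hp⟩ ⟨⟨p', q'⟩, hp'⟩ h
    simp only at h hp hp'
    have h1 : p = p' := Subtype.ext h
    have h2 : q = q' := Subtype.ext (by rw [← h1, ← hp] at hp'; exact (add_left_cancel hp').symm)
    subst h1 h2
    rfl
  rw [autoConv, ← hinj.tsum_eq (f := fun x => extendZero f x * extendZero f (ξ.1 - x))]
  · refine tsum_congr fun p => ?_
    have h : ξ.1 - p.1.1.1 = p.1.2.1 := sub_eq_of_eq_add' p.2.symm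
    simp only [h, extendZero_coe]
  · intro x hx
    have h1 : x ≠ 0 := by rintro rfl; simp at hx
    have h2 : ξ.1 - x ≠ 0 := by intro h; simp [h] at hx
    exact ⟨⟨(⟨x, h1⟩, ⟨ξ.1 - x, h2⟩), add_sub_cancel _ _⟩, rfl⟩

theorem summable_of_tsum_enorm_ne_top {ι : Type*} {f : ι → ℂ} (h : ∑' i, ‖f i‖ₑ ≠ ∞) :
    Summable f :=
  Summable.of_nnnorm (ENNReal.tsum_coe_ne_top_iff_summable.1 h)

theorem le_rpow_half_of_sq_le {x y : ℝ≥0∞} (h : x ^ 2 ≤ y) : x ≤ y ^ (1 / 2 : ℝ) := by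
  have h2 := ENNReal.rpow_le_rpow h (by norm_num : (0 : ℝ) ≤ 1 / 2)
  rw [← ENNReal.rpow_natCast, ← ENNReal.rpow_mul] at h2
  norm_num at h2
  simpa using h2

theorem summable_and_tsum_intervalIntegral {ι : Type*} [Countable ι] {F : ι → ℝ → ℂ} {t : ℝ}
    (hF : ∀ i, Continuous (F i))
    (h : ∑' i, ∫⁻ s in Set.uIoc 0 t, ‖F i s‖ₑ ≠ ∞) :
    (Summable fun i => ∫ s in (0 : ℝ)..t, F i s) ∧
      ∑' i, ∫ s in (0 : ℝ)..t, F i s = ∫ s in (0 : ℝ)..t, ∑' i, F i s := by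
  refine ⟨summable_of_tsum_enorm_ne_top (ne_top_of_le_ne_top h (ENNReal.tsum_le_tsum fun i =>
    enorm_intervalIntegral_le_setLIntegral _ _ _)), ?_⟩
  simp only [intervalIntegral.intervalIntegral_eq_integral_uIoc]
  rw [integral_tsum (fun i => (hF i).aestronglyMeasurable) h, tsum_const_smul'']

theorem tsum_setLIntegral_le {ι : Type*} [Countable ι] {g : ι → ℝ → ℝ≥0∞} {M : ℝ≥0∞} {t T : ℝ}
    (hg : ∀ i, Measurable (g i)) (hM : ∀ s, ∑' i, g i s ≤ M) (ht : |t| ≤ T) :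
    ∑' i, ∫⁻ s in Set.uIoc 0 t, g i s ≤ M * ENNReal.ofReal T := by
  rw [← lintegral_tsum fun i => (hg i).aemeasurable]
  refine (lintegral_mono hM).trans ?_
  rw [lintegral_const, Measure.restrict_apply_univ, Set.uIoc, Real.volume_Ioc, max_sub_min_eq_abs,
    sub_zero]
  gcongr

/-- The oscillating factor `e^{-is(α·ξ)³}`. -/
noncomputable def phase (α : ℝ × ℝ) (ξ : ℤ × ℤ) (s : ℝ) : ℂ :=
  Complex.exp (-(Complex.I * ((latFreq α ξ ^ 3 * s : ℝ) : ℂ)))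

theorem enorm_phase (α : ℝ × ℝ) (ξ : ℤ × ℤ) (s : ℝ) : ‖phase α ξ s‖ₑ = 1 :=
  enorm_exp_neg_I_mul _

@[fun_prop]
theorem continuous_phase (α : ℝ × ℝ) (ξ : ℤ × ℤ) : Continuous (phase α ξ) := by
  unfold phase; fun_prop

theorem hasDerivAt_phase (α : ℝ × ℝ) (ξ : ℤ × ℤ) (s : ℝ) :
    HasDerivAt (phase α ξ) (-(Complex.I * (latFreq α ξ : ℂ) ^ 3) * phase α ξ s) s := by
  have h1 : HasDerivAt (fun s : ℝ => -(Complex.I * ((latFreq α ξ ^ 3 * s : ℝ) : ℂ)))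
      (-(Complex.I * (latFreq α ξ : ℂ) ^ 3)) s := by
    have h2 : HasDerivAt (fun s : ℝ => ((latFreq α ξ ^ 3 * s : ℝ) : ℂ))
        ((latFreq α ξ ^ 3 * 1 : ℝ) : ℂ) s :=
      ((hasDerivAt_id s).const_mul (latFreq α ξ ^ 3)).ofReal_comp
    have h3 := (h2.const_mul Complex.I).neg
    simpa using! h3
  have h := h1.cexp
  rw [mul_comm] at h
  exact h

/-! ### The normal form: integration by parts in time. -/

/-- The quadratic nonlinearity without its zero mode. -/
noncomputable def quadratic (Q : ℝ → ℤ × ℤ → ℂ) (s : ℝ) (a : ℤ × ℤ) : ℂ :=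
  if a = 0 then 0 else autoConv (Q s) a

/-- A solution of the lattice form of the equation on `(-T, T)`, with the bounds that justify all
interchanges of sums and integrals. -/
structure LatticeSolution (α : ℝ × ℝ) (T : ℝ) (M₁ M₂ : ℝ≥0∞) (Q : ℝ → ℤ × ℤ → ℂ) : Prop where
  freq_ne : ∀ ξ : ℤ × ℤ, ξ ≠ 0 → latFreq α ξ ≠ 0
  zero : ∀ s, Q s 0 = 0
  continuous : ∀ x, Continuous fun s => Q s x
  continuous_conv : ∀ x, Continuous fun s => autoConv (Q s) x
  ne_top₁ : M₁ ≠ ∞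
  ne_top₂ : M₂ ≠ ∞
  div_le : ∀ s, ∑' x, ENNReal.ofReal |latFreq α x|⁻¹ * ‖Q s x‖ₑ ≤ M₁
  conv_le : ∀ s ξ, ∑' x, ‖Q s x‖ₑ * ‖Q s (ξ - x)‖ₑ ≤ M₂
  hasDerivAt : ∀ s ∈ Set.Ioo (-T) T, ∀ a, HasDerivAt (fun s => Q s a)
    (Complex.I * (latFreq α a : ℂ) ^ 3 * Q s a +
      3 * Complex.I * (latFreq α a : ℂ) * autoConv (Q s) a) s

theorem enorm_inv_latFreq (α : ℝ × ℝ) (ξ : ℤ × ℤ) :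
    ‖((latFreq α ξ : ℂ))⁻¹‖ₑ = ENNReal.ofReal |latFreq α ξ|⁻¹ := by
  rw [← ofReal_norm, norm_inv, Complex.norm_real, Real.norm_eq_abs]

namespace LatticeSolution

variable {α : ℝ × ℝ} {T : ℝ} {M₁ M₂ : ℝ≥0∞} {Q : ℝ → ℤ × ℤ → ℂ}

theorem enorm_autoConv_le (hQ : LatticeSolution α T M₁ M₂ Q) (s : ℝ) (a : ℤ × ℤ) :
    ‖autoConv (Q s) a‖ₑ ≤ M₂ := by
  refine (enorm_tsum_le_tsum_enorm).trans (le_trans (le_of_eq ?_) (hQ.conv_le s a))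
  simp only [enorm_mul]

theorem continuous_quadratic (hQ : LatticeSolution α T M₁ M₂ Q) (a : ℤ × ℤ) :
    Continuous fun s => quadratic Q s a := by
  by_cases h : a = 0
  · simp [quadratic, h, continuous_const]
  · simpa [quadratic, h] using hQ.continuous_conv a

theorem enorm_quadratic_le (hQ : LatticeSolution α T M₁ M₂ Q) (s : ℝ) (a : ℤ × ℤ) :
    ‖quadratic Q s a‖ₑ ≤ M₂ := by
  unfold quadratic
  split_ifs
  · simp
  · exact hQ.enorm_autoConv_le s a

/-- The cubic interaction of the modes `a` and `ξ - a`. -/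
noncomputable def cubicTerm (α : ℝ × ℝ) (Q : ℝ → ℤ × ℤ → ℂ) (ξ : ℤ × ℤ) (t : ℝ) (a : ℤ × ℤ) : ℂ :=
  ∫ s in (0 : ℝ)..t, phase α ξ s *
    (quadratic Q s a * (Q s (ξ - a) * ((latFreq α (ξ - a) : ℂ))⁻¹))

theorem uIcc_subset {t T : ℝ} (ht : |t| ≤ T) : Set.Ioo (min 0 t) (max 0 t) ⊆ Set.Ioo (-T) T := by
  have h := abs_le.1 ht
  have h0 := (abs_nonneg t).trans ht
  exact Set.Ioo_subset_Ioo (le_min (by linarith) h.1) (max_le h0 h.2)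

/-- Integration by parts in time for the interaction of the modes `a` and `ξ - a`. -/
theorem integral_mode_eq (hQ : LatticeSolution α T M₁ M₂ Q) {t : ℝ} (ht : |t| ≤ T)
    (ξ a : ℤ × ℤ) :
    3 * Complex.I * (latFreq α ξ : ℂ) *
        ∫ s in (0 : ℝ)..t, phase α ξ s * (Q s a * Q s (ξ - a)) =
      -((latFreq α a : ℂ)⁻¹ * (latFreq α (ξ - a) : ℂ)⁻¹ *
          (phase α ξ t * (Q t a * Q t (ξ - a)) - phase α ξ 0 * (Q 0 a * Q 0 (ξ - a)))) +
        3 * Complex.I * (cubicTerm α Q ξ t a + cubicTerm α Q ξ t (ξ - a)) := by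
  by_cases ha : a = 0
  · simp [ha, hQ.zero, cubicTerm, quadratic]
  by_cases hb : ξ - a = 0
  · simp [hb, hQ.zero, cubicTerm, quadratic]
  have hωa := hQ.freq_ne a ha
  have hωb := hQ.freq_ne _ hb
  have hωa' : (latFreq α a : ℂ) ≠ 0 := by exact_mod_cast hωa
  have hωb' : (latFreq α (ξ - a) : ℂ) ≠ 0 := by exact_mod_cast hωb
  have hω : (latFreq α ξ : ℂ) = latFreq α a + latFreq α (ξ - a) := by
    rw [latFreq_sub]; push_cast; ring
  have hca := hQ.continuous a
  have hcb := hQ.continuous (ξ - a)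
  have hqa := hQ.continuous_conv a
  have hqb := hQ.continuous_conv (ξ - a)
  set u : ℝ → ℂ := fun s => phase α ξ s * (Q s a * Q s (ξ - a)) with hu
  set v : ℝ → ℂ := fun s => phase α ξ s *
    (autoConv (Q s) a * (Q s (ξ - a) * ((latFreq α (ξ - a) : ℂ))⁻¹)) with hv
  set w : ℝ → ℂ := fun s => phase α ξ s *
    (autoConv (Q s) (ξ - a) * (Q s a * ((latFreq α a : ℂ))⁻¹)) with hw
  have huc : Continuous u := by fun_prop
  have hvc : Continuous v := by fun_prop
  have hwc : Continuous w := by fun_prop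
  have hva : cubicTerm α Q ξ t a = ∫ s in (0 : ℝ)..t, v s := by
    simp only [cubicTerm, quadratic, if_neg ha, hv]
  have hvb : cubicTerm α Q ξ t (ξ - a) = ∫ s in (0 : ℝ)..t, w s := by
    simp only [cubicTerm, quadratic, if_neg hb, hw, sub_sub_cancel]
  -- The derivative of u: the linear parts combine to -i(ω(ξ)³ - ω(a)³ - ω(b)³) = -3iω(a)ω(b)ω(ξ)
  -- with b = ξ - a, and the nonlinear parts are ω(a)ω(b) times 3i(v + w).
  set d : ℝ → ℂ := fun s => (latFreq α a : ℂ) * (latFreq α (ξ - a) : ℂ) *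
    (3 * Complex.I * (v s + w s) - 3 * Complex.I * (latFreq α ξ : ℂ) * u s) with hd
  have hder : ∀ s ∈ Set.Ioo (min 0 t) (max 0 t), HasDerivWithinAt u (d s) (Set.Ioi s) s := by
    intro s hs
    have hs' := uIcc_subset ht hs
    have h := (hasDerivAt_phase α ξ s).mul
      ((hQ.hasDerivAt s hs' a).mul (hQ.hasDerivAt s hs' (ξ - a)))
    refine (h.congr_deriv ?_).hasDerivWithinAt
    simp only [hd, hu, hv, hw, hω, Pi.mul_apply]
    field_simp
    ring
  -- The equation is available only on the open interval (-T, T) and t may equal ±T, hence the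
  -- version with continuity up to the endpoints.
  have hftc := intervalIntegral.integral_eq_sub_of_hasDeriv_right huc.continuousOn hder
    (Continuous.intervalIntegrable (by fun_prop) _ _)
  have hint : ∫ s in (0 : ℝ)..t, d s = (latFreq α a : ℂ) * (latFreq α (ξ - a) : ℂ) *
      (3 * Complex.I * ((∫ s in (0 : ℝ)..t, v s) + ∫ s in (0 : ℝ)..t, w s) -
        3 * Complex.I * (latFreq α ξ : ℂ) * ∫ s in (0 : ℝ)..t, u s) := by
    simp only [hd]
    rw [intervalIntegral.integral_const_mul, intervalIntegral.integral_sub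
      (Continuous.intervalIntegrable (by fun_prop) _ _)
      (Continuous.intervalIntegrable (by fun_prop) _ _),
      intervalIntegral.integral_const_mul, intervalIntegral.integral_const_mul,
      intervalIntegral.integral_add (hvc.intervalIntegrable _ _) (hwc.intervalIntegrable _ _)]
  rw [hint] at hftc
  rw [hva, hvb]
  change 3 * Complex.I * (latFreq α ξ : ℂ) * (∫ s in (0 : ℝ)..t, u s) =
    -((latFreq α a : ℂ)⁻¹ * (latFreq α (ξ - a) : ℂ)⁻¹ * (u t - u 0)) + _
  rw [← hftc]
  field_simp
  ring

theorem tsum_setLIntegral_quadratic_le (hQ : LatticeSolution α T M₁ M₂ Q) {t : ℝ} (ht : |t| ≤ T)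
    (ξ : ℤ × ℤ) : ∑' a, ∫⁻ s in Set.uIoc 0 t, ‖phase α ξ s *
      (quadratic Q s a * (Q s (ξ - a) * ((latFreq α (ξ - a) : ℂ))⁻¹))‖ₑ ≤
        (M₂ * M₁) * ENNReal.ofReal T := by
  refine tsum_setLIntegral_le (fun a => ?_) (fun s => ?_) ht
  · have h1 := hQ.continuous_quadratic a
    have h2 := hQ.continuous (ξ - a)
    exact Continuous.measurable (by fun_prop)
  · simp only [enorm_mul, enorm_phase, one_mul, enorm_inv_latFreq]
    calc _ ≤ ∑' a, M₂ * (ENNReal.ofReal |latFreq α (ξ - a)|⁻¹ * ‖Q s (ξ - a)‖ₑ) :=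
          ENNReal.tsum_le_tsum fun a => by
            rw [mul_comm (‖Q s (ξ - a)‖ₑ)]
            exact mul_le_mul' (hQ.enorm_quadratic_le s a) le_rfl
      _ ≤ M₂ * M₁ := by
          have h : ∑' a, ENNReal.ofReal |latFreq α (ξ - a)|⁻¹ * ‖Q s (ξ - a)‖ₑ =
              ∑' a, ENNReal.ofReal |latFreq α a|⁻¹ * ‖Q s a‖ₑ :=
            (Equiv.subLeft ξ).tsum_eq (fun a => ENNReal.ofReal |latFreq α a|⁻¹ * ‖Q s a‖ₑ)
          rw [ENNReal.tsum_mul_left, h]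
          exact mul_le_mul' le_rfl (hQ.div_le s)

theorem summable_cubicTerm (hQ : LatticeSolution α T M₁ M₂ Q) {t : ℝ} (ht : |t| ≤ T)
    (ξ : ℤ × ℤ) : Summable (cubicTerm α Q ξ t) := by
  refine (summable_and_tsum_intervalIntegral (fun a => ?_) (ne_top_of_le_ne_top ?_
    (hQ.tsum_setLIntegral_quadratic_le ht ξ))).1
  · have h1 := hQ.continuous_quadratic a
    have h2 := hQ.continuous (ξ - a)
    fun_prop
  · exact ENNReal.mul_ne_top (ENNReal.mul_ne_top hQ.ne_top₂ hQ.ne_top₁) ENNReal.ofReal_ne_top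

/-- The boundary term of the normal form. -/
noncomputable def boundarySum (α : ℝ × ℝ) (f : ℤ × ℤ → ℂ) (ξ : ℤ × ℤ) : ℝ≥0∞ :=
  ∑' a, (ENNReal.ofReal |latFreq α a|⁻¹ * ‖f a‖ₑ) *
    (ENNReal.ofReal |latFreq α (ξ - a)|⁻¹ * ‖f (ξ - a)‖ₑ)

/-- The boundary term is the convolution of the ℓ¹ sequence |q̂|/|ω| with itself. -/
theorem tsum_boundarySum_le (hQ : LatticeSolution α T M₁ M₂ Q) (s : ℝ) :
    ∑' ξ, boundarySum α (Q s) ξ ≤ M₁ ^ 2 := by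
  simp only [boundarySum]
  rw [ENNReal.tsum_comm]
  simp only [ENNReal.tsum_mul_left]
  have h : ∀ a : ℤ × ℤ, ∑' ξ : ℤ × ℤ, ENNReal.ofReal |latFreq α (ξ - a)|⁻¹ * ‖Q s (ξ - a)‖ₑ =
      ∑' x, ENNReal.ofReal |latFreq α x|⁻¹ * ‖Q s x‖ₑ := fun a =>
    (Equiv.subRight a).tsum_eq (fun x => ENNReal.ofReal |latFreq α x|⁻¹ * ‖Q s x‖ₑ)
  simp only [h]
  rw [ENNReal.tsum_mul_right, sq]
  exact mul_le_mul' (hQ.div_le s) (hQ.div_le s)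

/-- The normal form: the quadratic Duhamel term is a boundary term plus a cubic term. -/
theorem enorm_duhamel_le (hQ : LatticeSolution α T M₁ M₂ Q) {t : ℝ} (ht : |t| ≤ T) (ξ : ℤ × ℤ) :
    ‖3 * Complex.I * (latFreq α ξ : ℂ) *
        ∫ s in (0 : ℝ)..t, phase α ξ s * autoConv (Q s) ξ‖ₑ ≤
      boundarySum α (Q t) ξ + boundarySum α (Q 0) ξ + 6 * ‖∑' a, cubicTerm α Q ξ t a‖ₑ := by
  have hM₁ : M₁ ^ 2 ≠ ∞ := ENNReal.pow_ne_top hQ.ne_top₁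
  have hsum := summable_and_tsum_intervalIntegral (t := t)
    (F := fun a s => phase α ξ s * (Q s a * Q s (ξ - a)))
    (fun a => by have h1 := hQ.continuous a; have h2 := hQ.continuous (ξ - a); fun_prop)
    (ne_top_of_le_ne_top (ENNReal.mul_ne_top hQ.ne_top₂ (ENNReal.ofReal_ne_top (r := T)))
      (tsum_setLIntegral_le (fun a => by
        have h1 := hQ.continuous a; have h2 := hQ.continuous (ξ - a)
        exact Continuous.measurable (by fun_prop))
        (fun s => by
          simp only [enorm_mul, enorm_phase, one_mul]
          exact hQ.conv_le s ξ) ht))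
  have hconv : ∫ s in (0 : ℝ)..t, phase α ξ s * autoConv (Q s) ξ =
      ∑' a, ∫ s in (0 : ℝ)..t, phase α ξ s * (Q s a * Q s (ξ - a)) := by
    rw [hsum.2]
    simp only [autoConv, tsum_mul_left]
  have hbd : ∀ s, ∑' a, ‖(latFreq α a : ℂ)⁻¹ * (latFreq α (ξ - a) : ℂ)⁻¹ *
      (phase α ξ s * (Q s a * Q s (ξ - a)))‖ₑ = boundarySum α (Q s) ξ := by
    intro s
    refine tsum_congr fun a => ?_
    simp only [enorm_mul, enorm_phase, one_mul, enorm_inv_latFreq]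
    ring
  have hbdt : ∀ s, boundarySum α (Q s) ξ ≠ ∞ := fun s =>
    ne_top_of_le_ne_top hM₁ ((ENNReal.le_tsum ξ).trans (hQ.tsum_boundarySum_le s))
  have hbs : ∀ s, Summable fun a => (latFreq α a : ℂ)⁻¹ * (latFreq α (ξ - a) : ℂ)⁻¹ *
      (phase α ξ s * (Q s a * Q s (ξ - a))) := fun s =>
    summable_of_tsum_enorm_ne_top (by rw [hbd]; exact hbdt s)
  have hcs := hQ.summable_cubicTerm ht ξ
  have hcs' : Summable fun a => cubicTerm α Q ξ t (ξ - a) := (Equiv.subLeft ξ).summable_iff.2 hcs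
  have hcs'' : ∑' a, cubicTerm α Q ξ t (ξ - a) = ∑' a, cubicTerm α Q ξ t a :=
    (Equiv.subLeft ξ).tsum_eq (cubicTerm α Q ξ t)
  -- The cubic terms for a and ξ - a have the same sum over a, so 3i doubles to 6i.
  have hid : 3 * Complex.I * (latFreq α ξ : ℂ) *
        ∫ s in (0 : ℝ)..t, phase α ξ s * autoConv (Q s) ξ =
      -(∑' a, (latFreq α a : ℂ)⁻¹ * (latFreq α (ξ - a) : ℂ)⁻¹ *
          (phase α ξ t * (Q t a * Q t (ξ - a)))) +
        (∑' a, (latFreq α a : ℂ)⁻¹ * (latFreq α (ξ - a) : ℂ)⁻¹ *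
          (phase α ξ 0 * (Q 0 a * Q 0 (ξ - a)))) +
        6 * Complex.I * ∑' a, cubicTerm α Q ξ t a := by
    rw [hconv, ← tsum_mul_left, tsum_congr (fun a => hQ.integral_mode_eq ht ξ a)]
    simp only [mul_sub]
    rw [((((hbs t).sub (hbs 0)).neg)).tsum_add ((hcs.add hcs').mul_left _), tsum_neg,
      (hbs t).tsum_sub (hbs 0), tsum_mul_left, hcs.tsum_add hcs', hcs'']
    ring
  rw [hid]
  refine (enorm_add_le _ _).trans (add_le_add ((enorm_add_le _ _).trans (add_le_add ?_ ?_)) ?_)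
  · rw [enorm_neg, ← hbd]; exact enorm_tsum_le_tsum_enorm
  · rw [← hbd]; exact enorm_tsum_le_tsum_enorm
  · rw [enorm_mul]
    refine mul_le_mul' (le_of_eq ?_) le_rfl
    rw [← ofReal_norm]
    simp

end LatticeSolution

/-! ### Resonances of the cubic term and their cancellation. -/

namespace LatticeSolution

variable {α : ℝ × ℝ} {T : ℝ} {M₁ M₂ : ℝ≥0∞} {Q : ℝ → ℤ × ℤ → ℂ}

/-- The time integral of the interaction of the modes `x`, `y` and `z` in the mode `ξ`. -/
noncomputable def trilinearIntegral (α : ℝ × ℝ) (Q : ℝ → ℤ × ℤ → ℂ) (t : ℝ) (ξ x y z : ℤ × ℤ) : ℂ :=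
  ∫ s in (0 : ℝ)..t, phase α ξ s * (Q s x * Q s y * (Q s z * ((latFreq α z : ℂ))⁻¹))

/-- The interaction of the modes `x`, `a - x` and `ξ - a`. -/
noncomputable def cubicMode (α : ℝ × ℝ) (Q : ℝ → ℤ × ℤ → ℂ) (t : ℝ) (ξ a x : ℤ × ℤ) : ℂ :=
  if a = 0 then 0 else trilinearIntegral α Q t ξ x (a - x) (ξ - a)

/-- The nonresonant part of the cubic interaction. -/
noncomputable def nonresonantMode (α : ℝ × ℝ) (Q : ℝ → ℤ × ℤ → ℂ) (t : ℝ) (ξ a x : ℤ × ℤ) : ℂ :=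
  if a ≠ 0 ∧ x ≠ ξ ∧ a - x ≠ ξ then trilinearIntegral α Q t ξ x (a - x) (ξ - a) else 0

theorem trilinearIntegral_swap (t : ℝ) (ξ x y z : ℤ × ℤ) :
    trilinearIntegral α Q t ξ x y z = trilinearIntegral α Q t ξ y x z := by
  unfold trilinearIntegral
  congr 1
  ext s
  ring

/-- The slot carrying 1/ω is odd; this is the source of the cancellation of resonances. -/
theorem trilinearIntegral_neg (t : ℝ) (ξ y : ℤ × ℤ) :
    trilinearIntegral α Q t ξ ξ (-y) y = -trilinearIntegral α Q t ξ ξ y (-y) := by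
  unfold trilinearIntegral
  rw [← intervalIntegral.integral_neg]
  congr 1
  ext s
  rw [latFreq_neg, Complex.ofReal_neg, inv_neg]
  ring

/-- Absolute convergence of the full cubic sum, which legitimates splitting off resonances and
rearranging them. -/
theorem tsum_setLIntegral_cubicMode_le (hQ : LatticeSolution α T M₁ M₂ Q) {t : ℝ} (ht : |t| ≤ T)
    (ξ : ℤ × ℤ) : ∑' p : (ℤ × ℤ) × (ℤ × ℤ), ∫⁻ s in Set.uIoc 0 t, ‖phase α ξ s *
      (Q s p.2 * Q s (p.1 - p.2) * (Q s (ξ - p.1) * ((latFreq α (ξ - p.1) : ℂ))⁻¹))‖ₑ ≤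
        (M₂ * M₁) * ENNReal.ofReal T := by
  refine tsum_setLIntegral_le (fun p => ?_) (fun s => ?_) ht
  · have h1 := hQ.continuous p.2
    have h2 := hQ.continuous (p.1 - p.2)
    have h3 := hQ.continuous (ξ - p.1)
    exact Continuous.measurable (by fun_prop)
  · simp only [enorm_mul, enorm_phase, one_mul, enorm_inv_latFreq]
    rw [ENNReal.tsum_prod']
    simp only [ENNReal.tsum_mul_right]
    have h : ∑' a, ENNReal.ofReal |latFreq α (ξ - a)|⁻¹ * ‖Q s (ξ - a)‖ₑ =
        ∑' a, ENNReal.ofReal |latFreq α a|⁻¹ * ‖Q s a‖ₑ :=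
      (Equiv.subLeft ξ).tsum_eq (fun a => ENNReal.ofReal |latFreq α a|⁻¹ * ‖Q s a‖ₑ)
    calc _ ≤ ∑' a, M₂ * (ENNReal.ofReal |latFreq α (ξ - a)|⁻¹ * ‖Q s (ξ - a)‖ₑ) :=
          ENNReal.tsum_le_tsum fun a => by
            rw [mul_comm (‖Q s (ξ - a)‖ₑ)]
            exact mul_le_mul' (hQ.conv_le s a) le_rfl
      _ ≤ M₂ * M₁ := by
          rw [ENNReal.tsum_mul_left, h]
          exact mul_le_mul' le_rfl (hQ.div_le s)

theorem ne_top_bound (hQ : LatticeSolution α T M₁ M₂ Q) :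
    (M₂ * M₁) * ENNReal.ofReal T ≠ ∞ :=
  ENNReal.mul_ne_top (ENNReal.mul_ne_top hQ.ne_top₂ hQ.ne_top₁) ENNReal.ofReal_ne_top

theorem summable_trilinearIntegral (hQ : LatticeSolution α T M₁ M₂ Q) {t : ℝ} (ht : |t| ≤ T)
    (ξ : ℤ × ℤ) : Summable fun p : (ℤ × ℤ) × (ℤ × ℤ) =>
      trilinearIntegral α Q t ξ p.2 (p.1 - p.2) (ξ - p.1) := by
  refine (summable_and_tsum_intervalIntegral (fun p => ?_)
    (ne_top_of_le_ne_top hQ.ne_top_bound (hQ.tsum_setLIntegral_cubicMode_le ht ξ))).1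
  have h1 := hQ.continuous p.2
  have h2 := hQ.continuous (p.1 - p.2)
  have h3 := hQ.continuous (ξ - p.1)
  fun_prop

theorem summable_cubicMode (hQ : LatticeSolution α T M₁ M₂ Q) {t : ℝ} (ht : |t| ≤ T)
    (ξ : ℤ × ℤ) : Summable fun p : (ℤ × ℤ) × (ℤ × ℤ) => cubicMode α Q t ξ p.1 p.2 :=
  Summable.of_norm_bounded (hQ.summable_trilinearIntegral ht ξ).norm fun p => by
    unfold cubicMode
    split_ifs
    · rw [norm_zero]; exact norm_nonneg _
    · exact le_rfl

theorem summable_nonresonantMode (hQ : LatticeSolution α T M₁ M₂ Q) {t : ℝ} (ht : |t| ≤ T)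
    (ξ : ℤ × ℤ) : Summable fun p : (ℤ × ℤ) × (ℤ × ℤ) => nonresonantMode α Q t ξ p.1 p.2 :=
  Summable.of_norm_bounded (hQ.summable_trilinearIntegral ht ξ).norm fun p => by
    unfold nonresonantMode
    split_ifs
    · exact le_rfl
    · rw [norm_zero]; exact norm_nonneg _

theorem cubicTerm_eq_tsum (hQ : LatticeSolution α T M₁ M₂ Q) {t : ℝ} (ht : |t| ≤ T)
    (ξ a : ℤ × ℤ) : cubicTerm α Q ξ t a = ∑' x, cubicMode α Q t ξ a x := by
  by_cases ha : a = 0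
  · simp [ha, cubicTerm, quadratic, cubicMode]
  have hle := hQ.tsum_setLIntegral_cubicMode_le ht ξ
  rw [ENNReal.tsum_prod'] at hle
  have hfin := ne_top_of_le_ne_top hQ.ne_top_bound ((ENNReal.le_tsum a).trans hle)
  have h := (summable_and_tsum_intervalIntegral (fun x => by
    have h1 := hQ.continuous x
    have h2 := hQ.continuous (a - x)
    have h3 := hQ.continuous (ξ - a)
    fun_prop) hfin).2
  simp only [cubicMode, if_neg ha, trilinearIntegral]
  rw [h, cubicTerm]
  congr 1
  ext s
  simp only [quadratic, if_neg ha, autoConv, tsum_mul_left, tsum_mul_right]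

/-- Inclusion–exclusion over the resonances x = ξ and a - x = ξ, which meet only when a = 2ξ.
Symmetry in the first two slots gives both the same value. -/
theorem cubicMode_eq (t : ℝ) (ξ a x : ℤ × ℤ) :
    cubicMode α Q t ξ a x = nonresonantMode α Q t ξ a x +
      (if x = ξ then cubicMode α Q t ξ a ξ else 0) +
      (if x = a - ξ then cubicMode α Q t ξ a ξ else 0) -
      (if x = ξ then (if a = ξ + ξ then cubicMode α Q t ξ a ξ else 0) else 0) := by
  by_cases ha : a = 0
  · simp [ha, cubicMode, nonresonantMode]
  by_cases h1 : x = ξ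
  · subst h1
    by_cases h2 : a = x + x
    · subst h2
      simp [nonresonantMode]
    · have h3 : ¬ x = a - x := fun h => h2 (by rw [eq_sub_iff_add_eq] at h; exact h.symm)
      simp [nonresonantMode, h2, h3]
  · by_cases h2 : x = a - ξ
    · subst h2
      simp [nonresonantMode, h1, ha, cubicMode, trilinearIntegral_swap _ _ (a - ξ) ξ]
    · have h3 : ¬ a - x = ξ := fun h => h2 (by rw [← h, sub_sub_cancel])
      simp [nonresonantMode, h1, h2, h3, ha, cubicMode]

/-- Each resonant family sums to ∑_{a≠0} n(a - ξ). As n is odd, its sum over the whole lattice is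
zero, and removing a = 0 leaves -n(-ξ) = n(ξ). Two families minus their overlap n(ξ) give n(ξ). -/
theorem tsum_cubicTerm_eq (hQ : LatticeSolution α T M₁ M₂ Q) {t : ℝ} (ht : |t| ≤ T)
    {ξ : ℤ × ℤ} (hξ : ξ ≠ 0) : ∑' a, cubicTerm α Q ξ t a =
      (∑' p : (ℤ × ℤ) × (ℤ × ℤ), nonresonantMode α Q t ξ p.1 p.2) +
        trilinearIntegral α Q t ξ ξ ξ (-ξ) := by
  have hN := hQ.summable_nonresonantMode ht ξ
  have hNs : ∀ a, Summable fun x => nonresonantMode α Q t ξ a x := fun a => hN.prod_factor a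
  have hR : Summable fun a => cubicMode α Q t ξ a ξ :=
    (hQ.summable_cubicMode ht ξ).comp_injective (i := fun a : ℤ × ℤ => (a, ξ))
      (fun a b h => (Prod.ext_iff.1 h).1)
  have htri : Summable fun a => trilinearIntegral α Q t ξ ξ (a - ξ) (ξ - a) :=
    (hQ.summable_trilinearIntegral ht ξ).comp_injective (i := fun a : ℤ × ℤ => (a, ξ))
      (fun a b h => (Prod.ext_iff.1 h).1)
  set n : ℤ × ℤ → ℂ := fun y => trilinearIntegral α Q t ξ ξ y (-y) with hn
  have hnneg : ∀ y, n (-y) = -n y := fun y => by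
    simp only [hn, neg_neg]
    exact trilinearIntegral_neg t ξ y
  have hn0 : ∑' y, n y = 0 := by
    have h1 : ∑' y, n (-y) = ∑' y, n y := (Equiv.neg (ℤ × ℤ)).tsum_eq n
    simp only [hnneg, tsum_neg] at h1
    linear_combination (-1 / 2 : ℂ) * h1
  have hnsub : ∀ a, trilinearIntegral α Q t ξ ξ (a - ξ) (ξ - a) = n (a - ξ) := fun a => by
    simp only [hn, neg_sub]
  have hRn : ∑' a, cubicMode α Q t ξ a ξ = n ξ := by
    have h1 : ∀ a, cubicMode α Q t ξ a ξ = n (a - ξ) - (if a = 0 then n (-ξ) else 0) := by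
      intro a
      by_cases ha : a = 0
      · simp [ha, cubicMode]
      · simp only [cubicMode, if_neg ha, hnsub, sub_zero]
    rw [tsum_congr h1, Summable.tsum_sub (by simpa only [hnsub] using htri)
      (hasSum_ite_eq 0 (n (-ξ))).summable, tsum_ite_eq, hnneg]
    have h2 : ∑' a, n (a - ξ) = ∑' a, n a := (Equiv.subRight ξ).tsum_eq n
    rw [h2, hn0]
    ring
  have h2ξ : ξ + ξ ≠ 0 := fun h => hξ (by
    have h1 := congrArg Prod.fst h
    have h2 := congrArg Prod.snd h
    simp only [Prod.fst_add, Prod.snd_add, Prod.fst_zero, Prod.snd_zero] at h1 h2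
    exact Prod.ext (by simp only [Prod.fst_zero]; omega) (by simp only [Prod.snd_zero]; omega))
  have hdiag : cubicMode α Q t ξ (ξ + ξ) ξ = n ξ := by
    rw [cubicMode, if_neg h2ξ, hnsub, add_sub_cancel_right]
  have hrow : ∀ a, cubicTerm α Q ξ t a = (∑' x, nonresonantMode α Q t ξ a x) +
      cubicMode α Q t ξ a ξ + cubicMode α Q t ξ a ξ - (if a = ξ + ξ then n ξ else 0) := by
    intro a
    have hi : ∀ (b : ℤ × ℤ) (c : ℂ), Summable fun x : ℤ × ℤ => if x = b then c else 0 :=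
      fun b c => (hasSum_ite_eq b c).summable
    have hd : (if a = ξ + ξ then cubicMode α Q t ξ a ξ else 0) =
        if a = ξ + ξ then n ξ else 0 := by
      split_ifs with h
      · rw [h, hdiag]
      · rfl
    rw [hQ.cubicTerm_eq_tsum ht, tsum_congr (cubicMode_eq t ξ a)]
    rw [(((hNs a).add (hi _ _)).add (hi _ _)).tsum_sub (hi _ _),
      ((hNs a).add (hi _ _)).tsum_add (hi _ _), (hNs a).tsum_add (hi _ _),
      tsum_ite_eq, tsum_ite_eq, tsum_ite_eq, hd]
  have hNp : Summable fun a => ∑' x, nonresonantMode α Q t ξ a x := hN.prod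
  have hi : Summable fun a : ℤ × ℤ => if a = ξ + ξ then n ξ else 0 :=
    (hasSum_ite_eq (ξ + ξ) (n ξ)).summable
  rw [tsum_congr hrow, ((hNp.add hR).add hR).tsum_sub hi, (hNp.add hR).tsum_add hR,
    hNp.tsum_add hR, tsum_ite_eq, hRn, hN.tsum_prod]
  ring

/-- No oscillation is used: |Q(ξ)|² is bounded by `M₂`, the factor with 1/ω sums to at most `M₁`,
and the time integral costs T. -/
theorem tsum_enorm_resonant_le (hQ : LatticeSolution α T M₁ M₂ Q) {t : ℝ} (ht : |t| ≤ T) :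
    ∑' ξ, ‖trilinearIntegral α Q t ξ ξ ξ (-ξ)‖ₑ ≤ (M₂ * M₁) * ENNReal.ofReal T := by
  refine (ENNReal.tsum_le_tsum fun ξ => enorm_intervalIntegral_le_setLIntegral _ _ _).trans ?_
  refine tsum_setLIntegral_le (fun ξ => ?_) (fun s => ?_) ht
  · have h1 := hQ.continuous ξ
    have h2 := hQ.continuous (-ξ)
    exact Continuous.measurable (by fun_prop)
  · simp only [enorm_mul, enorm_phase, one_mul, enorm_inv_latFreq]
    have h : ∑' a, ENNReal.ofReal |latFreq α (-a)|⁻¹ * ‖Q s (-a)‖ₑ =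
        ∑' a, ENNReal.ofReal |latFreq α a|⁻¹ * ‖Q s a‖ₑ :=
      (Equiv.neg (ℤ × ℤ)).tsum_eq (fun a => ENNReal.ofReal |latFreq α a|⁻¹ * ‖Q s a‖ₑ)
    calc _ ≤ ∑' a, M₂ * (ENNReal.ofReal |latFreq α (-a)|⁻¹ * ‖Q s (-a)‖ₑ) :=
          ENNReal.tsum_le_tsum fun a => by
            rw [mul_comm (‖Q s (-a)‖ₑ)]
            refine mul_le_mul' ?_ le_rfl
            -- The convolution at a + a contains the term |Q(a)|².
            have h1 := (ENNReal.le_tsum a).trans (hQ.conv_le s (a + a))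
            rwa [add_sub_cancel_right] at h1
      _ ≤ M₂ * M₁ := by
          rw [ENNReal.tsum_mul_left, h]
          exact mul_le_mul' le_rfl (hQ.div_le s)

/-- The `ℓ¹` bound of the Duhamel term, up to its nonresonant cubic part. -/
theorem tsum_enorm_duhamel_le (hQ : LatticeSolution α T M₁ M₂ Q) {t : ℝ} (ht : |t| ≤ T) :
    ∑' ξ : ℤ × ℤ, ‖3 * Complex.I * (latFreq α ξ : ℂ) *
        ∫ s in (0 : ℝ)..t, phase α ξ s * autoConv (Q s) ξ‖ₑ ≤
      2 * M₁ ^ 2 + 6 * ((M₂ * M₁) * ENNReal.ofReal T) +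
        6 * ∑' ξ, ∑' a, ∑' x, ‖nonresonantMode α Q t ξ a x‖ₑ := by
  have hpt : ∀ ξ, ‖3 * Complex.I * (latFreq α ξ : ℂ) *
        ∫ s in (0 : ℝ)..t, phase α ξ s * autoConv (Q s) ξ‖ₑ ≤
      boundarySum α (Q t) ξ + boundarySum α (Q 0) ξ +
        6 * ((∑' a, ∑' x, ‖nonresonantMode α Q t ξ a x‖ₑ) +
          ‖trilinearIntegral α Q t ξ ξ ξ (-ξ)‖ₑ) := by
    intro ξ
    by_cases hξ : ξ = 0
    · rw [hξ, latFreq_zero]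
      simp
    refine (hQ.enorm_duhamel_le ht ξ).trans (add_le_add le_rfl (mul_le_mul' le_rfl ?_))
    rw [hQ.tsum_cubicTerm_eq ht hξ]
    refine (enorm_add_le _ _).trans (add_le_add (enorm_tsum_le_tsum_enorm.trans ?_) le_rfl)
    rw [ENNReal.tsum_prod']
  refine (ENNReal.tsum_le_tsum hpt).trans ?_
  rw [ENNReal.tsum_add, ENNReal.tsum_add, ENNReal.tsum_mul_left, ENNReal.tsum_add]
  calc _ ≤ M₁ ^ 2 + M₁ ^ 2 + 6 * ((∑' ξ, ∑' a, ∑' x, ‖nonresonantMode α Q t ξ a x‖ₑ) +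
        (M₂ * M₁) * ENNReal.ofReal T) := by
        gcongr
        · exact hQ.tsum_boundarySum_le t
        · exact hQ.tsum_boundarySum_le 0
        · exact hQ.tsum_enorm_resonant_le ht
    _ = _ := by ring

end LatticeSolution

/-! ### The nonresonant cubic term. -/

/-- The `H^{1/2}` norms in time of the modes, in the frame moving with the Airy flow. -/
noncomputable def modeNorm (α : ℝ × ℝ) (Q : ℝ → ℤ × ℤ → ℂ) (x : ℤ × ℤ) : ℝ≥0∞ :=
  halfNorm fun s => phase α x s * Q s x

/-- The majorant of the nonresonant cubic interaction. -/
noncomputable def cubicMajorant (α : ℝ × ℝ) (A : ℤ × ℤ → ℝ≥0∞) (x y z : ℤ × ℤ) : ℝ≥0∞ :=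
  if x + y ≠ 0 ∧ x + z ≠ 0 ∧ y + z ≠ 0 ∧ z ≠ 0 then
    ENNReal.ofReal (|latFreq α z|⁻¹ * jb (resonance α x y z) ^ (-(1 / 4) : ℝ)) * (A x * A y * A z)
  else 0

section

variable {α : ℝ × ℝ} {T : ℝ} {M₁ M₂ : ℝ≥0∞} {Q : ℝ → ℤ × ℤ → ℂ}

/-- The identity (p+q+r)³ - p³ - q³ - r³ = 3(p+q)(p+r)(q+r). -/
theorem phase_mul_eq (x y z : ℤ × ℤ) (s : ℝ) (a b c : ℂ) :
    phase α (x + y + z) s * (a * b * c) =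
      Complex.exp (-(Complex.I * ((resonance α x y z * s : ℝ) : ℂ))) *
        ((phase α x s * a) * (phase α y s * b) * (phase α z s * c)) := by
  have h : phase α (x + y + z) s = Complex.exp (-(Complex.I * ((resonance α x y z * s : ℝ) : ℂ))) *
      (phase α x s * phase α y s * phase α z s) := by
    simp only [phase, ← Complex.exp_add, latFreq_add, resonance]
    congr 1
    push_cast
    ring
  rw [h]
  ring

theorem LatticeSolution.enorm_trilinearIntegral_le (hQ : LatticeSolution α T M₁ M₂ Q)
    (hs : ∀ x, HasCompactSupport fun s => Q s x) {K : ℝ≥0}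
    (hK : ∀ u v w : ℝ → ℂ, Continuous u → HasCompactSupport u → Continuous v →
      HasCompactSupport v → Continuous w → HasCompactSupport w → ∀ Φ t : ℝ,
      ‖∫ s in (0 : ℝ)..t, Complex.exp (-(Complex.I * ((Φ * s : ℝ) : ℂ))) * (u s * v s * w s)‖ₑ ≤
      K * ENNReal.ofReal (jb Φ ^ (-(1 / 4) : ℝ)) * (halfNorm u * halfNorm v * halfNorm w))
    (t : ℝ) (x y z : ℤ × ℤ) :
    ‖LatticeSolution.trilinearIntegral α Q t (x + y + z) x y z‖ₑ ≤
      K * (ENNReal.ofReal (|latFreq α z|⁻¹ * jb (resonance α x y z) ^ (-(1 / 4) : ℝ)) *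
        (modeNorm α Q x * modeNorm α Q y * modeNorm α Q z)) := by
  have hc : ∀ x, Continuous fun s => phase α x s * Q s x := fun x => by
    have := hQ.continuous x; fun_prop
  have hsc : ∀ x, HasCompactSupport fun s => phase α x s * Q s x := fun x => (hs x).mul_left
  have h := hK _ _ _ (hc x) (hsc x) (hc y) (hsc y) (hc z) (hsc z) (resonance α x y z) t
  have heq : LatticeSolution.trilinearIntegral α Q t (x + y + z) x y z = (latFreq α z : ℂ)⁻¹ *
      ∫ s in (0 : ℝ)..t, Complex.exp (-(Complex.I * ((resonance α x y z * s : ℝ) : ℂ))) *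
        ((phase α x s * Q s x) * (phase α y s * Q s y) * (phase α z s * Q s z)) := by
    rw [LatticeSolution.trilinearIntegral, ← intervalIntegral.integral_const_mul]
    congr 1
    ext s
    rw [← phase_mul_eq]
    ring
  rw [heq, enorm_mul, enorm_inv_latFreq, ENNReal.ofReal_mul (by positivity)]
  refine (mul_le_mul' le_rfl h).trans (le_of_eq ?_)
  simp only [modeNorm]
  ring

theorem LatticeSolution.enorm_nonresonantMode_le (hQ : LatticeSolution α T M₁ M₂ Q)
    (hs : ∀ x, HasCompactSupport fun s => Q s x) {K : ℝ≥0}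
    (hK : ∀ u v w : ℝ → ℂ, Continuous u → HasCompactSupport u → Continuous v →
      HasCompactSupport v → Continuous w → HasCompactSupport w → ∀ Φ t : ℝ,
      ‖∫ s in (0 : ℝ)..t, Complex.exp (-(Complex.I * ((Φ * s : ℝ) : ℂ))) * (u s * v s * w s)‖ₑ ≤
      K * ENNReal.ofReal (jb Φ ^ (-(1 / 4) : ℝ)) * (halfNorm u * halfNorm v * halfNorm w))
    (t : ℝ) (ξ a x : ℤ × ℤ) :
    ‖LatticeSolution.nonresonantMode α Q t ξ a x‖ₑ ≤
      K * cubicMajorant α (modeNorm α Q) x (a - x) (ξ - a) := by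
  unfold LatticeSolution.nonresonantMode
  split_ifs with h
  swap
  · simp
  -- The majorant excludes z = 0; such interactions vanish because Q has no zero mode.
  by_cases hz : ξ - a = 0
  · simp [LatticeSolution.trilinearIntegral, hz, hQ.zero]
  obtain ⟨ha, hx, hax⟩ := h
  rw [cubicMajorant, if_pos]
  · have h1 := hQ.enorm_trilinearIntegral_le hs hK t x (a - x) (ξ - a)
    rwa [add_sub_cancel, add_sub_cancel] at h1
  · refine ⟨by rwa [add_sub_cancel], fun h => hax ?_, fun h => hx ?_, hz⟩
    · rw [← sub_eq_zero, ← neg_eq_zero, ← h]; abel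
    · rw [← sub_eq_zero, ← neg_eq_zero, ← h]; abel

end

/-- The change of variables y = a - x, z = ξ - a. -/
theorem tsum_reindex (F : ℤ × ℤ → ℤ × ℤ → ℤ × ℤ → ℝ≥0∞) :
    ∑' ξ, ∑' a, ∑' x, F x (a - x) (ξ - a) = ∑' x, ∑' y, ∑' z, F x y z := by
  calc _ = ∑' a, ∑' ξ, ∑' x, F x (a - x) (ξ - a) := ENNReal.tsum_comm
    _ = ∑' a, ∑' z, ∑' x, F x (a - x) z := tsum_congr fun a =>
        (Equiv.subRight a).tsum_eq (fun z => ∑' x, F x (a - x) z)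
    _ = ∑' a, ∑' x, ∑' z, F x (a - x) z := tsum_congr fun a => ENNReal.tsum_comm
    _ = ∑' x, ∑' a, ∑' z, F x (a - x) z := ENNReal.tsum_comm
    _ = _ := tsum_congr fun x => (Equiv.subRight x).tsum_eq (fun y => ∑' z, F x y z)

theorem tsum_triple {G : ℤ × ℤ → ℤ × ℤ → ℤ × ℤ → ℝ≥0∞} :
    ∑' p : (ℤ × ℤ) × (ℤ × ℤ) × (ℤ × ℤ), G p.1 p.2.1 p.2.2 = ∑' x, ∑' y, ∑' z, G x y z := by
  rw [ENNReal.tsum_prod']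
  exact tsum_congr fun x => ENNReal.tsum_prod'

/-- Cauchy–Schwarz over triples: the multiplier times the three inverse weights has square
`cubicKernel`, and the weighted sequences factor into a cube. -/
theorem Diophantine.tsum_cubicMajorant_sq_le {α : ℝ × ℝ} {γ C₀ θ : ℝ} (hα : Diophantine α γ C₀)
    (hC₀ : 0 < C₀) {A : ℤ × ℤ → ℝ≥0∞} (hA : A 0 = 0) :
    (∑' x, ∑' y, ∑' z, cubicMajorant α A x y z) ^ 2 ≤
      (∑' x : ℤ × ℤ, ∑' y : ℤ × ℤ, ∑' z : ℤ × ℤ,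
        (if x + y ≠ 0 ∧ x + z ≠ 0 ∧ y + z ≠ 0 ∧ z ≠ 0 then
          ENNReal.ofReal (cubicKernel α θ x y z) else 0)) * latNormSq α θ A ^ 3 := by
  set b : ℤ × ℤ → ℝ≥0∞ := fun ξ => ENNReal.ofReal (latWeight α θ ξ) * A ξ with hb
  set k : ℤ × ℤ → ℤ × ℤ → ℤ × ℤ → ℝ≥0∞ := fun x y z =>
    if x + y ≠ 0 ∧ x + z ≠ 0 ∧ y + z ≠ 0 ∧ z ≠ 0 then
      ENNReal.ofReal (|latFreq α z|⁻¹ * jb (resonance α x y z) ^ (-(1 / 4) : ℝ) *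
        (invWeight α θ x * invWeight α θ y * invWeight α θ z)) else 0 with hk
  have hpt : ∀ x y z, cubicMajorant α A x y z = k x y z * (b x * b y * b z) := by
    intro x y z
    simp only [cubicMajorant, hk]
    split_ifs with h
    · have hj := jb_pos (resonance α x y z)
      have hx := invWeight_nonneg (α := α) (θ := θ) x
      have hy := invWeight_nonneg (α := α) (θ := θ) y
      have hA' : ∀ ξ, A ξ = ENNReal.ofReal (invWeight α θ ξ) * b ξ := fun ξ =>
        hα.eq_invWeight_mul hC₀ hA ξ
      rw [ENNReal.ofReal_mul (p := |latFreq α z|⁻¹ * jb (resonance α x y z) ^ (-(1 / 4) : ℝ))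
        (by positivity), ENNReal.ofReal_mul (p := invWeight α θ x * invWeight α θ y)
        (by positivity), ENNReal.ofReal_mul hx, hA' x, hA' y, hA' z]
      ring
    · rw [zero_mul]
  have hksq : ∀ x y z, k x y z ^ 2 = if x + y ≠ 0 ∧ x + z ≠ 0 ∧ y + z ≠ 0 ∧ z ≠ 0 then
      ENNReal.ofReal (cubicKernel α θ x y z) else 0 := by
    intro x y z
    simp only [hk]
    split_ifs with h
    · have hj := jb_pos (resonance α x y z)
      have hx := invWeight_nonneg (α := α) (θ := θ) x
      have hy := invWeight_nonneg (α := α) (θ := θ) y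
      have hz := invWeight_nonneg (α := α) (θ := θ) z
      have hω := abs_pos.2 (hα.latFreq_ne_zero hC₀ h.2.2.2)
      rw [← ENNReal.ofReal_pow (by positivity)]
      congr 1
      have hj4 : (jb (resonance α x y z) ^ (-(1 / 4) : ℝ)) ^ 2 =
          jb (resonance α x y z) ^ (-(1 / 2) : ℝ) := by
        rw [← Real.rpow_natCast, ← Real.rpow_mul hj.le]
        norm_num
      rw [mul_pow, mul_pow, mul_pow, mul_pow, hj4, invWeight_sq, invWeight_sq, invWeight_sq,
        cubicKernel]
      field_simp
    · simp
  have h1 := tsum_mul_sq_le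
    (fun p : (ℤ × ℤ) × (ℤ × ℤ) × (ℤ × ℤ) => k p.1 p.2.1 p.2.2)
    (fun p => b p.1 * b p.2.1 * b p.2.2)
  rw [tsum_triple (G := fun x y z => k x y z * (b x * b y * b z)),
    tsum_triple (G := fun x y z => k x y z ^ 2),
    tsum_triple (G := fun x y z => (b x * b y * b z) ^ 2)] at h1
  simp only [← hpt, hksq, mul_pow] at h1
  refine h1.trans (mul_le_mul' le_rfl (le_of_eq ?_))
  simp only [ENNReal.tsum_mul_left, ENNReal.tsum_mul_right]
  rw [latNormSq]
  ring

theorem Diophantine.exists_tsum_nonresonantMode_le {α : ℝ × ℝ} {γ C₀ θ : ℝ}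
    (hα : Diophantine α γ C₀) (hC₀ : 0 < C₀) (hγ : 0 < γ) (hγ2 : γ < 2) (hθ : 7 / 8 < θ) :
    ∃ K : ℝ≥0, ∀ (T : ℝ) (M₁ M₂ : ℝ≥0∞) (Q : ℝ → ℤ × ℤ → ℂ), LatticeSolution α T M₁ M₂ Q →
      (∀ x, HasCompactSupport fun s => Q s x) → ∀ t,
      ∑' ξ, ∑' a, ∑' x, ‖LatticeSolution.nonresonantMode α Q t ξ a x‖ₑ ≤
        K * latNormSq α θ (modeNorm α Q) ^ (3 / 2 : ℝ) := by
  obtain ⟨K, hK⟩ := exists_enorm_integral_oscillating_le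
  have hS := hα.tsum_cubicKernel_ne_top hC₀ hγ hγ2 hθ
  set S := ∑' x : ℤ × ℤ, ∑' y : ℤ × ℤ, ∑' z : ℤ × ℤ,
      (if x + y ≠ 0 ∧ x + z ≠ 0 ∧ y + z ≠ 0 ∧ z ≠ 0 then
        ENNReal.ofReal (cubicKernel α θ x y z) else 0) with hSdef
  refine ⟨K * (S ^ (1 / 2 : ℝ)).toNNReal, fun T M₁ M₂ Q hQ hs t => ?_⟩
  rw [ENNReal.coe_mul, ENNReal.coe_toNNReal (ENNReal.rpow_ne_top_of_nonneg (by norm_num) hS)]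
  have h0 : modeNorm α Q 0 = 0 := by
    simp [modeNorm, hQ.zero, halfNorm, timeFourier]
  have h1 := le_rpow_half_of_sq_le (hα.tsum_cubicMajorant_sq_le hC₀ (θ := θ) h0)
  rw [← hSdef, ENNReal.mul_rpow_of_nonneg _ _ (by norm_num), ← ENNReal.rpow_natCast,
    ← ENNReal.rpow_mul] at h1
  calc _ ≤ ∑' ξ, ∑' a, ∑' x, K * cubicMajorant α (modeNorm α Q) x (a - x) (ξ - a) :=
        ENNReal.tsum_le_tsum fun ξ => ENNReal.tsum_le_tsum fun a => ENNReal.tsum_le_tsum fun x =>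
          hQ.enorm_nonresonantMode_le hs hK t ξ a x
    _ = K * ∑' x, ∑' y, ∑' z, cubicMajorant α (modeNorm α Q) x y z := by
        simp only [ENNReal.tsum_mul_left]
        rw [tsum_reindex]
    _ ≤ K * (S ^ (1 / 2 : ℝ) * latNormSq α θ (modeNorm α Q) ^ (((3 : ℕ) : ℝ) * (1 / 2))) := by
        gcongr
    _ = _ := by
        rw [mul_assoc]
        norm_num

/-! ### From the Duhamel formulation to a lattice solution. -/

section Solution

variable {α : ℝ × ℝ} {γ C₀ θ : ℝ} {T : ℝ} {η ηT : ℝ → ℝ} {q₀ : Freq → ℂ} {q : ℝ → Freq → ℂ}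

theorem gNorm_zero : gNorm α θ 0 = 0 := by simp [gNorm, hatNorm]

theorem gNorm_sq_le (f g : Freq → ℂ) :
    gNorm α θ f ^ 2 ≤ 2 * (gNorm α θ (f - g) ^ 2 + gNorm α θ g ^ 2) := by
  rw [gNorm_sq, gNorm_sq, gNorm_sq]
  refine latNormSq_le_two_mul _ _ _ fun ξ => ?_
  rw [extendZero_sub]
  simpa using enorm_add_le (extendZero f ξ - extendZero g ξ) (extendZero g ξ)

/-- The outer cutoff makes q vanish off a compact set, on which continuity in G gives a finite
bound. -/
theorem linftyGNorm_lt_top (hη : IsTimeCutoff T η) (hq : SolvesDuhamel α η ηT q₀ q)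
    (hc : IsContinuousInG α θ q) : linftyGNorm α θ q < ∞ := by
  have hz : ∀ t ∉ tsupport η, gNorm α θ (q t) = 0 := by
    intro t ht
    have h0 : q t = 0 := by
      ext ξ
      rw [hq t ξ, image_eq_zero_of_notMem_tsupport ht]
      simp
    rw [h0, gNorm_zero]
  have hcomp : ∃ M : ℝ≥0∞, M < ∞ ∧ ∀ t ∈ tsupport η, gNorm α θ (q t) ^ 2 ≤ M := by
    refine IsCompact.induction_on (p := fun s => ∃ M : ℝ≥0∞, M < ∞ ∧
      ∀ t ∈ s, gNorm α θ (q t) ^ 2 ≤ M) hη.2.1 ⟨0, by simp, by simp⟩ ?_ ?_ ?_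
    · rintro s t hst ⟨M, hM, h⟩
      exact ⟨M, hM, fun x hx => h x (hst hx)⟩
    · rintro s t ⟨M, hM, h⟩ ⟨M', hM', h'⟩
      refine ⟨max M M', max_lt hM hM', fun x hx => ?_⟩
      rcases hx with hx | hx
      · exact (h x hx).trans (le_max_left _ _)
      · exact (h' x hx).trans (le_max_right _ _)
    · intro t₀ _
      refine ⟨{t | gNorm α θ (q t - q t₀) < 1}, mem_nhdsWithin_of_mem_nhds
        ((hc.2 t₀).eventually (gt_mem_nhds one_pos)), 2 * (1 + gNorm α θ (q t₀) ^ 2),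
        ENNReal.mul_lt_top (by simp)
          (ENNReal.add_lt_top.2 ⟨by simp, ENNReal.pow_lt_top (hc.1 t₀)⟩), fun t ht => ?_⟩
      refine (gNorm_sq_le (q t) (q t₀)).trans ?_
      gcongr
      exact pow_le_one' (le_of_lt ht) 2
  obtain ⟨M, hM, h⟩ := hcomp
  refine lt_of_le_of_lt (iSup_le fun t => ?_)
    (ENNReal.rpow_lt_top_of_nonneg (by norm_num : (0 : ℝ) ≤ 1 / 2) hM.ne)
  by_cases ht : t ∈ tsupport η
  · exact le_rpow_half_of_sq_le (h t ht)
  · rw [hz t ht]; exact zero_le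

/-- Each coefficient is controlled by the norm, so that continuity in G passes to single modes. -/
theorem Diophantine.enorm_extendZero_sub_le (hα : Diophantine α γ C₀) (hC₀ : 0 < C₀)
    (f g : Freq → ℂ) (ξ : ℤ × ℤ) :
    ‖extendZero f ξ - extendZero g ξ‖ₑ ≤
      ENNReal.ofReal (invWeight α θ ξ) * gNorm α θ (f - g) := by
  rw [← extendZero_sub]
  have h := hα.eq_invWeight_mul hC₀ (θ := θ)
    (a := fun ξ => ‖extendZero (f - g) ξ‖ₑ) (by simp) ξ
  rw [h]
  gcongr
  refine (ENNReal.pow_le_pow_left_iff two_ne_zero).1 ?_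
  rw [gNorm_sq, latNormSq]
  exact ENNReal.le_tsum (f := fun ξ =>
    (ENNReal.ofReal (latWeight α θ ξ) * ‖extendZero (f - g) ξ‖ₑ) ^ 2) ξ

theorem Diophantine.continuous_extendZero (hα : Diophantine α γ C₀) (hC₀ : 0 < C₀)
    (hc : IsContinuousInG α θ q) (ξ : ℤ × ℤ) : Continuous fun t => extendZero (q t) ξ := by
  refine continuous_iff_continuousAt.2 fun t₀ => ?_
  refine tendsto_iff_edist_tendsto_0.2 ?_
  have h := ENNReal.Tendsto.const_mul (a := ENNReal.ofReal (invWeight α θ ξ)) (hc.2 t₀)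
    (Or.inr ENNReal.ofReal_ne_top)
  rw [mul_zero] at h
  refine tendsto_of_tendsto_of_tendsto_of_le_of_le tendsto_const_nhds h (fun _ => zero_le)
    fun t => ?_
  rw [edist_eq_enorm_sub]
  exact hα.enorm_extendZero_sub_le hC₀ _ _ ξ

theorem Diophantine.tsum_convolution_le (hα : Diophantine α γ C₀) (hC₀ : 0 < C₀)
    (hθ : 1 / 2 ≤ θ) (f g : Freq → ℂ) (ξ : ℤ × ℤ) :
    ∑' x, ‖extendZero f x‖ₑ * ‖extendZero g (ξ - x)‖ₑ ≤
      ENNReal.ofReal (|α.1| + |α.2|) * (gNorm α θ f * gNorm α θ g) := by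
  refine (ENNReal.pow_le_pow_left_iff two_ne_zero).1 ?_
  refine (hα.tsum_convolution_sq_le hC₀ hθ (a := fun x => ‖extendZero f x‖ₑ)
    (b := fun x => ‖extendZero g x‖ₑ) (by simp) (by simp) ξ).trans (le_of_eq ?_)
  rw [← gNorm_sq, ← gNorm_sq]
  ring

/-- From f∗f - g∗g = (f-g)∗f + g∗(f-g); it yields continuity in time of the modes of q². -/
theorem Diophantine.enorm_autoConv_sub_le (hα : Diophantine α γ C₀) (hC₀ : 0 < C₀)
    (hθ : 1 / 2 ≤ θ) {f g : Freq → ℂ} (hf : gNorm α θ f ≠ ∞) (hg : gNorm α θ g ≠ ∞) (ξ : ℤ × ℤ) :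
    ‖autoConv (extendZero f) ξ - autoConv (extendZero g) ξ‖ₑ ≤
      ENNReal.ofReal (|α.1| + |α.2|) * (gNorm α θ (f - g) * (gNorm α θ f + gNorm α θ g)) := by
  have hsum : ∀ h : Freq → ℂ, gNorm α θ h ≠ ∞ →
      Summable fun x => extendZero h x * extendZero h (ξ - x) := by
    intro h hh
    refine summable_of_tsum_enorm_ne_top (ne_top_of_le_ne_top ?_
      (le_trans (le_of_eq ?_) (hα.tsum_convolution_le hC₀ hθ h h ξ)))
    · exact ENNReal.mul_ne_top ENNReal.ofReal_ne_top (ENNReal.mul_ne_top hh hh)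
    · simp only [enorm_mul]
  rw [autoConv, autoConv, ← (hsum f hf).tsum_sub (hsum g hg)]
  have hpt : ∀ x, ‖extendZero f x * extendZero f (ξ - x) -
      extendZero g x * extendZero g (ξ - x)‖ₑ ≤
      ‖extendZero (f - g) x‖ₑ * ‖extendZero f (ξ - x)‖ₑ +
        ‖extendZero g x‖ₑ * ‖extendZero (f - g) (ξ - x)‖ₑ := by
    intro x
    have : extendZero f x * extendZero f (ξ - x) - extendZero g x * extendZero g (ξ - x) =
        extendZero (f - g) x * extendZero f (ξ - x) +
          extendZero g x * extendZero (f - g) (ξ - x) := by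
      rw [extendZero_sub, extendZero_sub]; ring
    rw [this, ← enorm_mul, ← enorm_mul]
    exact enorm_add_le _ _
  refine enorm_tsum_le_tsum_enorm.trans ((ENNReal.tsum_le_tsum hpt).trans ?_)
  rw [ENNReal.tsum_add]
  refine (add_le_add (hα.tsum_convolution_le hC₀ hθ (f - g) f ξ)
    (hα.tsum_convolution_le hC₀ hθ g (f - g) ξ)).trans (le_of_eq ?_)
  ring

theorem Diophantine.continuous_autoConv (hα : Diophantine α γ C₀) (hC₀ : 0 < C₀)
    (hθ : 1 / 2 ≤ θ) (hc : IsContinuousInG α θ q) (hG : linftyGNorm α θ q < ∞) (ξ : ℤ × ℤ) :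
    Continuous fun t => autoConv (extendZero (q t)) ξ := by
  refine continuous_iff_continuousAt.2 fun t₀ => tendsto_iff_edist_tendsto_0.2 ?_
  set G := linftyGNorm α θ q
  have hle : ∀ t, gNorm α θ (q t) ≤ G := fun t => le_iSup (fun t => gNorm α θ (q t)) t
  have h := ENNReal.Tendsto.const_mul (a := ENNReal.ofReal (|α.1| + |α.2|))
    (ENNReal.Tendsto.mul_const (b := G + G) (hc.2 t₀)
      (Or.inr (ENNReal.add_ne_top.2 ⟨hG.ne, hG.ne⟩))) (Or.inr ENNReal.ofReal_ne_top)
  rw [zero_mul, mul_zero] at h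
  refine tendsto_of_tendsto_of_tendsto_of_le_of_le tendsto_const_nhds h (fun _ => zero_le)
    fun t => ?_
  rw [edist_eq_enorm_sub]
  refine (hα.enorm_autoConv_sub_le hC₀ hθ (hc.1 t).ne (hc.1 t₀).ne ξ).trans ?_
  gcongr
  · exact hle t
  · exact hle t₀

theorem airy_sub (t s : ℝ) (ξ : Freq) : airy α (t - s) ξ = airy α t ξ * phase α ξ.1 s := by
  simp only [airy, phase, ← Complex.exp_add]
  congr 1
  have : latFreq α ξ.1 = freq α ξ := rfl
  rw [this]
  push_cast
  ring

theorem airy_mul_phase (s : ℝ) (ξ : Freq) : airy α s ξ * phase α ξ.1 s = 1 := by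
  rw [← airy_sub, sub_self]
  simp [airy]

theorem hasDerivAt_airy (ξ : Freq) (s : ℝ) :
    HasDerivAt (fun s => airy α s ξ) (Complex.I * (freq α ξ : ℂ) ^ 3 * airy α s ξ) s := by
  have h1 : HasDerivAt (fun s : ℝ => Complex.I * ((s * freq α ξ ^ 3 : ℝ) : ℂ))
      (Complex.I * (freq α ξ : ℂ) ^ 3) s := by
    have h2 : HasDerivAt (fun s : ℝ => ((s * freq α ξ ^ 3 : ℝ) : ℂ))
        ((1 * freq α ξ ^ 3 : ℝ) : ℂ) s :=
      ((hasDerivAt_id s).mul_const (freq α ξ ^ 3)).ofReal_comp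
    simpa using! h2.const_mul Complex.I
  have h := h1.cexp
  rw [mul_comm] at h
  exact h

theorem enorm_airy (t : ℝ) (ξ : Freq) : ‖airy α t ξ‖ₑ = 1 := by
  rw [airy, ← ofReal_norm, mul_comm, Complex.norm_exp_ofReal_mul_I, ENNReal.ofReal_one]

/-- The Duhamel formula with the outer cutoff removed. -/
theorem SolvesDuhamel.eq_of_cutoff_eq_one (hq : SolvesDuhamel α η ηT q₀ q) {t : ℝ} (ht : η t = 1)
    (ξ : Freq) : q t ξ = airy α t ξ * (q₀ ξ + 3 * ∫ s in (0 : ℝ)..t, phase α ξ.1 s *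
      ((Complex.I * (freq α ξ : ℂ)) * ((ηT s : ℂ) * autoConv (extendZero (q s)) ξ.1))) := by
  rw [hq t ξ, ht]
  simp only [airy_sub, squareCoeff_eq_autoConv, mul_assoc]
  rw [intervalIntegral.integral_const_mul]
  push_cast
  ring

/-- On (-T, T) both cutoffs equal 1, and the modes solve the untruncated equation. -/
theorem SolvesDuhamel.hasDerivAt (hη : IsTimeCutoff T η) (hηT : IsTimeCutoff T ηT)
    (hq : SolvesDuhamel α η ηT q₀ q)
    (hcont : ∀ x, Continuous fun s => autoConv (extendZero (q s)) x) {s : ℝ}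
    (hs : s ∈ Set.Ioo (-T) T) (ξ : Freq) : HasDerivAt (fun s => q s ξ)
      (Complex.I * (freq α ξ : ℂ) ^ 3 * q s ξ +
        3 * Complex.I * (freq α ξ : ℂ) * autoConv (extendZero (q s)) ξ.1) s := by
  have hηTc : Continuous ηT := hηT.1.continuous
  have hc := hcont ξ.1
  set g : ℝ → ℂ := fun s => phase α ξ.1 s *
      ((Complex.I * (freq α ξ : ℂ)) * ((ηT s : ℂ) * autoConv (extendZero (q s)) ξ.1)) with hg
  have hgc : Continuous g := by fun_prop
  have hFTC : HasDerivAt (fun t => ∫ r in (0 : ℝ)..t, g r) (g s) s :=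
    (hgc.integral_hasStrictDerivAt 0 s).hasDerivAt
  have hd := (hasDerivAt_airy (α := α) ξ s).mul ((hFTC.const_mul 3).const_add (q₀ ξ))
  have hev : (fun t => q t ξ) =ᶠ[𝓝 s]
      fun t => airy α t ξ * (q₀ ξ + 3 * ∫ r in (0 : ℝ)..t, g r) := by
    filter_upwards [Ioo_mem_nhds hs.1 hs.2] with t ht
    exact hq.eq_of_cutoff_eq_one (hη.2.2 t (abs_le.2 ⟨ht.1.le, ht.2.le⟩)) ξ
  have hsle : |s| ≤ T := abs_le.2 ⟨hs.1.le, hs.2.le⟩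
  refine (hd.congr_of_eventuallyEq hev).congr_deriv ?_
  rw [hq.eq_of_cutoff_eq_one (hη.2.2 s hsle) ξ]
  simp only [hg, hηT.2.2 s hsle]
  have h1 := airy_mul_phase (α := α) s ξ
  push_cast
  linear_combination (3 * Complex.I * (freq α ξ : ℂ) * autoConv (extendZero (q s)) ξ.1) * h1

theorem SolvesDuhamel.sub_airy_eq (hη : IsTimeCutoff T η) (hηT : IsTimeCutoff T ηT)
    (hq : SolvesDuhamel α η ηT q₀ q) {t : ℝ} (ht : |t| ≤ T) (ξ : Freq) :
    q t ξ - airy α t ξ * q 0 ξ = airy α t ξ * (3 * Complex.I * (latFreq α ξ.1 : ℂ) *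
      ∫ s in (0 : ℝ)..t, phase α ξ.1 s * autoConv (extendZero (q s)) ξ.1) := by
  have h0 : |(0 : ℝ)| ≤ T := by rw [abs_zero]; exact (abs_nonneg t).trans ht
  rw [hq.eq_of_cutoff_eq_one (hη.2.2 t ht) ξ, hq.eq_of_cutoff_eq_one (hη.2.2 0 h0) ξ]
  have h1 : airy α 0 ξ = 1 := by simp [airy]
  have h2 : ∫ s in (0 : ℝ)..t, phase α ξ.1 s *
      ((Complex.I * (freq α ξ : ℂ)) * ((ηT s : ℂ) * autoConv (extendZero (q s)) ξ.1)) =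
      (Complex.I * (freq α ξ : ℂ)) *
        ∫ s in (0 : ℝ)..t, phase α ξ.1 s * autoConv (extendZero (q s)) ξ.1 := by
    rw [← intervalIntegral.integral_const_mul]
    refine intervalIntegral.integral_congr fun s hs => ?_
    have hs' : |s| ≤ T := by
      have h3 := Set.abs_sub_left_of_mem_uIcc hs
      simp only [sub_zero] at h3
      exact h3.trans ht
    simp only [hηT.2.2 s hs']
    push_cast
    ring
  rw [h2, h1, intervalIntegral.integral_same]
  have h3 : (latFreq α ξ.1 : ℂ) = freq α ξ := rfl
  rw [h3]
  ring

theorem Diophantine.latticeSolution (hα : Diophantine α γ C₀) (hC₀ : 0 < C₀) (hθ : 1 / 2 ≤ θ)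
    {k : ℝ≥0} (hk : ∀ a : ℤ × ℤ → ℝ≥0∞, a 0 = 0 →
      (∑' ξ, ENNReal.ofReal |latFreq α ξ|⁻¹ * a ξ) ^ 2 ≤ (k : ℝ≥0∞) ^ 2 * latNormSq α θ a)
    (hη : IsTimeCutoff T η) (hηT : IsTimeCutoff T ηT) (hq : SolvesDuhamel α η ηT q₀ q)
    (hc : IsContinuousInG α θ q) :
    LatticeSolution α T (k * linftyGNorm α θ q)
      (ENNReal.ofReal (|α.1| + |α.2|) * (linftyGNorm α θ q * linftyGNorm α θ q))
      (fun t => extendZero (q t)) := by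
  have hG := linftyGNorm_lt_top hη hq hc
  set G := linftyGNorm α θ q
  have hle : ∀ t, gNorm α θ (q t) ≤ G := fun t => le_iSup (fun t => gNorm α θ (q t)) t
  have hconv := hα.continuous_autoConv hC₀ hθ hc hG
  refine ⟨fun ξ hξ => hα.latFreq_ne_zero hC₀ hξ, fun s => extendZero_zero _,
    hα.continuous_extendZero hC₀ hc, hconv,
    ENNReal.mul_ne_top ENNReal.coe_ne_top hG.ne,
    ENNReal.mul_ne_top ENNReal.ofReal_ne_top (ENNReal.mul_ne_top hG.ne hG.ne),
    fun s => ?_, fun s ξ => ?_, fun s hs a => ?_⟩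
  · refine (ENNReal.pow_le_pow_left_iff two_ne_zero).1 ?_
    refine (hk (fun x => ‖extendZero (q s) x‖ₑ) (by simp)).trans ?_
    rw [← gNorm_sq, mul_pow]
    gcongr
    exact hle s
  · refine (hα.tsum_convolution_le hC₀ hθ (q s) (q s) ξ).trans ?_
    gcongr <;> exact hle s
  · by_cases ha : a = 0
    · subst ha
      simp [latFreq_zero, hasDerivAt_const]
    · simp only [extendZero_of_ne _ ha]
      exact hq.hasDerivAt hη hηT hconv hs ⟨a, ha⟩

theorem SolvesDuhamel.hasCompactSupport (hη : IsTimeCutoff T η) (hq : SolvesDuhamel α η ηT q₀ q)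
    (ξ : ℤ × ℤ) : HasCompactSupport fun t => extendZero (q t) ξ := by
  refine HasCompactSupport.mono hη.2.1 fun t ht => ?_
  by_contra h
  rw [Function.notMem_support] at h
  apply ht
  by_cases hξ : ξ = 0
  · simp [hξ]
  · simp only [extendZero_of_ne _ hξ]
    rw [hq t, h]
    simp

/-- Multiplication by the phase translates the transform by ω³, and the L² norm is translation
invariant. -/
theorem modeNorm_extendZero {ξ : Freq} (hc : Continuous fun t => q t ξ)
    (hs : HasCompactSupport fun t => q t ξ) :
    modeNorm α (fun t => extendZero (q t)) ξ.1 =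
      eLpNorm (fun τ : ℝ => ((jb (τ - freq α ξ ^ 3) ^ (1 / 2 : ℝ) : ℝ) : ℂ) *
        timeFourier (fun t => q t ξ) τ) 2 volume := by
  have hF : Continuous fun τ : ℝ => ((jb (τ - freq α ξ ^ 3) ^ (1 / 2 : ℝ) : ℝ) : ℂ) *
      timeFourier (fun t => q t ξ) τ := by
    have h1 := continuous_timeFourier hc hs
    have h2 := continuous_jb
    have h3 : Continuous fun τ : ℝ => jb (τ - freq α ξ ^ 3) ^ (1 / 2 : ℝ) :=
      (h2.comp (continuous_id.sub continuous_const)).rpow_const fun _ => Or.inr (by norm_num)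
    fun_prop
  have h := eLpNorm_comp_measurePreserving (p := 2) hF.aestronglyMeasurable
    (measurePreserving_add_right (volume : Measure ℝ) (freq α ξ ^ 3))
  rw [← h, modeNorm, halfNorm]
  congr 1
  ext τ
  simp only [Function.comp, add_sub_cancel_right, extendZero_coe, phase]
  rw [timeFourier_modulate]
  rfl

theorem xNorm_sq (hc : ∀ ξ, Continuous fun t => q t ξ)
    (hs : ∀ ξ, HasCompactSupport fun t => q t ξ) :
    xNorm α θ q ^ 2 = latNormSq α θ (modeNorm α fun t => extendZero (q t)) := by
  rw [xNorm, hatNorm_sq]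
  congr 1
  ext ξ
  by_cases hξ : ξ = 0
  · simp [hξ, modeNorm, halfNorm, timeFourier]
  · rw [extendZero_of_ne _ hξ, modeNorm_extendZero (ξ := ⟨ξ, hξ⟩) (hc _) (hs _)]

theorem SolvesDuhamel.smoothingNorm_eq (hη : IsTimeCutoff T η) (hηT : IsTimeCutoff T ηT)
    (hq : SolvesDuhamel α η ηT q₀ q) {t : ℝ} (ht : |t| ≤ T) :
    smoothingNorm α q t = ∑' ξ : ℤ × ℤ, ‖3 * Complex.I * (latFreq α ξ : ℂ) *
      ∫ s in (0 : ℝ)..t, phase α ξ s * autoConv (extendZero (q s)) ξ‖ₑ := by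
  rw [← tsum_freq_eq (by simp [latFreq_zero]), smoothingNorm]
  refine tsum_congr fun ξ => ?_
  rw [hq.sub_airy_eq hη hηT ht, enorm_mul, enorm_airy, one_mul]

end Solution

end QPKdV

/-! ### Assembly of the estimates. -/

theorem theorem4p3
    (α : ℝ × ℝ) (γ C₀ θ : ℝ)
    (hγ : 1 < γ) (hC₀ : 0 < C₀) (hα : QPKdV.Diophantine α γ C₀)
    (hθ : max (7 / 8) (γ / 2) < θ) (hθ1 : θ < 1) :
    ∃ C : ℝ≥0, ∀ (T : ℝ) (η ηT : ℝ → ℝ) (q₀ : QPKdV.Freq → ℂ) (q : ℝ → QPKdV.Freq → ℂ),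
      0 < T → QPKdV.IsTimeCutoff T η → QPKdV.IsTimeCutoff T ηT →
      QPKdV.IsSeriesOf α q₀ (QPKdV.squareData α) →
      QPKdV.SolvesDuhamel α η ηT q₀ q →
      QPKdV.IsContinuousInG α θ q →
      QPKdV.xNorm α θ q < ⊤ →
      (⨆ t ∈ Set.Icc (-T) T, QPKdV.smoothingNorm α q t) < ⊤ ∧
      (⨆ t ∈ Set.Icc (-T) T, QPKdV.smoothingNorm α q t) ≤
        (C : ℝ≥0∞) *
          ((1 + QPKdV.xNorm α θ q) * QPKdV.xNorm α θ q ^ 2 +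
            (1 + ENNReal.ofReal T) * (1 + QPKdV.linftyGNorm α θ q) *
              QPKdV.linftyGNorm α θ q ^ 2) := by
  have hθ78 : 7 / 8 < θ := (le_max_left _ _).trans_lt hθ
  have hθγ : γ / 2 < θ := (le_max_right _ _).trans_lt hθ
  obtain ⟨K₁, hK₁⟩ := hα.exists_tsum_div_sq_le hC₀ (by linarith) (θ := θ) (by linarith)
    (by linarith)
  -- Here γ < 2 comes from γ/2 < θ < 1.
  obtain ⟨K, hK⟩ := hα.exists_tsum_nonresonantMode_le hC₀ (by linarith) (by linarith) hθ78
  set k := NNReal.sqrt K₁ with hk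
  have hk2 : (k : ℝ≥0∞) ^ 2 = K₁ := by
    rw [← ENNReal.coe_pow, hk, NNReal.sq_sqrt]
  set A := ENNReal.ofReal (|α.1| + |α.2|) with hA
  -- The summands belong to the two boundary terms, the resonant term and the nonresonant term.
  refine ⟨2 * k ^ 2 + 6 * A.toNNReal * k + 6 * K,
    fun T η ηT q₀ q _ hη hηT _ hq hc hX => ?_⟩
  have hsol := hα.latticeSolution hC₀ (k := k) (θ := θ) (by linarith)
    (by rw [hk2]; exact hK₁) hη hηT hq hc
  have hG := QPKdV.linftyGNorm_lt_top hη hq hc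
  have hcc : ∀ ξ : QPKdV.Freq, Continuous fun t => q t ξ := fun ξ => by
    simpa only [QPKdV.extendZero_coe] using hsol.continuous ξ.1
  have hcs : ∀ ξ : QPKdV.Freq, HasCompactSupport fun t => q t ξ := fun ξ => by
    simpa only [QPKdV.extendZero_coe] using hq.hasCompactSupport hη ξ.1
  have hXsq := QPKdV.xNorm_sq (α := α) (θ := θ) hcc hcs
  set G := QPKdV.linftyGNorm α θ q
  set X := QPKdV.xNorm α θ q
  have hbound : (⨆ t ∈ Set.Icc (-T) T, QPKdV.smoothingNorm α q t) ≤
      ((2 * k ^ 2 + 6 * A.toNNReal * k + 6 * K : ℝ≥0) : ℝ≥0∞) *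
        ((1 + X) * X ^ 2 + (1 + ENNReal.ofReal T) * (1 + G) * G ^ 2) := by
    refine iSup₂_le fun t ht => ?_
    have ht' : |t| ≤ T := abs_le.2 ht
    rw [hq.smoothingNorm_eq hη hηT ht']
    refine (hsol.tsum_enorm_duhamel_le ht').trans ?_
    have hN := hK T _ _ _ hsol (fun x => hq.hasCompactSupport hη x) t
    rw [← hXsq, ← ENNReal.rpow_natCast, ← ENNReal.rpow_mul] at hN
    have h3 : X ^ (((2 : ℕ) : ℝ) * (3 / 2)) = X ^ 3 := by
      rw [← ENNReal.rpow_natCast]; norm_num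
    rw [h3] at hN
    have hAcoe : A = (A.toNNReal : ℝ≥0∞) := (ENNReal.coe_toNNReal ENNReal.ofReal_ne_top).symm
    set τ := ENNReal.ofReal T
    set R := (1 + X) * X ^ 2 + (1 + τ) * (1 + G) * G ^ 2 with hR
    -- The boundary terms are of size G², the resonant term of size G³T and the nonresonant one of
    -- size X³; each is dominated by R.
    have r1 : G ^ 2 ≤ R := by
      refine le_add_left ?_
      exact le_mul_of_one_le_left zero_le
        (one_le_mul_of_one_le_of_one_le le_self_add le_self_add)
    have r2 : G ^ 3 * τ ≤ R := by
      refine le_add_left ?_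
      calc G ^ 3 * τ = τ * G * G ^ 2 := by ring
        _ ≤ _ := by gcongr <;> exact le_add_self
    have r3 : X ^ 3 ≤ R := by
      refine le_add_right ?_
      calc X ^ 3 = X * X ^ 2 := by ring
        _ ≤ _ := by gcongr; exact le_add_self
    calc _ ≤ 2 * (k * G) ^ 2 + 6 * ((A * (G * G)) * (k * G) * τ) + 6 * (K * X ^ 3) := by
          gcongr
      _ = 2 * k ^ 2 * G ^ 2 + 6 * A * k * (G ^ 3 * τ) + 6 * K * X ^ 3 := by ring
      _ ≤ 2 * k ^ 2 * R + 6 * A * k * R + 6 * K * R := by gcongr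
      _ = _ := by
          rw [hAcoe]
          push_cast
          rw [ENNReal.toNNReal_coe]
          ring
  refine ⟨hbound.trans_lt (ENNReal.mul_lt_top ENNReal.coe_lt_top ?_), hbound⟩
  refine ENNReal.add_lt_top.2 ⟨ENNReal.mul_lt_top ?_ (ENNReal.pow_lt_top hX),
    ENNReal.mul_lt_top (ENNReal.mul_lt_top ?_ ?_) (ENNReal.pow_lt_top hG)⟩
  · exact ENNReal.add_lt_top.2 ⟨ENNReal.one_lt_top, hX⟩
  · exact ENNReal.add_lt_top.2 ⟨ENNReal.one_lt_top, ENNReal.ofReal_lt_top⟩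
  · exact ENNReal.add_lt_top.2 ⟨ENNReal.one_lt_top, hG⟩
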